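/- Let $k$ be a field and let $\mathcal V$ be either the category $\mathsf{Vect}$ of vector spaces over $k$ or the category $\mathsf{dgVect}$ of ($\mathbb Z$-graded, unbounded) chain complexes over $k$, with the usual tensor product $\otimes$ (Koszul signs) and internal hom $[-,-]$. Let $X$ be a set (of colours) and let $P$ be a symmetric $X$-coloured operad in $\mathcal V$, with objects of operations $P^{\bar x}_y$ for $y\in X$ and $\bar x=(x_1,\dots,x_n)$ a finite word in $X$; let $S(X)$ be the groupoid of finite words in $X$ and colour-preserving bijections. For $C=(C^x)_{x\in X}\in\mathcal V^X$ put $C^{\otimes\bar x}=C^{x_1}\otimes\dots\otimes C^{x_n}$ and define endofunctors $P^\wedge$, $P^\wedge_2$ of $\mathcal V^X$ by $$P^\wedge(C)^y=\int_{\bar x\in S(X)}\bigl[P^{\bar x}_y,\,C^{\otimes \bar x}\bigr],$$ $$P^\wedge_2(C)^y=\int_{\bar x,\,(\bar z_1,\dots,\bar z_n)}\Bigl[P^{\bar x}_y,\bigl[P^{\bar z_1}_{x_1}\otimes\dots\otimes P^{\bar z_n}_{x_n},\;C^{\otimes\bar z_1}\otimes\dots\otimes C^{\otimes \bar z_n}\bigr]\Bigr],$$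 the end in the second formula being over words $\bar x=(x_1,\dots,x_n)$ and $n$-tuples of words $\bar z_i$, with their isomorphisms (the permutations of the letters of $\bar x$, which permute the $\bar z_i$ too, and the permutations of the letters of each $\bar z_i$). The operad composition induces a natural transformation $\Delta:P^\wedge\to P^\wedge_2$, $(\Delta f)(\mu)(\nu_1\otimes\dots\otimes\nu_n)=f(\mu\circ(\nu_1,\dots,\nu_n))$; the canonical maps $\bigotimes_i[A_i,B_i]\to[\bigotimes_iA_i,\bigotimes_iB_i]$ induce $\alpha:P^\wedge P^\wedge\to P^\wedge_2$; the operad units induce $\varepsilon:P^\wedge\to\mathrm{Id}$. A $P$-coalgebra is an object $C\in\mathcal V^X$ with a map $\delta_C:C\to P^\wedge(C)$ such that $\varepsilon_C\,\delta_C=\mathrm{id}_C$ and $\alpha_C\,P^\wedge(\delta_C)\,\delta_C=\Delta_C\,\delta_C$; a morphism $f:C\to D$ of $P$-coalgebras is a map in $\mathcal V^X$ with $P^\wedge(f)\,\delta_C=\delta_D\,f$. A $P$-coalgebra $E$ with a map $p:E\to C$ in $\mathcal V^X$ is cofree on $C$ if for every $P$-coalgebra $D$ and every map $f:D\to C$ in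 $\mathcal V^X$ there is a unique morphism of $P$-coalgebras $g:D\to E$ with $p\,g=f$. Define functors $Q_n:\mathcal V^X\to\mathcal V^X$ and natural transformations $\chi_{n+1}:Q_{n+1}\to Q_n$, $\delta_{n+1}:Q_{n+1}\to Q_nQ_n$ as follows. Let $Q_0=P^\wedge$; let $Q_1$, with projections $\chi_1:Q_1\to P^\wedge$ and $\delta_1:Q_1\to P^\wedge P^\wedge$, be the fiber product of $\Delta:P^\wedge\to P^\wedge_2$ and $\alpha:P^\wedge P^\wedge\to P^\wedge_2$; and for $n\ge 1$ let $Q_{n+1}$, with projections $\chi_{n+1}:Q_{n+1}\to Q_n$ and $\delta_{n+1}:Q_{n+1}\to Q_nQ_n$, be the limit of the diagram $$Q_n\xrightarrow{\ \delta_n\ }Q_{n-1}Q_{n-1}\xleftarrow{\ \chi_n\chi_n\ }Q_nQ_n\rightrightarrows Q_{n-1}Q_{n-1}Q_{n-1},$$ where the two parallel maps are $\delta_n\chi_n$ and $\chi_n\delta_n$. Let $Q_\infty=\lim(\cdots\to Q_2\to Q_1\to Q_0)$. Then: 1. The recursion stops at the first step: $\chi_{n+1}:Q_{n+1}\to Q_n$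 is an isomorphism for every $n\ge1$, and the projection $Q_\infty\to Q_1$ is an isomorphism. 2. For every $C\in\mathcal V^X$, $Q_1(C)$ is the fiber product of $P^\wedge(C)\xrightarrow{\Delta}P^\wedge_2(C)\xleftarrow{\alpha}P^\wedge(P^\wedge(C))$, the map $\chi_1:Q_1(C)\to P^\wedge(C)$ is a monomorphism, and its image consists exactly of the representative elements, that is of the $f\in P^\wedge(C)^y$ (homogeneous of degree $p$ in the case of $\mathsf{dgVect}$) such that $\Delta f=\alpha g$ for some $g\in P^\wedge(P^\wedge(C))^y$ (of degree $p$). 3. $Q_1$ is the cofree $P$-coalgebra functor: there is a natural transformation $\delta:Q_1\to P^\wedge Q_1$ with $P^\wedge(\chi_1)\,\delta=\delta_1$ such that, for every $C\in\mathcal V^X$, $\delta_C$ is a $P$-coalgebra structure on $Q_1(C)$, and $Q_1(C)$ with the map $Q_1(C)\xrightarrow{\chi_1}P^\wedge(C)\xrightarrow{\varepsilon}C$ is the cofree $P$-coalgebra $P^\vee(C)$ on $C$. -/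

import Mathlib

universe u

namespace OperadCoalg

open CategoryTheory
open PiTensorProduct (map_tprod)
open scoped TensorProduct DirectSum

noncomputable section

set_option linter.unusedSectionVars false

/-! ## Koszul signs -/

/-- The Koszul sign for exchanging two homogeneous elements, in terms of their parities
`u, v = ±1`: it is `-1` if both are odd and `1` otherwise. -/
def koszul (u v : ℤˣ) : ℤˣ := if u = -1 ∧ v = -1 then -1 else 1

lemma koszul_mul_left (u u' v : ℤˣ) : koszul (u * u') v = koszul u v * koszul u' v := by
  revert u u' v; decide

lemma koszul_mul_right (u v v' : ℤˣ) : koszul u (v * v') = koszul u v * koszul u v' := by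
  revert u v v'; decide

lemma koszul_neg_left (u v : ℤˣ) : koszul (-u) v = v * koszul u v := by
  revert u v; decide

lemma koszul_neg_right (u v : ℤˣ) : koszul u (-v) = u * koszul u v := by
  revert u v; decide

lemma koszul_comm (u v : ℤˣ) : koszul u v = koszul v u := by
  revert u v; decide

lemma koszul_prod {ι κ : Type} [Fintype ι] [Fintype κ] (f : ι → ℤˣ) (g : κ → ℤˣ) :
    koszul (∏ i, f i) (∏ j, g j) = ∏ i, ∏ j, koszul (f i) (g j) := by
  let L (v : ℤˣ) : ℤˣ →* ℤˣ := MonoidHom.mk' (fun u => koszul u v) (fun a b => koszul_mul_left a b v)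
  let R (u : ℤˣ) : ℤˣ →* ℤˣ := MonoidHom.mk' (fun v => koszul u v) (fun a b => koszul_mul_right u a b)
  calc _ = ∏ i, koszul (f i) (∏ j, g j) := map_prod (L _) f _
    _ = _ := Finset.prod_congr rfl fun i _ => map_prod (R _) g _

/-- The Koszul sign of a bijection `e` moving the `i`-th of `n` factors of parities `η i` to
position `e i`. -/
def permSign {n m : ℕ} (e : Fin n ≃ Fin m) (η : Fin n → ℤˣ) : ℤˣ :=
  ∏ i, ∏ j, if i < j ∧ e j < e i then koszul (η i) (η j) else 1

/-- The Koszul sign for passing from `f₁ ⊗ ⋯ ⊗ fₙ ⊗ a₁ ⊗ ⋯ ⊗ aₙ` to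
`f₁ ⊗ a₁ ⊗ ⋯ ⊗ fₙ ⊗ aₙ`, in terms of the parities `η` of the `f`s and `θ` of the `a`s. -/
def shuffleSign {n : ℕ} (η θ : Fin n → ℤˣ) : ℤˣ :=
  ∏ i, ∏ j, if i < j then koszul (θ i) (η j) else 1

/-- A sign as a scalar. -/
def sg (k : Type u) [Field k] : ℤˣ →* k :=
  (Int.castRingHom k : ℤ →* k).comp (Units.coeHom ℤ)

@[simp] lemma sg_neg (k : Type u) [Field k] (s : ℤˣ) : sg k (-s) = - sg k s := by
  simp [sg]

lemma sg_mul_self (k : Type u) [Field k] (s : ℤˣ) : sg k s * sg k s = 1 := by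
  rw [← map_mul, Int.units_mul_self, map_one]

/-! ## Graded modules with differential, presented by their total space -/

variable (k : Type u) [Field k] {I : Type} [AddCommGroup I] [DecidableEq I]
  (c : ComplexShape I) [c.TensorSigns]

/-- The total space of a complex, or of an iterated tensor product of complexes: a vector space
`M` spanned by subspaces `deg p` of homogeneous elements, the projections `pr u` onto
the even (`u = 1`) and the odd (`u = -1`) part, and the total differential `d`.
It is only used for `tot` and `tens` below. -/
structure GMod where
  M : Type u
  [grp : AddCommGroup M]
  [mod : Module k M]
  deg : I → Submodule k M
  pr : ℤˣ → M →ₗ[k] M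
  d : M →ₗ[k] M
  span_deg : Submodule.span k {a | ∃ p, a ∈ deg p} = ⊤
  pr_of_mem : ∀ {p a}, a ∈ deg p → ∀ u, pr u a = if c.ε p = u then a else 0
  d_mem : ∀ {p q a}, a ∈ deg p → c.Rel p q → d a ∈ deg q
  d_eq_zero : ∀ {p a}, a ∈ deg p → (∀ q, ¬ c.Rel p q) → d a = 0
  d_d : ∀ a, d (d a) = 0

attribute [instance] GMod.grp GMod.mod

variable {k c}

namespace GMod

/-- The sign operator, multiplication by `(-1)^p` in degree `p`. -/
def sgn (A : GMod k c) : A.M →ₗ[k] A.M := A.pr 1 - A.pr (-1)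

lemma sgn_of_mem (A : GMod k c) {p : I} {a : A.M} (h : a ∈ A.deg p) : A.sgn a = sg k (c.ε p) • a := by
  have h1 := A.pr_of_mem h 1
  have h2 := A.pr_of_mem h (-1)
  simp only [sgn, LinearMap.sub_apply, h1, h2]
  rcases Int.units_eq_one_or (c.ε p) with h | h <;> simp [h]

lemma ext_deg (A : GMod k c) {N : Type u} [AddCommGroup N] [Module k N] {f g : A.M →ₗ[k] N}
    (h : ∀ p, ∀ a ∈ A.deg p, f a = g a) : f = g :=
  LinearMap.ext_on A.span_deg (fun _ ⟨p, ha⟩ => h p _ ha)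

lemma d_cases (A : GMod k c) {p : I} {a : A.M} (h : a ∈ A.deg p) :
    A.d a = 0 ∨ ∃ q, c.Rel p q ∧ A.d a ∈ A.deg q ∧ c.ε q = - c.ε p := by
  by_cases hq : ∃ q, c.Rel p q
  · obtain ⟨q, hq⟩ := hq
    exact Or.inr ⟨q, hq, A.d_mem h hq, c.ε_succ hq⟩
  · push Not at hq
    exact Or.inl (A.d_eq_zero h hq)

lemma sgn_d (A : GMod k c) (a : A.M) : A.sgn (A.d a) = - A.d (A.sgn a) := by
  have : A.sgn ∘ₗ A.d = - (A.d ∘ₗ A.sgn) := by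
    refine A.ext_deg fun p a ha => ?_
    simp only [LinearMap.comp_apply, LinearMap.neg_apply, A.sgn_of_mem ha]
    rcases A.d_cases ha with h | ⟨q, -, hd, hs⟩
    · simp [h]
    · simp [A.sgn_of_mem hd, hs]
  exact LinearMap.congr_fun this a

lemma sgn_sgn (A : GMod k c) (a : A.M) : A.sgn (A.sgn a) = a := by
  have : A.sgn ∘ₗ A.sgn = LinearMap.id := by
    refine A.ext_deg fun p a ha => ?_
    simp only [LinearMap.comp_apply, A.sgn_of_mem ha, LinearMap.id_apply]
    rw [A.sgn_of_mem ((A.deg p).smul_mem _ ha), smul_smul, sg_mul_self, one_smul]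
  exact LinearMap.congr_fun this a

/-- Linear maps of degree zero commuting with the differentials. -/
structure IsHom {A B : GMod k c} (f : A.M →ₗ[k] B.M) : Prop where
  deg : ∀ p, ∀ a ∈ A.deg p, f a ∈ B.deg p
  d : ∀ a, f (A.d a) = B.d (f a)

lemma IsHom.id (A : GMod k c) : IsHom (A := A) (B := A) LinearMap.id :=
  ⟨fun _ _ h => h, fun _ => rfl⟩

lemma IsHom.comp {A B C : GMod k c} {g : B.M →ₗ[k] C.M} {f : A.M →ₗ[k] B.M}
    (hg : IsHom g) (hf : IsHom f) : IsHom (A := A) (B := C) (g ∘ₗ f) :=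
  ⟨fun p a h => hg.deg p _ (hf.deg p a h), fun a => by simp [hf.d, hg.d]⟩

lemma IsHom.sgn {A B : GMod k c} {f : A.M →ₗ[k] B.M} (hf : IsHom f) (a : A.M) :
    f (A.sgn a) = B.sgn (f a) := by
  have : f ∘ₗ A.sgn = B.sgn ∘ₗ f := by
    refine A.ext_deg fun p a ha => ?_
    simp [A.sgn_of_mem ha, B.sgn_of_mem (hf.deg p a ha)]
  exact LinearMap.congr_fun this a

end GMod

/-! ### The total space of a complex -/

variable (k c) in
/-- Complexes of vector spaces of shape `c`. -/
abbrev Cplx := HomologicalComplex (ModuleCat.{u} k) c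

section Tot

/-- The total space `⨁ p, A.X p` of a complex. -/
def tot (A : Cplx k c) : GMod k c where
  M := ⨁ p, A.X p
  deg p := LinearMap.range (DirectSum.lof k I (fun p => A.X p) p)
  pr u := DirectSum.toModule k I _ fun p =>
    if c.ε p = u then DirectSum.lof k I (fun p => A.X p) p else 0
  d := DirectSum.toModule k I _ fun p =>
    DirectSum.lof k I (fun p => A.X p) (c.next p) ∘ₗ (A.d p (c.next p)).hom
  span_deg := by
    rw [eq_top_iff]
    intro a _
    induction a using DirectSum.induction_on with
    | zero => exact zero_mem _
    | of p a => exact Submodule.subset_span ⟨p, a, rfl⟩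
    | add a b ha hb => exact add_mem (ha trivial) (hb trivial)
  pr_of_mem := by
    rintro p _ ⟨a, rfl⟩ u
    rw [DirectSum.toModule_lof]
    split_ifs <;> rfl
  d_mem := by
    rintro p q _ ⟨a, rfl⟩ h
    rw [DirectSum.toModule_lof]
    obtain rfl := c.next_eq' h
    exact ⟨_, rfl⟩
  d_eq_zero := by
    rintro p _ ⟨a, rfl⟩ h
    simp [DirectSum.toModule_lof, A.shape _ _ (h _)]
  d_d := by
    intro a
    induction a using DirectSum.induction_on with
    | zero => simp
    | of p a =>
      rw [← DirectSum.lof_eq_of k, DirectSum.toModule_lof, LinearMap.comp_apply,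
        DirectSum.toModule_lof, LinearMap.comp_apply]
      refine (congrArg _ ?_).trans (map_zero _)
      exact LinearMap.congr_fun (congrArg ModuleCat.Hom.hom (A.d_comp_d _ _ _)) a
    | add a b ha hb => rw [map_add, map_add, ha, hb, add_zero]

/-- The inclusion of the component of degree `p` in the total space. -/
def ι (A : Cplx k c) (p : I) : A.X p →ₗ[k] (tot A).M := DirectSum.lof k I (fun p => A.X p) p

/-- The projection of the total space onto the component of degree `p`. -/
def cproj (A : Cplx k c) (p : I) : (tot A).M →ₗ[k] A.X p := DirectSum.component k I _ p

lemma ι_mem (A : Cplx k c) (p : I) (a : A.X p) : ι A p a ∈ (tot A).deg p := ⟨a, rfl⟩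

lemma tot_ext {A : Cplx k c} {N : Type u} [AddCommGroup N] [Module k N]
    {f g : (tot A).M →ₗ[k] N} (h : ∀ p a, f (ι A p a) = g (ι A p a)) : f = g :=
  (tot A).ext_deg (by rintro p _ ⟨a, rfl⟩; exact h p a)

lemma d_ι (A : Cplx k c) {p q : I} (h : c.Rel p q) (a : A.X p) :
    (tot A).d (ι A p a) = ι A q ((A.d p q).hom a) := by
  obtain rfl := c.next_eq' h
  exact DirectSum.toModule_lof k (M := fun p => A.X p) (N := ⨁ p, A.X p) p a

lemma d_ι_zero (A : Cplx k c) {p : I} (h : ∀ q, ¬ c.Rel p q) (a : A.X p) :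
    (tot A).d (ι A p a) = 0 := (tot A).d_eq_zero (ι_mem A p a) h

lemma cproj_ι (A : Cplx k c) (p : I) (a : A.X p) : cproj A p (ι A p a) = a :=
  DirectSum.component.lof_self _ _ _

lemma ι_cproj (A : Cplx k c) {p : I} {a : (tot A).M} (h : a ∈ (tot A).deg p) :
    ι A p (cproj A p a) = a := by
  obtain ⟨b, rfl⟩ := h
  exact congrArg _ (cproj_ι A p b)

/-- The map of total spaces induced by a chain map. -/
def totMap {A B : Cplx k c} (f : A ⟶ B) : (tot A).M →ₗ[k] (tot B).M :=
  DirectSum.toModule k I _ fun p => ι B p ∘ₗ (f.f p).hom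

lemma totMap_ι {A B : Cplx k c} (f : A ⟶ B) (p : I) (a : A.X p) :
    totMap f (ι A p a) = ι B p ((f.f p).hom a) := DirectSum.toModule_lof _ _ _

lemma totMap_isHom {A B : Cplx k c} (f : A ⟶ B) : GMod.IsHom (totMap f) where
  deg := by rintro p _ ⟨a, rfl⟩; exact ⟨_, (totMap_ι f p a).symm⟩
  d a := by
    have : totMap f ∘ₗ (tot A).d = (tot B).d ∘ₗ totMap f := by
      refine tot_ext fun p a => ?_
      by_cases h : ∃ q, c.Rel p q
      · obtain ⟨q, h⟩ := h
        simp only [LinearMap.comp_apply, d_ι A h, totMap_ι, d_ι B h]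
        exact congrArg (ι B q) (LinearMap.congr_fun (congrArg ModuleCat.Hom.hom (f.comm p q)) a).symm
      · push Not at h
        simp only [LinearMap.comp_apply, d_ι_zero A h, totMap_ι, d_ι_zero B h, map_zero]
    exact LinearMap.congr_fun this a

lemma totMap_id (A : Cplx k c) : totMap (𝟙 A) = LinearMap.id :=
  tot_ext fun p a => by simp [totMap_ι]

lemma totMap_comp {A B C : Cplx k c} (f : A ⟶ B) (g : B ⟶ C) :
    totMap (f ≫ g) = totMap g ∘ₗ totMap f :=
  tot_ext fun p a => by simp [totMap_ι]

end Tot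

/-! ### Tensor products -/

section Tens

lemma map_ext {n : ℕ} {A : Fin n → GMod k c} {N : Type u} [AddCommGroup N] [Module k N]
    {f g : (⨂[k] i, (A i).M) →ₗ[k] N}
    (h : ∀ (p : Fin n → I) (a : ∀ i, (A i).M), (∀ i, a i ∈ (A i).deg (p i)) →
      f (PiTensorProduct.tprod k a) = g (PiTensorProduct.tprod k a)) : f = g := by
  refine PiTensorProduct.ext_of_span_eq_top
    (γ := fun i => {a : (A i).M // ∃ p, a ∈ (A i).deg p}) (g := fun i a => a.1) ?_ ?_
  · intro i
    rw [Subtype.range_coe_subtype]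
    exact (A i).span_deg
  · intro j
    choose p hp using fun i => (j i).2
    exact h p _ hp

/-- The operator `σ ⊗ ⋯ ⊗ σ ⊗ d ⊗ 1 ⊗ ⋯ ⊗ 1`, with `d` in position `i` and `σ` the sign
operator. -/
def tensDAt {n : ℕ} (A : Fin n → GMod k c) (i j : Fin n) : (A j).M →ₗ[k] (A j).M :=
  if j < i then (A j).sgn else if j = i then (A j).d else LinearMap.id

/-- The differential of a tensor product. -/
def tensD {n : ℕ} (A : Fin n → GMod k c) : (⨂[k] i, (A i).M) →ₗ[k] ⨂[k] i, (A i).M :=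
  ∑ i, PiTensorProduct.map (tensDAt A i)

lemma tprod_sg_smul {n : ℕ} {M : Fin n → Type u} [∀ i, AddCommGroup (M i)]
    [∀ i, Module k (M i)] (s : Fin n → ℤˣ) (a : ∀ i, M i) :
    PiTensorProduct.tprod k (fun i => sg k (s i) • a i) =
      sg k (∏ i, s i) • PiTensorProduct.tprod k a := by
  rw [map_prod]
  exact (PiTensorProduct.tprod k (s := M)).map_smul_univ (fun i => sg k (s i)) a

lemma map_tensDAt_tprod {n : ℕ} (A : Fin n → GMod k c) (i : Fin n) {p : Fin n → I}
    {a : ∀ i, (A i).M} (h : ∀ i, a i ∈ (A i).deg (p i)) :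
    PiTensorProduct.map (tensDAt A i) (PiTensorProduct.tprod k a) =
      sg k (∏ j, if j < i then c.ε (p j) else 1) •
        PiTensorProduct.tprod k (Function.update a i ((A i).d (a i))) := by
  rw [map_tprod, ← tprod_sg_smul]
  congr 1
  funext j
  by_cases h1 : j < i
  · simp [tensDAt, h1, (A j).sgn_of_mem (h j), Function.update_of_ne h1.ne]
  · by_cases h2 : j = i
    · subst h2; simp [tensDAt]
    · simp [tensDAt, h1, h2]

lemma tensD_tprod {n : ℕ} (A : Fin n → GMod k c) {p : Fin n → I}
    {a : ∀ i, (A i).M} (h : ∀ i, a i ∈ (A i).deg (p i)) :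
    tensD A (PiTensorProduct.tprod k a) = ∑ i, sg k (∏ j, if j < i then c.ε (p j) else 1) •
        PiTensorProduct.tprod k (Function.update a i ((A i).d (a i))) := by
  simp only [tensD, LinearMap.sum_apply, map_tensDAt_tprod A _ h]

lemma update_mem {n : ℕ} {A : Fin n → GMod k c} {p : Fin n → I} {a : ∀ i, (A i).M}
    (h : ∀ i, a i ∈ (A i).deg (p i)) (i : Fin n) {q : I} {b : (A i).M} (hb : b ∈ (A i).deg q)
    (j : Fin n) : Function.update a i b j ∈ (A j).deg (Function.update p i q j) := by
  by_cases hj : j = i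
  · subst hj; simpa using hb
  · simpa [hj] using h j

lemma tprod_update_zero {n : ℕ} {M : Fin n → Type u} [∀ i, AddCommGroup (M i)]
    [∀ i, Module k (M i)] (a : ∀ i, M i) (i : Fin n) :
    PiTensorProduct.tprod k (Function.update a i 0) = 0 :=
  (PiTensorProduct.tprod k (s := M)).map_coord_zero i (by simp)

lemma rel_sum {n : ℕ} (p : Fin n → I) (i : Fin n) {q : I} (h : c.Rel (p i) q) :
    c.Rel (∑ j, p j) (∑ j, Function.update p i q j) := by
  rw [Finset.sum_update_of_mem (Finset.mem_univ i), ← Finset.add_sum_erase _ p (Finset.mem_univ i),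
    Finset.sdiff_singleton_eq_erase]
  exact c.rel_add h _

lemma ε_sum {ι : Type} [Fintype ι] (p : ι → I) : c.ε (∑ i, p i) = ∏ i, c.ε (p i) := by
  classical
  have : ∀ s : Finset ι, c.ε (∑ i ∈ s, p i) = ∏ i ∈ s, c.ε (p i) := by
    intro s
    induction s using Finset.induction_on with
    | empty => simp
    | insert a s ha ih => rw [Finset.sum_insert ha, Finset.prod_insert ha, c.ε_add, ih]
  exact this _

/-- The homogeneous elements of degree `p` of a tensor product. -/
def tensDeg {n : ℕ} (A : Fin n → GMod k c) (p : I) : Submodule k (⨂[k] i, (A i).M) :=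
  Submodule.span k {t | ∃ (q : Fin n → I) (a : ∀ i, (A i).M),
    (∀ i, a i ∈ (A i).deg (q i)) ∧ ∑ i, q i = p ∧ t = PiTensorProduct.tprod k a}

lemma tprod_mem {n : ℕ} {A : Fin n → GMod k c} {p : Fin n → I} {a : ∀ i, (A i).M}
    (h : ∀ i, a i ∈ (A i).deg (p i)) : PiTensorProduct.tprod k a ∈ tensDeg A (∑ i, p i) :=
  Submodule.subset_span ⟨p, a, h, rfl, rfl⟩

/-- The tensor product `A₁ ⊗ ⋯ ⊗ Aₙ`. -/
def tens {n : ℕ} (A : Fin n → GMod k c) : GMod k c where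
  M := ⨂[k] i, (A i).M
  deg p := tensDeg A p
  pr u := ∑ η : Fin n → ℤˣ, if ∏ i, η i = u then
    PiTensorProduct.map (fun i => (A i).pr (η i)) else 0
  d := tensD A
  span_deg := by
    have h := PiTensorProduct.submodule_span_eq_top (R := k) (M := fun i => (A i).M)
      (γ := fun i => {a : (A i).M // ∃ p, a ∈ (A i).deg p}) (g := fun i a => a.1) (by
        intro i
        rw [Subtype.range_coe_subtype]
        exact (A i).span_deg)
    rw [eq_top_iff, ← h, Submodule.span_le]
    rintro _ ⟨j, rfl⟩
    choose p hp using fun i => (j i).2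
    exact Submodule.subset_span ⟨∑ i, p i, Submodule.subset_span ⟨p, _, hp, rfl, rfl⟩⟩
  pr_of_mem := by
    intro p t ht u
    induction ht using Submodule.span_induction with
    | mem t ht =>
      obtain ⟨q, a, ha, rfl, rfl⟩ := ht
      rw [LinearMap.sum_apply, Finset.sum_eq_single (fun i => c.ε (q i))]
      · rw [ε_sum]
        split_ifs
        · rw [map_tprod]
          congr 1
          funext i
          rw [(A i).pr_of_mem (ha i), if_pos rfl]
        · rfl
      · intro η _ hη
        split_ifs
        · obtain ⟨i, hi⟩ := Function.ne_iff.1 hη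
          rw [map_tprod]
          refine (PiTensorProduct.tprod k).map_coord_zero i ?_
          rw [(A i).pr_of_mem (ha i), if_neg (Ne.symm hi)]
        · rfl
      · simp
    | zero => simp
    | add a b _ _ ha hb => rw [map_add, ha, hb]; split_ifs <;> simp
    | smul r a _ ha => rw [map_smul, ha]; split_ifs <;> simp
  d_mem := by
    intro p q t ht hpq
    induction ht using Submodule.span_induction with
    | mem t ht =>
      obtain ⟨p', a, ha, rfl, rfl⟩ := ht
      rw [tensD_tprod A ha]
      refine Submodule.sum_mem _ fun i _ => Submodule.smul_mem _ _ ?_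
      rcases (A i).d_cases (ha i) with h | ⟨q', h1, h2, -⟩
      · rw [h, tprod_update_zero]; exact zero_mem _
      · refine Submodule.subset_span ⟨_, _, update_mem ha i h2, ?_, rfl⟩
        exact c.next_eq (rel_sum p' i h1) hpq
    | zero => simp
    | add a b _ _ ha hb => rw [map_add]; exact add_mem ha hb
    | smul r a _ ha => rw [map_smul]; exact Submodule.smul_mem _ _ ha
  d_eq_zero := by
    intro p t ht hp
    induction ht using Submodule.span_induction with
    | mem t ht =>
      obtain ⟨p', a, ha, rfl, rfl⟩ := ht
      rw [tensD_tprod A ha]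
      refine Finset.sum_eq_zero fun i _ => ?_
      rcases (A i).d_cases (ha i) with h | ⟨q', h1, h2, -⟩
      · rw [h, tprod_update_zero, smul_zero]
      · exact (hp _ (rel_sum p' i h1)).elim
    | zero => simp
    | add a b _ _ ha hb => rw [map_add, ha, hb, add_zero]
    | smul r a _ ha => rw [map_smul, ha, smul_zero]
  d_d := by
    intro t
    have : tensD A ∘ₗ tensD A = 0 := by
      have hsum : tensD A ∘ₗ tensD A = ∑ x : Fin n × Fin n,
          PiTensorProduct.map (fun l => tensDAt A x.1 l ∘ₗ tensDAt A x.2 l) := by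
        rw [Fintype.sum_prod_type]
        refine LinearMap.ext fun t => ?_
        simp [tensD, PiTensorProduct.map_comp]
      have key : ∀ i j : Fin n, i < j →
          PiTensorProduct.map (fun l => tensDAt A i l ∘ₗ tensDAt A j l) +
          PiTensorProduct.map (fun l => tensDAt A j l ∘ₗ tensDAt A i l) = 0 := by
        intro i j hij
        have h1 : (fun l => tensDAt A i l ∘ₗ tensDAt A j l) =
            Function.update (fun l => tensDAt A j l ∘ₗ tensDAt A i l) i
              ((-1 : k) • (tensDAt A j i ∘ₗ tensDAt A i i)) := by
          funext l
          by_cases hl : l = i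
          · subst hl
            ext a
            simp [tensDAt, hij, (A l).sgn_d]
          · rw [Function.update_of_ne hl]
            by_cases h2 : l < i
            · simp [tensDAt, h2, h2.trans hij]
            · by_cases h3 : l < j
              · simp [tensDAt, h2, h3, hl]
              · simp [tensDAt, h2, h3, hl]
        rw [h1, PiTensorProduct.map_update_smul, Function.update_eq_self]
        refine LinearMap.ext fun t => ?_
        simp only [LinearMap.add_apply, LinearMap.smul_apply, LinearMap.zero_apply]
        rw [neg_smul, one_smul, neg_add_cancel]
      rw [hsum]
      refine Finset.sum_involution (fun x _ => x.swap) ?_ ?_ (by simp) (by simp)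
      · rintro ⟨i, j⟩ -
        rcases lt_trichotomy i j with h | h | h
        · exact key i j h
        · subst h
          have : PiTensorProduct.map (fun l => tensDAt A i l ∘ₗ tensDAt A i l) = 0 := by
            refine PiTensorProduct.ext (MultilinearMap.ext fun a => ?_)
            simp only [LinearMap.compMultilinearMap_apply, map_tprod, LinearMap.zero_apply]
            exact (PiTensorProduct.tprod k).map_coord_zero i (by simp [tensDAt, (A i).d_d])
          simp [this]
        · rw [add_comm]; exact key j i h
      · rintro ⟨i, j⟩ - hne heq
        obtain rfl : j = i := congrArg Prod.fst heq
        refine hne (PiTensorProduct.ext (MultilinearMap.ext fun a => ?_))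
        simp only [LinearMap.compMultilinearMap_apply, map_tprod, LinearMap.zero_apply]
        exact (PiTensorProduct.tprod k).map_coord_zero j (by simp [tensDAt, (A j).d_d])
    exact LinearMap.congr_fun this t

end Tens

section Perm

lemma piCongrLeft_update {n m : ℕ} {B : Fin m → Type u} (e : Fin n ≃ Fin m)
    (v : ∀ i, B (e i)) (i : Fin n) (x : B (e i)) :
    Equiv.piCongrLeft B e (Function.update v i x) =
      Function.update (Equiv.piCongrLeft B e v) (e i) x := by
  funext j
  obtain ⟨l, rfl⟩ := e.surjective j
  rw [Equiv.piCongrLeft_apply_apply]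
  by_cases h : l = i
  · subst h; simp
  · rw [Function.update_of_ne h, Function.update_of_ne (e.injective.ne h),
      Equiv.piCongrLeft_apply_apply]

/-- The map `v₁ ⊗ ⋯ ⊗ vₙ ↦ w₁ ⊗ ⋯ ⊗ wₙ` with `w_{e i} = vᵢ`, without sign. -/
def relabel {n m : ℕ} (e : Fin n ≃ Fin m) (B : Fin m → GMod k c) :
    (⨂[k] i, (B (e i)).M) →ₗ[k] ⨂[k] j, (B j).M :=
  PiTensorProduct.lift
    (MultilinearMap.mk'
      (fun v => PiTensorProduct.tprod k (Equiv.piCongrLeft (fun j => (B j).M) e v))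
      (fun v i x y => by
        simp only [piCongrLeft_update, MultilinearMap.map_update_add])
      (fun v i r x => by
        simp only [piCongrLeft_update, MultilinearMap.map_update_smul]))

lemma relabel_tprod {n m : ℕ} (e : Fin n ≃ Fin m) (B : Fin m → GMod k c) (v : ∀ i, (B (e i)).M) :
    relabel e B (PiTensorProduct.tprod k v) =
      PiTensorProduct.tprod k (Equiv.piCongrLeft (fun j => (B j).M) e v) :=
  PiTensorProduct.lift.tprod _

/-- The map `A₁ ⊗ ⋯ ⊗ Aₙ → B₁ ⊗ ⋯ ⊗ Bₙ` that applies `φ i : A i → B (e i)` to the `i`-th factor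
and moves it to position `e i`, with the Koszul sign of `e`. -/
def permLin {n m : ℕ} {A : Fin n → GMod k c} {B : Fin m → GMod k c} (e : Fin n ≃ Fin m)
    (φ : ∀ i, (A i).M →ₗ[k] (B (e i)).M) : (⨂[k] i, (A i).M) →ₗ[k] ⨂[k] j, (B j).M :=
  ∑ η : Fin n → ℤˣ, sg k (permSign e η) •
    (relabel e B ∘ₗ PiTensorProduct.map (fun i => φ i ∘ₗ (A i).pr (η i)))

lemma permLin_tprod {n m : ℕ} {A : Fin n → GMod k c} {B : Fin m → GMod k c} (e : Fin n ≃ Fin m)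
    (φ : ∀ i, (A i).M →ₗ[k] (B (e i)).M) {p : Fin n → I} {a : ∀ i, (A i).M}
    (h : ∀ i, a i ∈ (A i).deg (p i)) :
    permLin e φ (PiTensorProduct.tprod k a) = sg k (permSign e fun i => c.ε (p i)) •
      PiTensorProduct.tprod k (Equiv.piCongrLeft (fun j => (B j).M) e fun i => φ i (a i)) := by
  rw [permLin, LinearMap.sum_apply, Finset.sum_eq_single (fun i => c.ε (p i))]
  · rw [LinearMap.smul_apply, LinearMap.comp_apply, map_tprod, relabel_tprod]
    congr 4
    funext i
    rw [LinearMap.comp_apply, (A i).pr_of_mem (h i), if_pos rfl]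
  · intro η _ hη
    obtain ⟨i, hi⟩ := Function.ne_iff.1 hη
    rw [LinearMap.smul_apply, LinearMap.comp_apply, map_tprod, MultilinearMap.map_coord_zero,
      map_zero, smul_zero]
    · exact i
    · rw [LinearMap.comp_apply, (A i).pr_of_mem (h i), if_neg (Ne.symm hi), map_zero]
  · simp

/-- The pure tensor of a family, as an element of the total space of the tensor product. -/
def pure {n : ℕ} {A : Fin n → GMod k c} (a : ∀ i, (A i).M) : (tens A).M :=
  PiTensorProduct.tprod k a

lemma tens_ext {n : ℕ} {A : Fin n → GMod k c} {N : Type u} [AddCommGroup N] [Module k N]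
    {f g : (tens A).M →ₗ[k] N}
    (h : ∀ (p : Fin n → I) (a : ∀ i, (A i).M), (∀ i, a i ∈ (A i).deg (p i)) →
      f (pure a) = g (pure a)) : f = g := map_ext h

lemma pure_mem {n : ℕ} {A : Fin n → GMod k c} {p : Fin n → I} {a : ∀ i, (A i).M}
    (h : ∀ i, a i ∈ (A i).deg (p i)) : pure a ∈ (tens A).deg (∑ i, p i) := tprod_mem h

lemma pure_update_zero {n : ℕ} {A : Fin n → GMod k c} (a : ∀ i, (A i).M) (i : Fin n) :
    pure (Function.update a i 0) = 0 := tprod_update_zero a i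

lemma pure_eq_zero {n : ℕ} {A : Fin n → GMod k c} {a : ∀ i, (A i).M} (i : Fin n) (h : a i = 0) :
    pure a = 0 := (PiTensorProduct.tprod k).map_coord_zero i h

lemma pure_sg_smul {n : ℕ} {A : Fin n → GMod k c} (s : Fin n → ℤˣ) (a : ∀ i, (A i).M) :
    pure (fun i => sg k (s i) • a i) = sg k (∏ i, s i) • pure a := tprod_sg_smul s a

lemma d_pure {n : ℕ} (A : Fin n → GMod k c) {p : Fin n → I}
    {a : ∀ i, (A i).M} (h : ∀ i, a i ∈ (A i).deg (p i)) :
    (tens A).d (pure a) = ∑ i, sg k (∏ j, if j < i then c.ε (p j) else 1) •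
        pure (Function.update a i ((A i).d (a i))) := tensD_tprod A h

lemma mem_tens_induction {n : ℕ} {A : Fin n → GMod k c} {p : I} {t : (tens A).M}
    (ht : t ∈ (tens A).deg p) (S : Submodule k (tens A).M)
    (h : ∀ (q : Fin n → I) (a : ∀ i, (A i).M), (∀ i, a i ∈ (A i).deg (q i)) → ∑ i, q i = p →
      pure a ∈ S) : t ∈ S := by
  refine (Submodule.span_le (p := S)).2 ?_ ht
  rintro _ ⟨q, a, h1, h2, rfl⟩
  exact h q a h1 h2

/-- The map `permLin` on total spaces of tensor products. -/
def permMap {n m : ℕ} {A : Fin n → GMod k c} {B : Fin m → GMod k c} (e : Fin n ≃ Fin m)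
    (φ : ∀ i, (A i).M →ₗ[k] (B (e i)).M) : (tens A).M →ₗ[k] (tens B).M := permLin e φ

lemma permMap_pure {n m : ℕ} {A : Fin n → GMod k c} {B : Fin m → GMod k c} (e : Fin n ≃ Fin m)
    (φ : ∀ i, (A i).M →ₗ[k] (B (e i)).M) {p : Fin n → I} {a : ∀ i, (A i).M}
    (h : ∀ i, a i ∈ (A i).deg (p i)) :
    permMap e φ (pure a) = sg k (permSign e fun i => c.ε (p i)) •
      pure (A := B) (Equiv.piCongrLeft (fun j => (B j).M) e fun i => φ i (a i)) :=
  permLin_tprod e φ h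

lemma permSign_update {n m : ℕ} (e : Fin n ≃ Fin m) (η : Fin n → ℤˣ) (i : Fin n) :
    permSign e (Function.update η i (-η i)) =
      (∏ j, if j < i ∧ e i < e j ∨ i < j ∧ e j < e i then η j else 1) * permSign e η := by
  have h : ∀ a b : Fin n, (if a < b ∧ e b < e a then
        koszul (Function.update η i (-η i) a) (Function.update η i (-η i) b) else 1) =
      ((if b = i then (if a < i ∧ e i < e a then η a else 1) else 1) *
        (if a = i then (if i < b ∧ e b < e i then η b else 1) else 1)) *
      (if a < b ∧ e b < e a then koszul (η a) (η b) else 1) := by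
    intro a b
    by_cases hab : a < b ∧ e b < e a
    · rw [if_pos hab, if_pos hab]
      by_cases ha : a = i
      · subst ha
        simp [hab, hab.1.ne', koszul_neg_left]
      · by_cases hb : b = i
        · subst hb
          simp [hab, ha, koszul_neg_right]
        · simp [ha, hb]
    · rw [if_neg hab, if_neg hab]
      by_cases ha : a = i
      · subst ha
        by_cases hb : b = a
        · subst hb; simp
        · simp only [hb, if_false, if_true, if_neg hab, mul_one]
      · by_cases hb : b = i
        · subst hb; simp [hab, ha]
        · simp [ha, hb]
  unfold permSign
  simp only [h, Finset.prod_mul_distrib]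
  congr 1
  have h1 : ∀ a : Fin n, (∏ b, if b = i then (if a < i ∧ e i < e a then η a else 1) else 1) =
      if a < i ∧ e i < e a then η a else 1 := fun a => by simp
  have h2 : (∏ a, ∏ b, if a = i then (if i < b ∧ e b < e i then η b else 1) else 1) =
      ∏ b, if i < b ∧ e b < e i then η b else 1 := by
    rw [Finset.prod_comm]; simp
  simp only [h1, h2]
  rw [← Finset.prod_mul_distrib]
  refine Finset.prod_congr rfl fun j _ => ?_
  by_cases h3 : j < i
  · simp [h3, not_lt_of_gt h3]
  · by_cases h4 : i < j
    · simp [h3, h4]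
    · simp [h3, h4]

lemma eps_update {n : ℕ} {p : Fin n → I} {i : Fin n} {q : I} (h : c.ε q = - c.ε (p i)) :
    (fun j => c.ε (Function.update p i q j)) =
      Function.update (fun j => c.ε (p j)) i (- c.ε (p i)) := by
  funext j
  by_cases hj : j = i
  · subst hj; simp [h]
  · simp [hj]

lemma piCongrLeft_mem {n m : ℕ} {B : Fin m → GMod k c} (e : Fin n ≃ Fin m)
    {p : Fin n → I} {b : ∀ i, (B (e i)).M} (h : ∀ i, b i ∈ (B (e i)).deg (p i)) (j : Fin m) :
    Equiv.piCongrLeft (fun j => (B j).M) e b j ∈ (B j).deg (p (e.symm j)) := by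
  obtain ⟨i, rfl⟩ := e.surjective j
  rw [Equiv.piCongrLeft_apply_apply, Equiv.symm_apply_apply]
  exact h i

lemma permMap_isHom {n m : ℕ} {A : Fin n → GMod k c} {B : Fin m → GMod k c} (e : Fin n ≃ Fin m)
    {φ : ∀ i, (A i).M →ₗ[k] (B (e i)).M} (hφ : ∀ i, GMod.IsHom (φ i)) :
    GMod.IsHom (permMap e φ) where
  deg p t ht := by
    refine mem_tens_induction ht (((tens B).deg p).comap (permMap e φ)) ?_
    rintro q a ha rfl
    rw [Submodule.mem_comap, permMap_pure e φ ha, ← Equiv.sum_comp e.symm q]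
    exact Submodule.smul_mem _ _ (pure_mem (piCongrLeft_mem e fun i => (hφ i).deg _ _ (ha i)))
  d t := by
    have : permMap e φ ∘ₗ (tens A).d = (tens B).d ∘ₗ permMap e φ := by
      refine tens_ext fun p a ha => ?_
      have ha' := piCongrLeft_mem e fun i => (hφ i).deg _ _ (ha i)
      rw [LinearMap.comp_apply, LinearMap.comp_apply, permMap_pure e φ ha, map_smul,
        d_pure B ha', d_pure A ha, map_sum, Finset.smul_sum, ← Equiv.sum_comp e]
      refine Finset.sum_congr rfl fun i _ => ?_
      rw [map_smul, Equiv.piCongrLeft_apply_apply, ← (hφ i).d, ← piCongrLeft_update]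
      rcases (A i).d_cases (ha i) with h0 | ⟨q, -, hq, hs⟩
      · rw [h0, pure_update_zero, map_zero, map_zero, pure_eq_zero (e i), smul_zero, smul_zero,
          smul_zero]
        rw [Equiv.piCongrLeft_apply_apply, Function.update_self]
      · rw [permMap_pure e φ (update_mem ha i hq), eps_update hs, permSign_update, smul_smul,
          smul_smul, ← map_mul, ← map_mul]
        congr 1
        · congr 1
          rw [← mul_assoc, mul_comm (permSign _ _)]
          congr 1
          rw [← Equiv.prod_comp e fun j => if j < e i then c.ε (p (e.symm j)) else 1,
            ← Finset.prod_mul_distrib]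
          refine Finset.prod_congr rfl fun j _ => ?_
          rw [Equiv.symm_apply_apply]
          rcases lt_trichotomy j i with h | h | h
          · rcases lt_or_gt_of_ne (e.injective.ne h.ne) with h' | h'
            · simp [h, h', not_lt_of_gt h, not_lt_of_gt h']
            · simp [h, h', not_lt_of_gt h, not_lt_of_gt h', Int.units_mul_self]
          · subst h; simp
          · rcases lt_or_gt_of_ne (e.injective.ne h.ne') with h' | h'
            · simp [h, h', not_lt_of_gt h, not_lt_of_gt h']
            · simp [h, h', not_lt_of_gt h, not_lt_of_gt h']
        · congr 2
          funext l
          by_cases hl : l = i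
          · subst hl; simp
          · simp [hl]
    exact LinearMap.congr_fun this t

/-- The map `A₁ ⊗ ⋯ ⊗ Aₙ → B₁ ⊗ ⋯ ⊗ Bₙ` induced by maps `Aᵢ → Bᵢ` of degree zero. -/
def tensMap {n : ℕ} {A B : Fin n → GMod k c} (φ : ∀ i, (A i).M →ₗ[k] (B i).M) :
    (tens A).M →ₗ[k] (tens B).M := PiTensorProduct.map φ

lemma tensMap_pure {n : ℕ} {A B : Fin n → GMod k c} (φ : ∀ i, (A i).M →ₗ[k] (B i).M)
    (a : ∀ i, (A i).M) : tensMap φ (pure a) = pure (A := B) fun i => φ i (a i) := map_tprod _ _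

lemma tensMap_isHom {n : ℕ} {A B : Fin n → GMod k c} {φ : ∀ i, (A i).M →ₗ[k] (B i).M}
    (hφ : ∀ i, GMod.IsHom (φ i)) : GMod.IsHom (tensMap φ) where
  deg p t ht := by
    refine mem_tens_induction ht (((tens B).deg p).comap (tensMap φ)) ?_
    rintro q a ha rfl
    rw [Submodule.mem_comap, tensMap_pure]
    exact pure_mem fun i => (hφ i).deg _ _ (ha i)
  d t := by
    have : tensMap φ ∘ₗ (tens A).d = (tens B).d ∘ₗ tensMap φ := by
      refine tens_ext fun p a ha => ?_
      rw [LinearMap.comp_apply, LinearMap.comp_apply, tensMap_pure,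
        d_pure B fun i => (hφ i).deg _ _ (ha i), d_pure A ha, map_sum]
      refine Finset.sum_congr rfl fun i _ => ?_
      rw [map_smul, tensMap_pure, ← (hφ i).d]
      congr 2
      funext l
      by_cases hl : l = i
      · subst hl; simp
      · simp [hl]
    exact LinearMap.congr_fun this t

lemma tensMap_id {n : ℕ} (A : Fin n → GMod k c) :
    tensMap (A := A) (B := A) (fun _ => LinearMap.id) = LinearMap.id := PiTensorProduct.map_id

lemma tensMap_comp {n : ℕ} {A B C : Fin n → GMod k c} (φ : ∀ i, (A i).M →ₗ[k] (B i).M)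
    (ψ : ∀ i, (B i).M →ₗ[k] (C i).M) :
    tensMap (A := A) (B := C) (fun i => ψ i ∘ₗ φ i) = tensMap ψ ∘ₗ tensMap φ :=
  PiTensorProduct.map_comp _ _

lemma permMap_tensMap {n m : ℕ} {A A' : Fin n → GMod k c} {B B' : Fin m → GMod k c}
    (e : Fin n ≃ Fin m) {φ : ∀ i, (A i).M →ₗ[k] (B (e i)).M} {φ' : ∀ i, (A' i).M →ₗ[k] (B' (e i)).M}
    {f : ∀ i, (A i).M →ₗ[k] (A' i).M} {g : ∀ j, (B j).M →ₗ[k] (B' j).M}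
    (hf : ∀ i, GMod.IsHom (f i)) (h : ∀ i a, φ' i (f i a) = g (e i) (φ i a)) (t : (tens A).M) :
    permMap e φ' (tensMap f t) = tensMap g (permMap e φ t) := by
  have : permMap e φ' ∘ₗ tensMap f = tensMap g ∘ₗ permMap e φ := by
    refine tens_ext fun p a ha => ?_
    rw [LinearMap.comp_apply, LinearMap.comp_apply, tensMap_pure, permMap_pure e φ ha,
      permMap_pure e φ' fun i => (hf i).deg _ _ (ha i), map_smul, tensMap_pure]
    congr 2
    funext j
    obtain ⟨i, rfl⟩ := e.surjective j
    rw [Equiv.piCongrLeft_apply_apply, Equiv.piCongrLeft_apply_apply, h]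
  exact LinearMap.congr_fun this t

end Perm

section Pairing

/-- A pairing `G ⊗ A → B` of degree zero which is compatible with the differentials. -/
structure IsPairing {G A B : GMod k c} (ev : G.M →ₗ[k] A.M →ₗ[k] B.M) : Prop where
  deg : ∀ p q, ∀ g ∈ G.deg p, ∀ a ∈ A.deg q, ev g a ∈ B.deg (p + q)
  d : ∀ g a, B.d (ev g a) = ev (G.d g) a + ev (G.sgn g) (A.d a)

/-- For bilinear maps `ev i : G i → A i → B i`, the bilinear map
`g₁ ⊗ ⋯ ⊗ gₙ, a₁ ⊗ ⋯ ⊗ aₙ ↦ ± ev g₁ a₁ ⊗ ⋯ ⊗ ev gₙ aₙ` with the Koszul sign of the shuffle. -/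
def pairLin {n : ℕ} {G A B : Fin n → GMod k c} (ev : ∀ i, (G i).M →ₗ[k] (A i).M →ₗ[k] (B i).M) :
    (⨂[k] i, (G i).M) →ₗ[k] (⨂[k] i, (A i).M) →ₗ[k] ⨂[k] i, (B i).M :=
  ∑ η : Fin n → ℤˣ, ∑ θ : Fin n → ℤˣ, sg k (shuffleSign η θ) •
    PiTensorProduct.map₂ fun i => (ev i).compl₁₂ ((G i).pr (η i)) ((A i).pr (θ i))

lemma pairLin_tprod {n : ℕ} {G A B : Fin n → GMod k c}
    (ev : ∀ i, (G i).M →ₗ[k] (A i).M →ₗ[k] (B i).M) {p q : Fin n → I}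
    {g : ∀ i, (G i).M} {a : ∀ i, (A i).M}
    (hg : ∀ i, g i ∈ (G i).deg (p i)) (ha : ∀ i, a i ∈ (A i).deg (q i)) :
    pairLin ev (PiTensorProduct.tprod k g) (PiTensorProduct.tprod k a) =
      sg k (shuffleSign (fun i => c.ε (p i)) (fun i => c.ε (q i))) •
        PiTensorProduct.tprod k fun i => ev i (g i) (a i) := by
  simp only [pairLin, LinearMap.sum_apply, LinearMap.smul_apply, PiTensorProduct.map₂_tprod_tprod,
    LinearMap.compl₁₂_apply]
  rw [Finset.sum_eq_single (fun i => c.ε (p i)), Finset.sum_eq_single (fun i => c.ε (q i))]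
  · congr 2
    funext i
    rw [(G i).pr_of_mem (hg i), if_pos rfl, (A i).pr_of_mem (ha i), if_pos rfl]
  · intro θ _ hθ
    obtain ⟨i, hi⟩ := Function.ne_iff.1 hθ
    rw [MultilinearMap.map_coord_zero _ i, smul_zero]
    rw [(A i).pr_of_mem (ha i), if_neg (Ne.symm hi), map_zero]
  · simp
  · intro η _ hη
    obtain ⟨i, hi⟩ := Function.ne_iff.1 hη
    refine Finset.sum_eq_zero fun θ _ => ?_
    rw [MultilinearMap.map_coord_zero _ i, smul_zero]
    rw [(G i).pr_of_mem (hg i), if_neg (Ne.symm hi), map_zero, LinearMap.zero_apply]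
  · simp

/-- The map `pairLin` on total spaces of tensor products. -/
def pairTens {n : ℕ} {G A B : Fin n → GMod k c} (ev : ∀ i, (G i).M →ₗ[k] (A i).M →ₗ[k] (B i).M) :
    (tens G).M →ₗ[k] (tens A).M →ₗ[k] (tens B).M := pairLin ev

lemma pairTens_pure {n : ℕ} {G A B : Fin n → GMod k c}
    (ev : ∀ i, (G i).M →ₗ[k] (A i).M →ₗ[k] (B i).M) {p q : Fin n → I}
    {g : ∀ i, (G i).M} {a : ∀ i, (A i).M}
    (hg : ∀ i, g i ∈ (G i).deg (p i)) (ha : ∀ i, a i ∈ (A i).deg (q i)) :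
    pairTens ev (pure g) (pure a) =
      sg k (shuffleSign (fun i => c.ε (p i)) (fun i => c.ε (q i))) •
        pure (A := B) fun i => ev i (g i) (a i) := pairLin_tprod ev hg ha

lemma pair_ext {n m : ℕ} {G : Fin n → GMod k c} {A : Fin m → GMod k c} {N : Type u}
    [AddCommGroup N] [Module k N] {f g : (tens G).M →ₗ[k] (tens A).M →ₗ[k] N}
    (h : ∀ (p : Fin n → I) (q : Fin m → I) (b : ∀ i, (G i).M) (a : ∀ i, (A i).M),
      (∀ i, b i ∈ (G i).deg (p i)) → (∀ i, a i ∈ (A i).deg (q i)) →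
      f (pure b) (pure a) = g (pure b) (pure a)) : f = g :=
  tens_ext fun p b hb => tens_ext fun q a ha => h p q b a hb ha

lemma shuffleSign_update_left {n : ℕ} (η θ : Fin n → ℤˣ) (i : Fin n) :
    shuffleSign (Function.update η i (-η i)) θ =
      (∏ j, if j < i then θ j else 1) * shuffleSign η θ := by
  have h : ∀ a b : Fin n, (if a < b then koszul (θ a) (Function.update η i (-η i) b) else 1) =
      (if b = i then (if a < i then θ a else 1) else 1) *
        (if a < b then koszul (θ a) (η b) else 1) := by
    intro a b
    by_cases hb : b = i
    · subst hb
      by_cases hab : a < b <;> simp [hab, koszul_neg_right]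
    · simp [hb]
  unfold shuffleSign
  simp only [h, Finset.prod_mul_distrib]
  congr 1
  exact Finset.prod_congr rfl fun a _ => by simp

lemma shuffleSign_update_right {n : ℕ} (η θ : Fin n → ℤˣ) (i : Fin n) :
    shuffleSign η (Function.update θ i (-θ i)) =
      (∏ j, if i < j then η j else 1) * shuffleSign η θ := by
  have h : ∀ a b : Fin n, (if a < b then koszul (Function.update θ i (-θ i) a) (η b) else 1) =
      (if a = i then (if i < b then η b else 1) else 1) *
        (if a < b then koszul (θ a) (η b) else 1) := by
    intro a b
    by_cases ha : a = i
    · subst ha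
      by_cases hab : a < b <;> simp [hab, koszul_neg_left]
    · simp [ha]
  unfold shuffleSign
  simp only [h, Finset.prod_mul_distrib]
  congr 1
  rw [Finset.prod_comm]
  exact Finset.prod_congr rfl fun a _ => by simp

lemma pairTens_isPairing {n : ℕ} {G A B : Fin n → GMod k c}
    {ev : ∀ i, (G i).M →ₗ[k] (A i).M →ₗ[k] (B i).M} (hev : ∀ i, IsPairing (ev i)) :
    IsPairing (pairTens ev) where
  deg p q g hg a ha := by
    refine mem_tens_induction hg (((tens B).deg (p + q)).comap ((pairTens ev).flip a)) ?_
    rintro p' g hg' rfl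
    refine mem_tens_induction ha (((tens B).deg (_ + q)).comap (pairTens ev (pure g))) ?_
    rintro q' a ha' rfl
    rw [Submodule.mem_comap, pairTens_pure ev hg' ha', ← Finset.sum_add_distrib]
    exact Submodule.smul_mem _ _ (pure_mem fun i => (hev i).deg _ _ _ (hg' i) _ (ha' i))
  d g a := by
    have : (pairTens ev).compr₂ (tens B).d =
        pairTens ev ∘ₗ (tens G).d + (pairTens ev).compl₁₂ (tens G).sgn (tens A).d := by
      refine pair_ext fun p q g a hg ha => ?_
      have hb : ∀ i, ev i (g i) (a i) ∈ (B i).deg (p i + q i) :=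
        fun i => (hev i).deg _ _ _ (hg i) _ (ha i)
      rw [LinearMap.compr₂_apply, pairTens_pure ev hg ha, map_smul, d_pure B hb,
        LinearMap.add_apply, LinearMap.add_apply, LinearMap.comp_apply, LinearMap.compl₁₂_apply,
        (tens G).sgn_of_mem (pure_mem hg), d_pure G hg, d_pure A ha, map_sum, map_sum,
        LinearMap.sum_apply, Finset.smul_sum, ← Finset.sum_add_distrib]
      refine Finset.sum_congr rfl fun i _ => ?_
      rw [(hev i).d, (G i).sgn_of_mem (hg i)]
      have hsplit : pure (A := B) (Function.update (fun i => ev i (g i) (a i)) i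
          (ev i ((G i).d (g i)) (a i) + ev i (sg k (c.ε (p i)) • g i) ((A i).d (a i)))) =
          pure (A := B) (Function.update (fun i => ev i (g i) (a i)) i
            (ev i ((G i).d (g i)) (a i))) + sg k (c.ε (p i)) •
          pure (A := B) (Function.update (fun i => ev i (g i) (a i)) i
            (ev i (g i) ((A i).d (a i)))) := by
        rw [map_smul, LinearMap.smul_apply]
        exact ((PiTensorProduct.tprod k).map_update_add _ _ _ _).trans
          (congrArg _ ((PiTensorProduct.tprod k).map_update_smul _ _ _ _))
      rw [hsplit, smul_add, smul_add]
      have e1 : (fun l => ev l (Function.update g i ((G i).d (g i)) l) (a l)) =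
          Function.update (fun i => ev i (g i) (a i)) i (ev i ((G i).d (g i)) (a i)) := by
        funext l
        by_cases hl : l = i
        · subst hl; simp
        · simp [hl]
      have e2 : (fun l => ev l (g l) (Function.update a i ((A i).d (a i)) l)) =
          Function.update (fun i => ev i (g i) (a i)) i (ev i (g i) ((A i).d (a i))) := by
        funext l
        by_cases hl : l = i
        · subst hl; simp
        · simp [hl]
      congr 1
      · rw [map_smul, LinearMap.smul_apply]
        rcases (G i).d_cases (hg i) with h0 | ⟨r, -, hr, hs⟩
        · rw [h0, map_zero, LinearMap.zero_apply, pure_update_zero, pure_update_zero, map_zero,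
            LinearMap.zero_apply, smul_zero, smul_zero, smul_zero]
        · rw [pairTens_pure ev (update_mem hg i hr) ha, eps_update hs, shuffleSign_update_left,
            smul_smul, smul_smul, ← map_mul, ← map_mul, e1]
          congr 2
          rw [← mul_assoc, mul_comm, ← Finset.prod_mul_distrib]
          congr 1
          refine Finset.prod_congr rfl fun j _ => ?_
          split_ifs <;> simp [c.ε_add]
      · rw [map_smul, map_smul, LinearMap.smul_apply]
        rcases (A i).d_cases (ha i) with h0 | ⟨r, -, hr, hs⟩
        · rw [h0, map_zero, pure_update_zero, pure_update_zero, map_zero]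
          simp only [smul_zero]
        · rw [pairTens_pure ev hg (update_mem ha i hr), eps_update hs, shuffleSign_update_right, e2]
          simp only [smul_smul, ← map_mul]
          congr 2
          rw [ε_sum]
          have key : (∏ j, if j < i then c.ε (p j + q j) else 1) * c.ε (p i) =
              (∏ j, if j < i then c.ε (q j) else 1) * (∏ j, c.ε (p j)) *
                (∏ j, if i < j then c.ε (p j) else 1) := by
            have : c.ε (p i) = ∏ j, if j = i then c.ε (p j) else 1 := by simp
            rw [this]
            simp only [← Finset.prod_mul_distrib]
            refine Finset.prod_congr rfl fun j _ => ?_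
            rcases lt_trichotomy j i with h | h | h
            · simp [h, h.ne, not_lt_of_gt h, c.ε_add, mul_comm]
            · subst h; simp
            · simp [h, h.ne', not_lt_of_gt h, Int.units_mul_self]
          rw [key]
          simp only [mul_assoc, mul_comm, mul_left_comm]
    have h2 := LinearMap.congr_fun₂ this g a
    simpa using h2

lemma shuffleSign_perm {n m : ℕ} (e : Fin n ≃ Fin m) (η θ : Fin n → ℤˣ) :
    permSign e η * permSign e θ *
      shuffleSign (fun j => η (e.symm j)) (fun j => θ (e.symm j)) =
    shuffleSign η θ * permSign e (fun i => η i * θ i) := by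
  have h1 : shuffleSign (fun j => η (e.symm j)) (fun j => θ (e.symm j)) =
      (∏ i, ∏ j, if i < j ∧ e i < e j then koszul (θ i) (η j) else 1) *
      (∏ i, ∏ j, if i < j ∧ e j < e i then koszul (θ j) (η i) else 1) := by
    unfold shuffleSign
    have h2 : (∏ i, ∏ j, if i < j ∧ e j < e i then koszul (θ j) (η i) else 1) =
        ∏ i, ∏ j, if j < i ∧ e i < e j then koszul (θ i) (η j) else 1 := Finset.prod_comm
    rw [h2, ← Equiv.prod_comp e, ← Finset.prod_mul_distrib]
    refine Finset.prod_congr rfl fun i _ => ?_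
    rw [← Equiv.prod_comp e, ← Finset.prod_mul_distrib]
    refine Finset.prod_congr rfl fun j _ => ?_
    simp only [Equiv.symm_apply_apply]
    rcases lt_trichotomy i j with h | h | h
    · simp [h, not_lt_of_gt h]
    · subst h; simp
    · simp [h, not_lt_of_gt h]
  rw [h1]
  unfold shuffleSign permSign
  simp only [← Finset.prod_mul_distrib]
  refine Finset.prod_congr rfl fun i _ => Finset.prod_congr rfl fun j _ => ?_
  by_cases h : i < j
  · rcases lt_or_gt_of_ne (e.injective.ne h.ne) with h' | h'
    · simp [h, h', not_lt_of_gt h']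
    · simp only [h, h', not_lt_of_gt h', and_self, and_false, if_true, if_false, one_mul]
      generalize η i = a, η j = b, θ i = a', θ j = b'
      revert a b a' b'
      decide
  · simp [h]

lemma pairTens_permMap {n m : ℕ} {G A B : Fin n → GMod k c} {G' A' B' : Fin m → GMod k c}
    (e : Fin n ≃ Fin m) {ev : ∀ i, (G i).M →ₗ[k] (A i).M →ₗ[k] (B i).M}
    {ev' : ∀ i, (G' i).M →ₗ[k] (A' i).M →ₗ[k] (B' i).M} (hev : ∀ i, IsPairing (ev i))
    {φ : ∀ i, (G i).M →ₗ[k] (G' (e i)).M} {ψ : ∀ i, (A i).M →ₗ[k] (A' (e i)).M}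
    {χ : ∀ i, (B i).M →ₗ[k] (B' (e i)).M}
    (hφ : ∀ i, GMod.IsHom (φ i)) (hψ : ∀ i, GMod.IsHom (ψ i))
    (h : ∀ i g a, ev' (e i) (φ i g) (ψ i a) = χ i (ev i g a)) (g : (tens G).M) (a : (tens A).M) :
    pairTens ev' (permMap e φ g) (permMap e ψ a) = permMap e χ (pairTens ev g a) := by
  have : (pairTens ev').compl₁₂ (permMap e φ) (permMap e ψ) =
      (pairTens ev).compr₂ (permMap e χ) := by
    refine pair_ext fun p q g a hg ha => ?_
    have hb : ∀ i, ev i (g i) (a i) ∈ (B i).deg (p i + q i) :=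
      fun i => (hev i).deg _ _ _ (hg i) _ (ha i)
    rw [LinearMap.compl₁₂_apply, LinearMap.compr₂_apply, permMap_pure e φ hg, permMap_pure e ψ ha,
      pairTens_pure ev hg ha, map_smul, map_smul, map_smul, LinearMap.smul_apply,
      permMap_pure e χ hb,
      pairTens_pure ev' (piCongrLeft_mem e fun i => (hφ i).deg _ _ (hg i))
        (piCongrLeft_mem e fun i => (hψ i).deg _ _ (ha i))]
    simp only [smul_smul, ← map_mul, c.ε_add]
    congr 1
    · rw [← shuffleSign_perm]
      congr 1
      rw [← mul_assoc]
      congr 1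
      exact mul_comm _ _
    · congr 1
      funext j
      obtain ⟨i, rfl⟩ := e.surjective j
      simp only [Equiv.piCongrLeft_apply_apply, h]
  exact LinearMap.congr_fun₂ this g a

lemma pairTens_tensMap {n : ℕ} {G A B G' A' B' : Fin n → GMod k c}
    {ev : ∀ i, (G i).M →ₗ[k] (A i).M →ₗ[k] (B i).M}
    {ev' : ∀ i, (G' i).M →ₗ[k] (A' i).M →ₗ[k] (B' i).M}
    {φ : ∀ i, (G i).M →ₗ[k] (G' i).M} {ψ : ∀ i, (A i).M →ₗ[k] (A' i).M}
    {χ : ∀ i, (B i).M →ₗ[k] (B' i).M}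
    (hφ : ∀ i, GMod.IsHom (φ i)) (hψ : ∀ i, GMod.IsHom (ψ i))
    (h : ∀ i g a, ev' i (φ i g) (ψ i a) = χ i (ev i g a)) (g : (tens G).M) (a : (tens A).M) :
    pairTens ev' (tensMap φ g) (tensMap ψ a) = tensMap χ (pairTens ev g a) := by
  have : (pairTens ev').compl₁₂ (tensMap φ) (tensMap ψ) =
      (pairTens ev).compr₂ (tensMap χ) := by
    refine pair_ext fun p q g a hg ha => ?_
    rw [LinearMap.compl₁₂_apply, LinearMap.compr₂_apply, tensMap_pure, tensMap_pure,
      pairTens_pure ev hg ha, map_smul, tensMap_pure,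
      pairTens_pure ev' (fun i => (hφ i).deg _ _ (hg i)) (fun i => (hψ i).deg _ _ (ha i))]
    simp only [h]
  exact LinearMap.congr_fun₂ this g a

end Pairing

/-! ### Positions in concatenations

A position in the concatenation of `n` words of lengths `m 0, …, m (n - 1)` is
`finSigmaFinEquiv ⟨i, j⟩`, for the `j`-th position in the `i`-th word. -/

section Positions

/-- Permuting positions inside the blocks. -/
def sumEquiv {n : ℕ} {m m' : Fin n → ℕ} (e : ∀ i, Fin (m i) ≃ Fin (m' i)) :
    Fin (∑ i, m i) ≃ Fin (∑ i, m' i) :=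
  finSigmaFinEquiv.symm.trans ((Equiv.sigmaCongrRight e).trans finSigmaFinEquiv)

/-- Permuting the blocks. -/
def blockEquiv {n n' : ℕ} (σ : Fin n ≃ Fin n') (m : Fin n' → ℕ) :
    Fin (∑ i, m (σ i)) ≃ Fin (∑ i, m i) :=
  finSigmaFinEquiv.symm.trans
    ((Equiv.sigmaCongrLeft (β := fun i => Fin (m i)) σ).trans finSigmaFinEquiv)

/-- The two ways of concatenating a family of families of words. -/
def assocEquiv {n : ℕ} {m : Fin n → ℕ} (l : ∀ i, Fin (m i) → ℕ) :
    Fin (∑ s : Fin (∑ i, m i), l (finSigmaFinEquiv.symm s).1 (finSigmaFinEquiv.symm s).2) ≃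
      Fin (∑ i, ∑ j, l i j) :=
  finSigmaFinEquiv.symm.trans
    ((Equiv.sigmaCongrLeft (β := fun w : (i : Fin n) × Fin (m i) => Fin (l w.1 w.2))
      finSigmaFinEquiv.symm).trans
    ((Equiv.sigmaAssoc fun i j => Fin (l i j)).trans
    ((Equiv.sigmaCongrRight fun _ => finSigmaFinEquiv).trans finSigmaFinEquiv)))

/-- The concatenation of one word. -/
def singleEquiv (m : ℕ) : Fin (∑ _ : Fin 1, m) ≃ Fin m :=
  finSigmaFinEquiv.symm.trans ((Equiv.sigmaEquivProd (Fin 1) (Fin m)).trans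
    (Equiv.uniqueProd (Fin m) (Fin 1)))

/-- The concatenation of words of length one. -/
def lettersEquiv (n : ℕ) : Fin (∑ _ : Fin n, 1) ≃ Fin n :=
  finSigmaFinEquiv.symm.trans (Equiv.sigmaUnique (Fin n) fun _ => Fin 1)

lemma sumEquiv_apply {n : ℕ} {m m' : Fin n → ℕ} (e : ∀ i, Fin (m i) ≃ Fin (m' i)) (i : Fin n)
    (j : Fin (m i)) : sumEquiv e (finSigmaFinEquiv ⟨i, j⟩) = finSigmaFinEquiv ⟨i, e i j⟩ := by
  simp only [sumEquiv, Equiv.trans_apply, Equiv.symm_apply_apply]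
  rfl

lemma blockEquiv_apply {n n' : ℕ} (σ : Fin n ≃ Fin n') (m : Fin n' → ℕ) (i : Fin n)
    (j : Fin (m (σ i))) :
    blockEquiv σ m (finSigmaFinEquiv ⟨i, j⟩) = finSigmaFinEquiv ⟨σ i, j⟩ := by
  simp only [blockEquiv, Equiv.trans_apply, Equiv.symm_apply_apply]
  rfl

lemma sigma_lt_of_lt {n : ℕ} {m : Fin n → ℕ} {i i' : Fin n} (h : i < i') (j : Fin (m i))
    (j' : Fin (m i')) : finSigmaFinEquiv ⟨i, j⟩ < finSigmaFinEquiv ⟨i', j'⟩ := by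
  rw [Fin.lt_def, finSigmaFinEquiv_apply, finSigmaFinEquiv_apply]
  have h1 : ∑ l : Fin (i : ℕ), m (Fin.castLE i.2.le l) + m i ≤
      ∑ l : Fin (i' : ℕ), m (Fin.castLE i'.2.le l) := by
    have h2 : ∀ a : Fin n, ∑ l : Fin (a : ℕ), m (Fin.castLE a.2.le l) =
        ∑ l ∈ Finset.univ.filter (· < a), m l := by
      intro a
      refine Finset.sum_bij (fun l _ => Fin.castLE a.2.le l) ?_ ?_ ?_ ?_
      · intro l _
        exact Finset.mem_filter.2 ⟨Finset.mem_univ _, Fin.lt_def.2 l.2⟩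
      · intro l _ l' _ hl
        exact Fin.castLE_injective _ hl
      · intro l hl
        exact ⟨⟨l, (Finset.mem_filter.1 hl).2⟩, Finset.mem_univ _, rfl⟩
      · intro l _; rfl
    rw [h2, h2, add_comm, ← Finset.sum_insert (by simp)]
    refine Finset.sum_le_sum_of_subset ?_
    intro l hl
    simp only [Finset.mem_insert, Finset.mem_filter, Finset.mem_univ, true_and] at hl ⊢
    rcases hl with rfl | hl
    · exact h
    · exact hl.trans h
  have h3 := j.2
  simp only at h1 h3 ⊢
  omega

lemma sigma_lt_iff {n : ℕ} {m : Fin n → ℕ} {i : Fin n} (j j' : Fin (m i)) :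
    finSigmaFinEquiv ⟨i, j⟩ < finSigmaFinEquiv ⟨i, j'⟩ ↔ j < j' := by
  rw [Fin.lt_def, finSigmaFinEquiv_apply, finSigmaFinEquiv_apply, Fin.lt_def]
  simp

lemma prod_flat {n : ℕ} {m : Fin n → ℕ} (f : Fin (∑ i, m i) → ℤˣ) :
    ∏ s, f s = ∏ i, ∏ j, f (finSigmaFinEquiv ⟨i, j⟩) := by
  rw [← Equiv.prod_comp finSigmaFinEquiv, Fintype.prod_sigma]

lemma permSign_block {n n' : ℕ} (σ : Fin n ≃ Fin n') (m : Fin n' → ℕ)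
    (η : Fin (∑ i, m (σ i)) → ℤˣ) :
    permSign (blockEquiv σ m) η =
      permSign σ fun i => ∏ j : Fin (m (σ i)), η (finSigmaFinEquiv ⟨i, j⟩) := by
  unfold permSign
  rw [prod_flat]
  refine Finset.prod_congr rfl fun i _ => ?_
  refine (Finset.prod_congr rfl fun j _ => prod_flat (m := fun i => m (σ i)) _).trans ?_
  rw [Finset.prod_comm]
  refine Finset.prod_congr rfl fun i' _ => ?_
  simp only [blockEquiv_apply]
  rcases lt_trichotomy i i' with h | h | h
  · rcases lt_or_gt_of_ne (σ.injective.ne h.ne) with h' | h'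
    · simp only [not_lt_of_gt (sigma_lt_of_lt (m := m) h' _ _), not_lt_of_gt h',
        and_false, if_false, Finset.prod_const_one]
    · simp only [sigma_lt_of_lt (m := m) h' _ _, h', h,
        sigma_lt_of_lt (m := fun i => m (σ i)) h _ _, and_self, if_true]
      exact (koszul_prod _ _).symm
  · subst h
    simp only [lt_irrefl, false_and, if_false]
    refine Finset.prod_eq_one fun j _ => Finset.prod_eq_one fun j' _ => if_neg ?_
    rw [sigma_lt_iff (m := fun i => m (σ i)), sigma_lt_iff (m := m)]
    exact fun h => lt_asymm h.1 h.2
  · simp only [not_lt_of_gt (sigma_lt_of_lt (m := fun i => m (σ i)) h _ _), not_lt_of_gt h,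
        false_and, if_false, Finset.prod_const_one]

lemma permSign_sum {n : ℕ} {m m' : Fin n → ℕ} (e : ∀ i, Fin (m i) ≃ Fin (m' i))
    (η : Fin (∑ i, m i) → ℤˣ) :
    permSign (sumEquiv e) η = ∏ i, permSign (e i) fun j => η (finSigmaFinEquiv ⟨i, j⟩) := by
  unfold permSign
  rw [prod_flat]
  refine Finset.prod_congr rfl fun i _ => Finset.prod_congr rfl fun j _ => ?_
  rw [prod_flat, Finset.prod_eq_single i]
  · refine Finset.prod_congr rfl fun j' _ => ?_
    simp only [sumEquiv_apply, sigma_lt_iff]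
  · intro i' _ hi
    refine Finset.prod_eq_one fun j' _ => if_neg ?_
    simp only [sumEquiv_apply]
    rcases lt_or_gt_of_ne hi with h | h
    · exact fun h' => lt_asymm h'.1 (sigma_lt_of_lt h _ _)
    · exact fun h' => lt_asymm h'.2 (sigma_lt_of_lt h _ _)
  · simp

end Positions

/-! ## Words -/

section Words

/-- Objects of the free symmetric monoidal category `S(X)`: finite sequences of colours. -/
structure Word (X : Type u) where
  len : ℕ
  col : Fin len → X

variable {X : Type u}

namespace Word

/-- A morphism of words is a bijection of the positions preserving the colours. -/
instance : Category (Word X) where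
  Hom x y := {e : Fin x.len ≃ Fin y.len // ∀ i, y.col (e i) = x.col i}
  id x := ⟨Equiv.refl _, fun _ => rfl⟩
  comp f g := ⟨f.1.trans g.1, fun i => (g.2 (f.1 i)).trans (f.2 i)⟩

/-- The word with one letter. -/
def single (y : X) : Word X := ⟨1, fun _ => y⟩

/-- The word `x ∘ σ`, with the letters of `x` permuted. -/
def pull (x : Word X) {n : ℕ} (σ : Fin n ≃ Fin x.len) : Word X := ⟨n, x.col ∘ σ⟩

/-- The bijection `σ` as a morphism of words. -/
def pullHom (x : Word X) {n : ℕ} (σ : Fin n ≃ Fin x.len) : x.pull σ ⟶ x := ⟨σ, fun _ => rfl⟩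

/-- The concatenation `z₁ ⋯ zₙ` of a family of words indexed by the positions of the word `x`. -/
def concat (x : Word X) (z : Fin x.len → Word X) : Word X where
  len := ∑ i, (z i).len
  col s := (z (finSigmaFinEquiv.symm s).1).col (finSigmaFinEquiv.symm s).2

lemma concat_col_mk (x : Word X) (z : Fin x.len → Word X) (w : (i : Fin x.len) × Fin (z i).len) :
    (concat x z).col (finSigmaFinEquiv w) = (z w.1).col w.2 :=
  congrArg (fun w : (i : Fin x.len) × Fin (z i).len => (z w.1).col w.2)
    (Equiv.symm_apply_apply finSigmaFinEquiv w)

/-- The concatenation of a family of morphisms. -/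
def concatMap (x : Word X) {z z' : Fin x.len → Word X} (e : ∀ i, z i ⟶ z' i) :
    concat x z ⟶ concat x z' :=
  ⟨sumEquiv fun i => (e i).1, fun _ =>
    (concat_col_mk x z' ⟨_, (e _).1 _⟩).trans ((e _).2 _)⟩

/-- The morphism permuting the blocks of a concatenation. -/
def blockHom (x : Word X) {n : ℕ} (σ : Fin n ≃ Fin x.len) (z : Fin x.len → Word X) :
    concat (x.pull σ) (fun i => z (σ i)) ⟶ concat x z :=
  ⟨blockEquiv σ fun i => (z i).len, fun _ => concat_col_mk x z ⟨σ _, _⟩⟩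

/-- The identification of the two ways of concatenating a family of families of words. -/
def concatAssoc (x : Word X) (z : Fin x.len → Word X) (t : ∀ i, Fin (z i).len → Word X) :
    concat (concat x z) (fun s => t (finSigmaFinEquiv.symm s).1 (finSigmaFinEquiv.symm s).2) ⟶
      concat x (fun i => concat (z i) (t i)) :=
  ⟨assocEquiv fun i j => (t i j).len, fun _ =>
    (concat_col_mk x (fun i => concat (z i) (t i)) ⟨_, finSigmaFinEquiv ⟨_, _⟩⟩).trans
      (concat_col_mk (z _) (t _) ⟨_, _⟩)⟩

/-- The identification of a concatenation of one word with that word. -/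
def concatSingle (y : X) (x : Word X) : concat (single y) (fun _ => x) ⟶ x :=
  ⟨singleEquiv x.len, fun _ => rfl⟩

/-- The identification of a word with the concatenation of its letters. -/
def concatLetters (x : Word X) : concat x (fun i => single (x.col i)) ⟶ x :=
  ⟨lettersEquiv x.len, fun _ => rfl⟩

end Word

open Word

/-- The map of total spaces `C a → C b` for equal colours `a = b`. -/
def colMap (C : X → Cplx k c) {a b : X} (h : a = b) : (tot (C a)).M →ₗ[k] (tot (C b)).M :=
  totMap (eqToHom (congrArg C h))

lemma colMap_rfl (C : X → Cplx k c) {a : X} (h : a = a) (v : (tot (C a)).M) :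
    colMap C h v = v := by
  rw [colMap, eqToHom_refl, totMap_id, LinearMap.id_apply]

lemma colMap_colMap (C : X → Cplx k c) {a b b' : X} (h : a = b) (h' : b = b')
    (v : (tot (C a)).M) : colMap C h' (colMap C h v) = colMap C (h.trans h') v := by
  subst h h'; simp only [colMap_rfl]

lemma colMap_isHom (C : X → Cplx k c) {a b : X} (h : a = b) : GMod.IsHom (colMap C h) :=
  totMap_isHom _

/-- The tensor power `C^{⊗ x} = C^{x₁} ⊗ ⋯ ⊗ C^{xₙ}`. -/
def wt (C : X → Cplx k c) (x : Word X) : GMod k c := tens fun i => tot (C (x.col i))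

/-- The action of the morphisms of words on tensor powers. -/
def wtMap (C : X → Cplx k c) {x x' : Word X} (e : x ⟶ x') : (wt C x).M →ₗ[k] (wt C x').M :=
  permMap e.1 fun i => colMap C (e.2 i).symm

lemma wtMap_isHom (C : X → Cplx k c) {x x' : Word X} (e : x ⟶ x') : GMod.IsHom (wtMap C e) :=
  permMap_isHom _ fun _ => colMap_isHom _ _

/-- The map of tensor powers induced by a map `C ⟶ D`. -/
def wtFun {C D : X → Cplx k c} (f : C ⟶ D) (x : Word X) : (wt C x).M →ₗ[k] (wt D x).M :=
  tensMap fun i => totMap (f (x.col i))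

lemma wtFun_isHom {C D : X → Cplx k c} (f : C ⟶ D) (x : Word X) : GMod.IsHom (wtFun f x) :=
  tensMap_isHom fun _ => totMap_isHom _

lemma wtFun_id (C : X → Cplx k c) (x : Word X) : wtFun (𝟙 C) x = LinearMap.id := by
  refine Eq.trans (congrArg tensMap (funext fun i => ?_)) (tensMap_id _)
  exact totMap_id _

lemma wtFun_comp {C D E : X → Cplx k c} (f : C ⟶ D) (g : D ⟶ E) (x : Word X) :
    wtFun (f ≫ g) x = wtFun g x ∘ₗ wtFun f x := by
  refine Eq.trans (congrArg tensMap (funext fun i => ?_)) (tensMap_comp _ _)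
  exact totMap_comp _ _

lemma colMap_totMap {C D : X → Cplx k c} (f : C ⟶ D) {a b : X} (h : a = b) (v : (tot (C a)).M) :
    colMap D h (totMap (f a) v) = totMap (f b) (colMap C h v) := by
  subst h; simp only [colMap_rfl]

lemma wtMap_wtFun {C D : X → Cplx k c} (f : C ⟶ D) {x x' : Word X} (e : x ⟶ x')
    (t : (wt C x).M) : wtMap D e (wtFun f x t) = wtFun f x' (wtMap C e t) :=
  permMap_tensMap (g := fun j => totMap (f (x'.col j))) _ (fun _ => totMap_isHom _)
    (fun _ a => colMap_totMap f _ a) t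

/-! ### Tensor powers of concatenated words -/

/-- The multilinear map sending a family `(aᵢⱼ)` to `⊗ᵢ ⊗ⱼ aᵢⱼ`. -/
def nest {n : ℕ} {m : Fin n → ℕ} (A : ∀ i, Fin (m i) → GMod k c) :
    MultilinearMap k (fun w : (i : Fin n) × Fin (m i) => (A w.1 w.2).M)
      (⨂[k] i, (tens (A i)).M) :=
  MultilinearMap.mk'
    (fun v => PiTensorProduct.tprod k fun i => (PiTensorProduct.tprod k fun j => v ⟨i, j⟩ :
      ⨂[k] j, (A i j).M))
    (fun v w x y => by
      obtain ⟨i, j⟩ := w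
      have h : ∀ b : (A i j).M, (fun i' => (PiTensorProduct.tprod k fun j' =>
            Function.update v ⟨i, j⟩ b ⟨i', j'⟩ : ⨂[k] j, (A i' j).M)) =
          Function.update (fun i' => (PiTensorProduct.tprod k fun j' => v ⟨i', j'⟩ :
            ⨂[k] j, (A i' j).M)) i
            (PiTensorProduct.tprod k (Function.update (fun j' => v ⟨i, j'⟩) j b)) := by
        intro b
        funext i'
        by_cases hi : i' = i
        · subst hi
          rw [Function.update_self]
          congr 1
          funext j'
          by_cases hj : j' = j
          · subst hj; simp
          · rw [Function.update_of_ne hj, Function.update_of_ne]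
            simpa using hj
        · rw [Function.update_of_ne hi]
          congr 1
          funext j'
          rw [Function.update_of_ne]
          intro h
          exact hi (congrArg Sigma.fst h)
      simp only [h, MultilinearMap.map_update_add]
      exact (PiTensorProduct.tprod k (s := fun i => (tens (A i)).M)).map_update_add _ _ _ _)
    (fun v w r x => by
      obtain ⟨i, j⟩ := w
      have h : ∀ b : (A i j).M, (fun i' => (PiTensorProduct.tprod k fun j' =>
            Function.update v ⟨i, j⟩ b ⟨i', j'⟩ : ⨂[k] j, (A i' j).M)) =
          Function.update (fun i' => (PiTensorProduct.tprod k fun j' => v ⟨i', j'⟩ :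
            ⨂[k] j, (A i' j).M)) i
            (PiTensorProduct.tprod k (Function.update (fun j' => v ⟨i, j'⟩) j b)) := by
        intro b
        funext i'
        by_cases hi : i' = i
        · subst hi
          rw [Function.update_self]
          congr 1
          funext j'
          by_cases hj : j' = j
          · subst hj; simp
          · rw [Function.update_of_ne hj, Function.update_of_ne]
            simpa using hj
        · rw [Function.update_of_ne hi]
          congr 1
          funext j'
          rw [Function.update_of_ne]
          intro h
          exact hi (congrArg Sigma.fst h)
      simp only [h, MultilinearMap.map_update_smul]
      exact (PiTensorProduct.tprod k (s := fun i => (tens (A i)).M)).map_update_smul _ _ _ _)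

/-- The map `⨂_{(i, j)} A i j → ⨂ᵢ ⨂ⱼ A i j`. -/
def unflatLin {n : ℕ} {m : Fin n → ℕ} (A : ∀ i, Fin (m i) → GMod k c) :
    (⨂[k] s : Fin (∑ i, m i), (A (finSigmaFinEquiv.symm s).1 (finSigmaFinEquiv.symm s).2).M)
      →ₗ[k] ⨂[k] i, (tens (A i)).M :=
  PiTensorProduct.lift (nest A) ∘ₗ (PiTensorProduct.reindex k
    (fun w : (i : Fin n) × Fin (m i) => (A w.1 w.2).M) finSigmaFinEquiv).symm.toLinearMap

lemma unflatLin_tprod {n : ℕ} {m : Fin n → ℕ} (A : ∀ i, Fin (m i) → GMod k c)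
    (u : ∀ i j, (A i j).M) :
    unflatLin A (PiTensorProduct.tprod k
      fun s => u (finSigmaFinEquiv.symm s).1 (finSigmaFinEquiv.symm s).2) =
    PiTensorProduct.tprod k fun i => (PiTensorProduct.tprod k (u i) : ⨂[k] j, (A i j).M) := by
  have h : (PiTensorProduct.reindex k (fun w : (i : Fin n) × Fin (m i) => (A w.1 w.2).M)
      finSigmaFinEquiv).symm (PiTensorProduct.tprod k
        fun s => u (finSigmaFinEquiv.symm s).1 (finSigmaFinEquiv.symm s).2) =
      PiTensorProduct.tprod k fun w : (i : Fin n) × Fin (m i) => u w.1 w.2 := by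
    rw [LinearEquiv.symm_apply_eq, PiTensorProduct.reindex_tprod]
  rw [unflatLin, LinearMap.comp_apply, LinearEquiv.coe_coe, h, PiTensorProduct.lift.tprod]
  rfl

lemma pure_update_sum {n : ℕ} {A : Fin n → GMod k c} (a : ∀ i, (A i).M) (i : Fin n) {T : Type}
    (s : Finset T) (f : T → (A i).M) :
    pure (Function.update a i (∑ t ∈ s, f t)) = ∑ t ∈ s, pure (Function.update a i (f t)) :=
  (PiTensorProduct.tprod k (s := fun i => (A i).M)).map_update_sum s i f a

lemma pure_update_smul {n : ℕ} {A : Fin n → GMod k c} (a : ∀ i, (A i).M) (i : Fin n) (r : k)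
    (b : (A i).M) : pure (Function.update a i (r • b)) = r • pure (Function.update a i b) :=
  (PiTensorProduct.tprod k (s := fun i => (A i).M)).map_update_smul a i r b

/-- The family of complexes indexed by the positions in a concatenation given by a family of
families. -/
abbrev flatFam {n : ℕ} {m : Fin n → ℕ} (A : ∀ i, Fin (m i) → GMod k c) (s : Fin (∑ i, m i)) :
    GMod k c := A (finSigmaFinEquiv.symm s).1 (finSigmaFinEquiv.symm s).2

/-- The map `unflatLin` on total spaces of tensor products. -/
def unflatG {n : ℕ} {m : Fin n → ℕ} (A : ∀ i, Fin (m i) → GMod k c) :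
    (tens (flatFam A)).M →ₗ[k] (tens fun i => tens (A i)).M := unflatLin A

/-- The family indexed by the positions in a concatenation given by a family of families. -/
def flat {n : ℕ} {m : Fin n → ℕ} {A : ∀ i, Fin (m i) → GMod k c} (u : ∀ i j, (A i j).M)
    (s : Fin (∑ i, m i)) : (flatFam A s).M :=
  u (finSigmaFinEquiv.symm s).1 (finSigmaFinEquiv.symm s).2

/-- The family of degrees corresponding to `flat`. -/
def flatDeg {n : ℕ} {m : Fin n → ℕ} {T : Type} (p : ∀ i, Fin (m i) → T) (s : Fin (∑ i, m i)) : T :=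
  p (finSigmaFinEquiv.symm s).1 (finSigmaFinEquiv.symm s).2

lemma flatDeg_apply {n : ℕ} {m : Fin n → ℕ} {T : Type} (p : ∀ i, Fin (m i) → T) (i : Fin n)
    (j : Fin (m i)) : flatDeg p (finSigmaFinEquiv ⟨i, j⟩) = p i j :=
  congrArg (fun w : (i : Fin n) × Fin (m i) => p w.1 w.2) (Equiv.symm_apply_apply _ _)

lemma unflatG_pure {n : ℕ} {m : Fin n → ℕ} {A : ∀ i, Fin (m i) → GMod k c}
    (u : ∀ i j, (A i j).M) :
    unflatG A (pure (A := flatFam A) (flat u)) = pure (A := fun i => tens (A i)) fun i => pure (A := A i) (u i) :=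
  unflatLin_tprod A u

lemma flat_mem {n : ℕ} {m : Fin n → ℕ} {A : ∀ i, Fin (m i) → GMod k c} {p : ∀ i, Fin (m i) → I}
    {u : ∀ i j, (A i j).M} (h : ∀ i j, u i j ∈ (A i j).deg (p i j)) (s : Fin (∑ i, m i)) :
    flat u s ∈ (flatFam A s).deg (flatDeg p s) :=
  h _ _

lemma exists_flat {n : ℕ} {m : Fin n → ℕ} {A : ∀ i, Fin (m i) → GMod k c}
    {q : Fin (∑ i, m i) → I}
    {a : ∀ s, (flatFam A s).M} (ha : ∀ s, a s ∈ (flatFam A s).deg (q s)) :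
    ∃ (p : ∀ i, Fin (m i) → I) (u : ∀ i j, (A i j).M),
      (∀ i j, u i j ∈ (A i j).deg (p i j)) ∧ q = flatDeg p ∧ a = flat u := by
  let E := Equiv.piCongrLeft' (fun w : (i : Fin n) × Fin (m i) => (A w.1 w.2).M) finSigmaFinEquiv
  have hq : q = flatDeg fun i j => q (finSigmaFinEquiv ⟨i, j⟩) := by
    funext s
    exact congrArg q (Equiv.apply_symm_apply _ s).symm
  have hE : a = flat fun i j => E.symm a ⟨i, j⟩ := (E.apply_symm_apply a).symm
  refine ⟨_, _, fun i j => ?_, hq, hE⟩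
  have h1 := ha (finSigmaFinEquiv ⟨i, j⟩)
  rw [hE] at h1
  have h2 : ∀ w : (i : Fin n) × Fin (m i), w = ⟨i, j⟩ →
      E.symm a ⟨w.1, w.2⟩ ∈ (A w.1 w.2).deg (q (finSigmaFinEquiv ⟨i, j⟩)) →
      E.symm a ⟨i, j⟩ ∈ (A i j).deg (q (finSigmaFinEquiv ⟨i, j⟩)) := by
    rintro w rfl h; exact h
  exact h2 _ (Equiv.symm_apply_apply _ _) h1

lemma flat_ext {n : ℕ} {m : Fin n → ℕ} {A : ∀ i, Fin (m i) → GMod k c} {N : Type u}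
    [AddCommGroup N] [Module k N]
    {f g : (tens (flatFam A)).M →ₗ[k] N}
    (h : ∀ (p : ∀ i, Fin (m i) → I) (u : ∀ i j, (A i j).M),
      (∀ i j, u i j ∈ (A i j).deg (p i j)) → f (pure (A := flatFam A) (flat u)) = g (pure (A := flatFam A) (flat u))) : f = g := by
  refine tens_ext fun q a ha => ?_
  obtain ⟨p, u, hu, -, rfl⟩ := exists_flat ha
  exact h p u hu

lemma flat_update {n : ℕ} {m : Fin n → ℕ} {A : ∀ i, Fin (m i) → GMod k c}
    (u : ∀ i j, (A i j).M) (f : ∀ i j, (A i j).M →ₗ[k] (A i j).M) (i : Fin n) (j : Fin (m i)) :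
    Function.update (flat u) (finSigmaFinEquiv ⟨i, j⟩) (f _ _ (flat u (finSigmaFinEquiv ⟨i, j⟩))) =
      flat (Function.update u i (Function.update (u i) j (f i j (u i j)))) := by
  funext s
  by_cases hs : s = finSigmaFinEquiv ⟨i, j⟩
  · subst hs
    rw [Function.update_self]
    have h : ∀ w : (i : Fin n) × Fin (m i), w = ⟨i, j⟩ → f w.1 w.2 (u w.1 w.2) =
        Function.update u i (Function.update (u i) j (f i j (u i j))) w.1 w.2 := by
      rintro w rfl; simp
    exact h _ (Equiv.symm_apply_apply _ _)
  · rw [Function.update_of_ne hs]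
    have h : ∀ w : (i : Fin n) × Fin (m i), w ≠ ⟨i, j⟩ → u w.1 w.2 =
        Function.update u i (Function.update (u i) j (f i j (u i j))) w.1 w.2 := by
      rintro ⟨i', j'⟩ hw
      by_cases hi : i' = i
      · subst hi
        have hj : j' ≠ j := fun hj => hw (by rw [hj])
        simp [hj]
      · simp [hi]
    exact h _ fun h' => hs (by rw [← h', Equiv.apply_symm_apply])

lemma prod_lt_flat {n : ℕ} {m : Fin n → ℕ} (η : Fin (∑ i, m i) → ℤˣ) (i : Fin n) (j : Fin (m i)) :
    (∏ s, if s < finSigmaFinEquiv ⟨i, j⟩ then η s else 1) =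
      (∏ i', if i' < i then ∏ j', η (finSigmaFinEquiv ⟨i', j'⟩) else 1) *
        ∏ j', if j' < j then η (finSigmaFinEquiv ⟨i, j'⟩) else 1 := by
  rw [prod_flat, ← Finset.mul_prod_erase _ _ (Finset.mem_univ i),
    ← Finset.mul_prod_erase _ (fun i' => if i' < i then _ else 1) (Finset.mem_univ i)]
  simp only [sigma_lt_iff, lt_irrefl, if_false, one_mul]
  rw [mul_comm]
  congr 1
  refine Finset.prod_congr rfl fun i' hi' => ?_
  rcases lt_or_gt_of_ne (Finset.ne_of_mem_erase hi') with h | h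
  · simp only [h, if_true, sigma_lt_of_lt h]
  · simp only [not_lt_of_gt h, if_false, not_lt_of_gt (sigma_lt_of_lt h _ _),
      Finset.prod_const_one]

lemma unflatG_isHom {n : ℕ} {m : Fin n → ℕ} (A : ∀ i, Fin (m i) → GMod k c) :
    GMod.IsHom (unflatG A) where
  deg p t ht := by
    refine mem_tens_induction ht (((tens fun i => tens (A i)).deg p).comap (unflatG A)) ?_
    rintro q a ha rfl
    obtain ⟨p, u, hu, rfl, rfl⟩ := exists_flat ha
    have hp : ∑ s, flatDeg p s = ∑ i, ∑ j, p i j := by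
      rw [← Equiv.sum_comp finSigmaFinEquiv, Fintype.sum_sigma]
      exact Finset.sum_congr rfl fun i _ => Finset.sum_congr rfl fun j _ => flatDeg_apply p i j
    rw [Submodule.mem_comap, unflatG_pure, hp]
    exact pure_mem fun i => pure_mem (hu i)
  d t := by
    have : unflatG A ∘ₗ (tens (flatFam A)).d = (tens fun i => tens (A i)).d ∘ₗ unflatG A := by
      refine flat_ext fun p u hu => ?_
      rw [LinearMap.comp_apply, LinearMap.comp_apply, unflatG_pure, d_pure (flatFam A) (flat_mem hu),
        d_pure (fun i => tens (A i)) (fun i => pure_mem (hu i)),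
        ← Equiv.sum_comp finSigmaFinEquiv, Fintype.sum_sigma, map_sum]
      refine Finset.sum_congr rfl fun i _ => ?_
      rw [d_pure _ (hu i)]
      rw [pure_update_sum, map_sum, Finset.smul_sum]
      refine Finset.sum_congr rfl fun j _ => ?_
      rw [map_smul, flat_update u (fun i j => (A i j).d), unflatG_pure]
      rw [pure_update_smul, smul_smul, ← map_mul, prod_lt_flat]
      congr 1
      · simp only [flatDeg_apply, ε_sum]
      · refine congrArg pure (funext fun l => ?_)
        by_cases hl : l = i
        · subst hl; simp
        · simp [hl]
    exact LinearMap.congr_fun this t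

lemma unflatG_tensMap {n : ℕ} {m : Fin n → ℕ} {A B : ∀ i, Fin (m i) → GMod k c}
    (φ : ∀ i j, (A i j).M →ₗ[k] (B i j).M)
    (t : (tens (flatFam A)).M) :
    unflatG B (tensMap (A := flatFam A) (B := flatFam B) (fun _ => φ _ _) t) = tensMap (fun i => tensMap (φ i)) (unflatG A t) := by
  have : unflatG B ∘ₗ tensMap (A := flatFam A) (B := flatFam B) (fun _ => φ _ _) =
      tensMap (fun i => tensMap (φ i)) ∘ₗ unflatG A := by
    refine flat_ext fun p u hu => ?_
    rw [LinearMap.comp_apply, LinearMap.comp_apply, unflatG_pure, tensMap_pure, tensMap_pure]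
    refine (unflatG_pure (A := B) fun i j => φ i j (u i j)).trans ?_
    refine congrArg pure (funext fun i => ?_)
    exact (tensMap_pure _ _).symm
  exact LinearMap.congr_fun this t

lemma unflatG_sum {n : ℕ} {m m' : Fin n → ℕ} {A : ∀ i, Fin (m i) → GMod k c}
    {B : ∀ i, Fin (m' i) → GMod k c} (e : ∀ i, Fin (m i) ≃ Fin (m' i))
    (φ : ∀ i j, (A i j).M →ₗ[k] (B i (e i j)).M)
    (ψ : ∀ s : Fin (∑ i, m i), (flatFam A s).M →ₗ[k] (flatFam B (sumEquiv e s)).M)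
    (hψ : ∀ (u : ∀ i j, (A i j).M) (v : ∀ i j, (B i j).M),
      (∀ i j, v i (e i j) = φ i j (u i j)) → ∀ s, flat v (sumEquiv e s) = ψ s (flat u s))
    (t : (tens (flatFam A)).M) :
    unflatG B (permMap (A := flatFam A) (B := flatFam B) (sumEquiv e) ψ t) =
      tensMap (fun i => permMap (e i) (φ i)) (unflatG A t) := by
  have : unflatG B ∘ₗ permMap (A := flatFam A) (B := flatFam B) (sumEquiv e) ψ =
      tensMap (fun i => permMap (e i) (φ i)) ∘ₗ unflatG A := by
    refine flat_ext fun p u hu => ?_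
    rw [LinearMap.comp_apply, LinearMap.comp_apply, unflatG_pure, tensMap_pure,
      permMap_pure (A := flatFam A) (B := flatFam B) _ ψ (flat_mem hu), map_smul]
    let v : ∀ i j, (B i j).M := fun i =>
      Equiv.piCongrLeft (fun j => (B i j).M) (e i) fun j => φ i j (u i j)
    have hv : (Equiv.piCongrLeft (fun s => (flatFam B s).M) (sumEquiv e)
          fun s => ψ s (flat u s)) = flat v := by
      funext s
      obtain ⟨s, rfl⟩ := (sumEquiv e).surjective s
      rw [Equiv.piCongrLeft_apply_apply]
      exact (hψ u v (fun i j => Equiv.piCongrLeft_apply_apply _ _ _ _) s).symm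
    rw [hv, unflatG_pure, permSign_sum]
    simp only [flatDeg_apply]
    rw [← pure_sg_smul]
    refine congrArg pure (funext fun i => ?_)
    exact (permMap_pure (e i) (φ i) (hu i)).symm
  exact LinearMap.congr_fun this t

lemma unflatG_block {n n' : ℕ} (σ : Fin n ≃ Fin n') {m : Fin n' → ℕ}
    {B : ∀ i, Fin (m i) → GMod k c}
    (ψ : ∀ s : Fin (∑ i, m (σ i)),
      (flatFam (fun i j => B (σ i) j) s).M →ₗ[k] (flatFam B (blockEquiv σ m s)).M)
    (hψ : ∀ (v : ∀ i j, (B i j).M) (s : Fin (∑ i, m (σ i))),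
      flat v (blockEquiv σ m s) = ψ s (flat (fun i j => v (σ i) j) s))
    (t : (tens (flatFam fun i j => B (σ i) j)).M) :
    unflatG B (permMap (A := flatFam fun i j => B (σ i) j) (B := flatFam B)
        (blockEquiv σ m) ψ t) =
      permMap (B := fun i => tens (B i)) σ (fun _ => LinearMap.id)
        (unflatG (fun i j => B (σ i) j) t) := by
  have : unflatG B ∘ₗ permMap (A := flatFam fun i j => B (σ i) j) (B := flatFam B)
        (blockEquiv σ m) ψ =
      permMap (B := fun i => tens (B i)) σ (fun _ => LinearMap.id) ∘ₗ
        unflatG (fun i j => B (σ i) j) := by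
    refine flat_ext fun p u hu => ?_
    rw [LinearMap.comp_apply, LinearMap.comp_apply, unflatG_pure,
      permMap_pure (A := flatFam fun i j => B (σ i) j) (B := flatFam B) _ ψ (flat_mem hu),
      map_smul]
    let v : ∀ i j, (B i j).M :=
      Equiv.piCongrLeft (fun i => ∀ j, (B i j).M) σ u
    have hu' : u = fun i j => v (σ i) j := by
      funext i
      exact (Equiv.piCongrLeft_apply_apply (fun i => ∀ j, (B i j).M) σ u i).symm
    have hv : (Equiv.piCongrLeft (fun s => (flatFam B s).M) (blockEquiv σ m)
          fun s => ψ s (flat u s)) = flat v := by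
      funext s
      obtain ⟨s, rfl⟩ := (blockEquiv σ m).surjective s
      rw [Equiv.piCongrLeft_apply_apply, hψ v, ← hu']
    rw [hv, unflatG_pure, permSign_block,
      permMap_pure (B := fun i => tens (B i)) σ _ fun i => pure_mem (hu i)]
    simp only [flatDeg_apply, ε_sum]
    congr 2
    funext i
    obtain ⟨i, rfl⟩ := σ.surjective i
    rw [Equiv.piCongrLeft_apply_apply, LinearMap.id_apply]
    exact congrArg pure (Equiv.piCongrLeft_apply_apply (fun i => ∀ j, (B i j).M) σ u i)
  exact LinearMap.congr_fun this t

/-- The identification `C^{⊗ z₁ ⋯ zₙ} = C^{⊗ z₁} ⊗ ⋯ ⊗ C^{⊗ zₙ}`. -/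
def unflat (C : X → Cplx k c) (x : Word X) (z : Fin x.len → Word X) :
    (wt C (concat x z)).M →ₗ[k] (tens fun i => wt C (z i)).M :=
  unflatG (m := fun i => (z i).len) fun i j => tot (C ((z i).col j))

lemma unflat_isHom (C : X → Cplx k c) (x : Word X) (z : Fin x.len → Word X) :
    GMod.IsHom (unflat C x z) := unflatG_isHom _

lemma unflat_wtFun {C D : X → Cplx k c} (f : C ⟶ D) (x : Word X) (z : Fin x.len → Word X)
    (t : (wt C (concat x z)).M) :
    unflat D x z (wtFun f _ t) = tensMap (fun i => wtFun f (z i)) (unflat C x z t) :=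
  unflatG_tensMap (m := fun i => (z i).len) (fun i j => totMap (f ((z i).col j))) t

lemma colMap_flat (C : X → Cplx k c) {x : Word X} {z : Fin x.len → Word X}
    (v : ∀ i j, (tot (C ((z i).col j))).M) {w w' : (i : Fin x.len) × Fin (z i).len}
    (h : w = w') (h' : (z w.1).col w.2 = (z w'.1).col w'.2) :
    v w'.1 w'.2 = colMap C h' (v w.1 w.2) := by
  subst h; rw [colMap_rfl]

lemma unflat_concatMap (C : X → Cplx k c) (x : Word X) {z z' : Fin x.len → Word X}
    (e : ∀ i, z i ⟶ z' i) (t : (wt C (concat x z)).M) :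
    unflat C x z' (wtMap C (concatMap x e) t) =
      tensMap (fun i => wtMap C (e i)) (unflat C x z t) := by
  refine unflatG_sum (m := fun i => (z i).len) (m' := fun i => (z' i).len)
    (A := fun i j => tot (C ((z i).col j))) (B := fun i j => tot (C ((z' i).col j)))
    (fun i => (e i).1) (fun i j => colMap C ((e i).2 j).symm)
    (fun s => colMap C ((concatMap x e).2 s).symm) ?_ t
  intro u v h s
  refine (colMap_flat C (x := x) (z := z') v (w := ⟨_, (e _).1 _⟩)
    (Equiv.symm_apply_apply finSigmaFinEquiv _).symm (concat_col_mk x z' _).symm).trans ?_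
  exact (congrArg _ (h _ _)).trans (colMap_colMap C _ _ _)

lemma unflat_blockHom (C : X → Cplx k c) (x : Word X) {n : ℕ} (σ : Fin n ≃ Fin x.len)
    (z : Fin x.len → Word X) (t : (wt C (concat (x.pull σ) fun i => z (σ i))).M) :
    unflat C x z (wtMap C (blockHom x σ z) t) =
      permMap (B := fun i => wt C (z i)) σ (fun _ => LinearMap.id)
        (unflat C (x.pull σ) (fun i => z (σ i)) t) := by
  refine unflatG_block σ (m := fun i => (z i).len) (B := fun i j => tot (C ((z i).col j)))
    (fun s => colMap C ((blockHom x σ z).2 s).symm) ?_ t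
  intro v s
  exact colMap_flat C (x := x) (z := z) v (w := ⟨σ _, _⟩)
    (Equiv.symm_apply_apply finSigmaFinEquiv _).symm (concat_col_mk x z _).symm

end Words

/-! ## Complexes of graded maps -/

section HomSp

variable (k c) in
/-- A vector space `L` of maps between total spaces, with the subspaces of maps of degree `p` and the
operators `f ↦ d ∘ f` and `f ↦ f ∘ d`. It is only used for `hatSp` and `hat₂Sp` below. -/
structure HomSp where
  L : Type u
  [grp : AddCommGroup L]
  [mod : Module k L]
  deg : I → Submodule k L
  post : L →ₗ[k] L
  pre : L →ₗ[k] L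
  post_mem : ∀ {p q f}, c.Rel p q → f ∈ deg p → post f ∈ deg q
  pre_mem : ∀ {p q f}, c.Rel p q → f ∈ deg p → pre f ∈ deg q
  post_post : ∀ f, post (post f) = 0
  pre_pre : ∀ f, pre (pre f) = 0
  post_pre : ∀ f, post (pre f) = pre (post f)

attribute [instance] HomSp.grp HomSp.mod

namespace HomSp

/-- The differential `f ↦ d ∘ f - (-1)^p f ∘ d` on maps of degree `p`. -/
def D (H : HomSp k c) (p : I) : H.L →ₗ[k] H.L := H.post - sg k (c.ε p) • H.pre

lemma D_mem (H : HomSp k c) {p q : I} (h : c.Rel p q) {f : H.L} (hf : f ∈ H.deg p) :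
    H.D p f ∈ H.deg q :=
  sub_mem (H.post_mem h hf) (Submodule.smul_mem _ _ (H.pre_mem h hf))

lemma D_D (H : HomSp k c) {p q : I} (h : c.Rel p q) (f : H.L) : H.D q (H.D p f) = 0 := by
  have hs : c.ε q = - c.ε p := c.ε_succ h
  simp only [D, LinearMap.sub_apply, LinearMap.smul_apply, map_sub, map_smul, H.post_post,
    H.pre_pre, H.post_pre, hs, sg_neg]
  simp

/-- The complex of graded maps. -/
def cplx (H : HomSp k c) : Cplx k c where
  X p := ModuleCat.of k (H.deg p)
  d p q := open Classical in
    if h : c.Rel p q then ModuleCat.ofHom ((H.D p).restrict fun _ hf => H.D_mem h hf) else 0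
  shape p q h := by rw [dif_neg h]
  d_comp_d' p q r h1 h2 := by
    rw [dif_pos h1, dif_pos h2]
    ext f
    exact H.D_D h1 f.1

lemma cplx_d (H : HomSp k c) {p q : I} (h : c.Rel p q) (f : H.deg p) :
    ((H.cplx.d p q).hom f : H.deg q) = ⟨H.D p f.1, H.D_mem h f.2⟩ := by
  have : H.cplx.d p q = ModuleCat.ofHom ((H.D p).restrict fun _ hf => H.D_mem h hf) := dif_pos h
  rw [this]
  rfl

/-- The chain map given by a linear map which respects degrees and differentials. -/
def cplxMap {H K : HomSp k c} (φ : H.L →ₗ[k] K.L) (h1 : ∀ p, ∀ f ∈ H.deg p, φ f ∈ K.deg p)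
    (h2 : ∀ p, ∀ f ∈ H.deg p, K.D p (φ f) = φ (H.D p f)) : H.cplx ⟶ K.cplx where
  f p := ModuleCat.ofHom (φ.restrict (h1 p))
  comm' p q h := by
    ext f
    exact (cplx_d K h _).trans ((Subtype.ext (h2 p f.1 f.2)).trans
      (congrArg (φ.restrict (h1 q)) (cplx_d H h f)).symm)

/-- The total space of the complex of graded maps, mapped to the space of all maps. -/
def total (H : HomSp k c) : (tot H.cplx).M →ₗ[k] H.L :=
  DirectSum.toModule k I _ fun p => (H.deg p).subtype

lemma total_ι (H : HomSp k c) (p : I) (f : H.deg p) : H.total (ι H.cplx p f) = f.1 :=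
  DirectSum.toModule_lof k (M := fun p => H.deg p) (φ := fun p => (H.deg p).subtype) p f

lemma total_totMap {H K : HomSp k c} (φ : H.L →ₗ[k] K.L) (h1 : ∀ p, ∀ f ∈ H.deg p, φ f ∈ K.deg p)
    (h2 : ∀ p, ∀ f ∈ H.deg p, K.D p (φ f) = φ (H.D p f)) (f : (tot H.cplx).M) :
    K.total (totMap (cplxMap φ h1 h2) f) = φ (H.total f) := by
  have : K.total ∘ₗ totMap (cplxMap φ h1 h2) = φ ∘ₗ H.total := by
    refine tot_ext fun p f => ?_
    rw [LinearMap.comp_apply, LinearMap.comp_apply, totMap_ι]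
    refine (total_ι K p _).trans ?_
    exact (congrArg φ (total_ι H p f)).symm
  exact LinearMap.congr_fun this f

end HomSp

/-- In a shape of complexes with tensor products, either all differentials vanish or all degrees
have a successor. -/
lemma no_rel {p : I} (h : ∀ q, ¬ c.Rel p q) (i j : I) : ¬ c.Rel i j := by
  intro hij
  refine h (p - i + j) ?_
  have := c.add_rel (p - i) hij
  rwa [sub_add_cancel] at this

lemma GMod.d_of_no_rel (A : GMod k c) {p : I} (h : ∀ q, ¬ c.Rel p q) (a : A.M) : A.d a = 0 := by
  have : A.d = 0 := A.ext_deg fun i a ha => A.d_eq_zero ha fun j => no_rel h i j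
  rw [this, LinearMap.zero_apply]

lemma GMod.d_mem' (A : GMod k c) {p q i : I} {a : A.M} (h : c.Rel p q) (ha : a ∈ A.deg i) :
    A.d a ∈ A.deg (q - p + i) := by
  refine A.d_mem ha ?_
  have h1 := c.add_rel (i - p) h
  rw [sub_add_cancel] at h1
  convert h1 using 1
  abel

end HomSp

/-! ## Operads -/

section Operads

variable (k c) in
/-- A symmetric operad with set of colours `X` in the category of complexes of shape `c`:
for each colour `y` a functor `x ↦ P(x; y)` on words (so that the symmetric groups act), units
in `P(y; y)` and compositions
`P(x; y) ⊗ P(z₁; x₁) ⊗ ⋯ ⊗ P(zₙ; xₙ) ⟶ P(z₁ ⋯ zₙ; y)` which are chain maps, equivariant,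
associative and unital. -/
structure Operad (X : Type u) where
  obj : X → Word X ⥤ Cplx k c
  unit : ∀ y, (tot ((obj y).obj (Word.single y))).M
  unit_mem : ∀ y, unit y ∈ (tot ((obj y).obj (Word.single y))).deg 0
  d_unit : ∀ y, (tot ((obj y).obj (Word.single y))).d (unit y) = 0
  comp : ∀ (y : X) (x : Word X) (z : Fin x.len → Word X),
    (tot ((obj y).obj x)).M →ₗ[k] (tens fun i => tot ((obj (x.col i)).obj (z i))).M →ₗ[k]
      (tot ((obj y).obj (x.concat z))).M
  comp_isPairing : ∀ y x z, IsPairing (comp y x z)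
  comp_map : ∀ y x (z z' : Fin x.len → Word X) (e : ∀ i, z i ⟶ z' i) μ ν,
    comp y x z' μ (tensMap (A := fun i => tot ((obj (x.col i)).obj (z i)))
        (B := fun i => tot ((obj (x.col i)).obj (z' i)))
        (fun i => totMap ((obj (x.col i)).map (e i))) ν) =
      totMap ((obj y).map (x.concatMap e)) (comp y x z μ ν)
  comp_pull : ∀ y (x : Word X) (n : ℕ) (σ : Fin n ≃ Fin x.len) (z : Fin x.len → Word X) μ ν,
    comp y x z (totMap ((obj y).map (x.pullHom σ)) μ)
        (permMap (A := fun i => tot ((obj (x.col (σ i))).obj (z (σ i))))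
          (B := fun i => tot ((obj (x.col i)).obj (z i))) σ (fun _ => LinearMap.id) ν) =
      totMap ((obj y).map (x.blockHom σ z)) (comp y (x.pull σ) (fun i => z (σ i)) μ ν)
  assoc : ∀ y (x : Word X) (z : Fin x.len → Word X) (t : ∀ i, Fin (z i).len → Word X) μ ν ρ,
    totMap ((obj y).map (x.concatAssoc z t))
      (comp y (x.concat z) (fun s => t (finSigmaFinEquiv.symm s).1 (finSigmaFinEquiv.symm s).2)
        (comp y x z μ ν) ρ) =
      comp y x (fun i => (z i).concat (t i)) μ
        (pairTens (fun i => comp (x.col i) (z i) (t i)) ν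
          (unflatG (m := fun i => (z i).len)
            (fun i j => tot ((obj ((z i).col j)).obj (t i j))) ρ))
  unit_comp : ∀ y x μ, totMap ((obj y).map (Word.concatSingle y x))
    (comp y (Word.single y) (fun _ => x) (unit y)
      (pure (A := fun _ : Fin 1 => tot ((obj y).obj x)) fun _ => μ)) = μ
  comp_unit : ∀ y (x : Word X) μ, totMap ((obj y).map x.concatLetters)
    (comp y x (fun i => Word.single (x.col i)) μ
      (pure (A := fun i => tot ((obj (x.col i)).obj (Word.single (x.col i))))
        fun i => unit (x.col i))) = μ

namespace Operad

variable {X : Type u} (P : Operad k c X)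

/-- The total space of `P(x; y)`. -/
abbrev ops (y : X) (x : Word X) : GMod k c := tot ((P.obj y).obj x)

/-- The total space of `P(z₁; x₁) ⊗ ⋯ ⊗ P(zₙ; xₙ)`. -/
abbrev opsTens (x : Word X) (z : Fin x.len → Word X) : GMod k c :=
  tens fun i => P.ops (x.col i) (z i)

/-- The total space of `C^{⊗ z₁} ⊗ ⋯ ⊗ C^{⊗ zₙ}`. -/
abbrev wtTens (C : X → Cplx k c) (x : Word X) (z : Fin x.len → Word X) : GMod k c :=
  tens fun i => wt C (z i)

/-- The action of morphisms of words on `P`. -/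
abbrev act (y : X) {x x' : Word X} (e : x ⟶ x') : (P.ops y x).M →ₗ[k] (P.ops y x').M :=
  totMap ((P.obj y).map e)

/-- The action of morphisms of words on `P(z₁; x₁) ⊗ ⋯ ⊗ P(zₙ; xₙ)`. -/
abbrev actTens (x : Word X) {z z' : Fin x.len → Word X} (e : ∀ i, z i ⟶ z' i) :
    (P.opsTens x z).M →ₗ[k] (P.opsTens x z').M :=
  tensMap fun i => P.act (x.col i) (e i)

/-- The permutation of the factors of `P(z₁; x₁) ⊗ ⋯ ⊗ P(zₙ; xₙ)`. -/
abbrev permTens (x : Word X) {n : ℕ} (σ : Fin n ≃ Fin x.len) (z : Fin x.len → Word X) :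
    (P.opsTens (x.pull σ) fun i => z (σ i)).M →ₗ[k] (P.opsTens x z).M :=
  permMap (A := fun i => P.ops (x.col (σ i)) (z (σ i))) (B := fun i => P.ops (x.col i) (z i)) σ
    fun _ => LinearMap.id

/-- The permutation of the factors of `C^{⊗ z₁} ⊗ ⋯ ⊗ C^{⊗ zₙ}`. -/
abbrev wtPerm (C : X → Cplx k c) (x : Word X) {n : ℕ} (σ : Fin n ≃ Fin x.len)
    (z : Fin x.len → Word X) :
    (wtTens C (x.pull σ) fun i => z (σ i)).M →ₗ[k] (wtTens C x z).M :=
  permMap (A := fun i => wt C (z (σ i))) (B := fun i => wt C (z i)) σ fun _ => LinearMap.id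

/-! ### The functor `P^∧` -/

/-- The graded maps underlying `P^∧(C)^y = [P(x; y), C^{⊗ x}]`: families of maps
`P(x; y) → C^{⊗ x}` of degree `p`, natural in the word `x`. -/
def hatSp (C : X → Cplx k c) (y : X) : HomSp k c where
  L := ∀ x, (P.ops y x).M →ₗ[k] (wt C x).M
  deg p :=
    { carrier := {f | (∀ x q, ∀ a ∈ (P.ops y x).deg q, f x a ∈ (wt C x).deg (p + q)) ∧
        ∀ x x' (e : x ⟶ x') a, f x' (P.act y e a) = wtMap C e (f x a)}
      add_mem' := fun hf hg => ⟨fun x q a ha => add_mem (hf.1 x q a ha) (hg.1 x q a ha),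
        fun x x' e a => by
          simp only [Pi.add_apply, LinearMap.add_apply, map_add, hf.2 x x' e a, hg.2 x x' e a]⟩
      zero_mem' := ⟨fun x q a ha => zero_mem _, fun x x' e a => (map_zero _).symm⟩
      smul_mem' := fun r f hf => ⟨fun x q a ha => Submodule.smul_mem _ _ (hf.1 x q a ha),
        fun x x' e a => by
          simp only [Pi.smul_apply, LinearMap.smul_apply, map_smul, hf.2 x x' e a]⟩ }
  post :=
    { toFun := fun f x => (wt C x).d ∘ₗ f x
      map_add' := fun f g => funext fun x => LinearMap.comp_add _ _ _
      map_smul' := fun r f => funext fun x => LinearMap.comp_smul _ _ _ }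
  pre :=
    { toFun := fun f x => f x ∘ₗ (P.ops y x).d
      map_add' := fun f g => funext fun x => LinearMap.add_comp _ _ _
      map_smul' := fun r f => funext fun x => LinearMap.smul_comp _ _ _ }
  post_mem := by
    intro p q f h hf
    refine ⟨fun x i a ha => ?_, fun x x' e a => ?_⟩
    · have := (wt C x).d_mem' h (hf.1 x i a ha)
      rwa [← add_assoc, sub_add_cancel] at this
    · exact (congrArg _ (hf.2 x x' e a)).trans ((wtMap_isHom C e).d _).symm
  pre_mem := by
    intro p q f h hf
    refine ⟨fun x i a ha => ?_, fun x x' e a => ?_⟩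
    · have := hf.1 x _ _ ((P.ops y x).d_mem' h ha)
      rwa [← add_assoc, add_sub_cancel] at this
    · exact (congrArg _ ((totMap_isHom _).d a).symm).trans (hf.2 x x' e _)
  post_post f := funext fun x => LinearMap.ext fun a => (wt C x).d_d _
  pre_pre f := funext fun x => LinearMap.ext fun a =>
    (congrArg (f x) ((P.ops y x).d_d _)).trans (map_zero _)
  post_pre f := rfl

/-- The map of graded maps induced by `C ⟶ D`. -/
def hatSpMap {C D : X → Cplx k c} (f : C ⟶ D) (y : X) : (P.hatSp C y).L →ₗ[k] (P.hatSp D y).L where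
  toFun g x := wtFun f x ∘ₗ g x
  map_add' _ _ := funext fun _ => LinearMap.comp_add _ _ _
  map_smul' _ _ := funext fun _ => LinearMap.comp_smul _ _ _

lemma hatSpMap_mem {C D : X → Cplx k c} (f : C ⟶ D) (y : X) (p : I) (g : (P.hatSp C y).L)
    (hg : g ∈ (P.hatSp C y).deg p) : P.hatSpMap f y g ∈ (P.hatSp D y).deg p :=
  ⟨fun x q a ha => (wtFun_isHom f x).deg _ _ (hg.1 x q a ha),
    fun x x' e a => (congrArg _ (hg.2 x x' e a)).trans (wtMap_wtFun f e _).symm⟩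

lemma hatSpMap_D {C D : X → Cplx k c} (f : C ⟶ D) (y : X) (p : I) (g : (P.hatSp C y).L) :
    (P.hatSp D y).D p (P.hatSpMap f y g) = P.hatSpMap f y ((P.hatSp C y).D p g) :=
  funext fun x => LinearMap.ext fun a => by
    refine Eq.trans ?_ (map_sub (wtFun f x) ((wt C x).d (g x a)) _).symm
    refine congrArg₂ (· - ·) ((wtFun_isHom f x).d _).symm ?_
    exact (map_smul (wtFun f x) _ _).symm

/-- The map `P^∧(C) ⟶ P^∧(D)` induced by `C ⟶ D`. -/
def hatMap {C D : X → Cplx k c} (f : C ⟶ D) (y : X) : (P.hatSp C y).cplx ⟶ (P.hatSp D y).cplx :=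
  HomSp.cplxMap (P.hatSpMap f y) (P.hatSpMap_mem f y) fun p g _ => P.hatSpMap_D f y p g

/-- The functor `P^∧`, with `P^∧(C)^y = [P(x; y), C^{⊗ x}]`. -/
def hat : (X → Cplx k c) ⥤ (X → Cplx k c) where
  obj C y := (P.hatSp C y).cplx
  map f y := P.hatMap f y
  map_id C := by
    funext y
    ext p f
    refine Subtype.ext (funext fun x => ?_)
    exact (congrArg (· ∘ₗ _) (wtFun_id C x)).trans (LinearMap.id_comp _)
  map_comp f g := by
    funext y
    ext p h
    refine Subtype.ext (funext fun x => ?_)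
    exact (congrArg (· ∘ₗ _) (wtFun_comp f g x)).trans (LinearMap.comp_assoc _ _ _)

/-! ### The functor `P^∧₂` -/

/-- Families of bilinear maps `P(x; y) × P(z₁; x₁) ⊗ ⋯ ⊗ P(zₙ; xₙ) → C^{⊗ z₁} ⊗ ⋯ ⊗ C^{⊗ zₙ}`. -/
abbrev Hat₂L (C : X → Cplx k c) (y : X) : Type u :=
  ∀ x z, (P.ops y x).M →ₗ[k] (P.opsTens x z).M →ₗ[k] (wtTens C x z).M

/-- Composition with the differential of the target. -/
def hat₂Post (C : X → Cplx k c) (y : X) : P.Hat₂L C y →ₗ[k] P.Hat₂L C y where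
  toFun F x z := (F x z).compr₂ (wtTens C x z).d
  map_add' _ _ := funext fun x => funext fun z => LinearMap.ext₂ fun _ _ =>
    map_add (wtTens C x z).d _ _
  map_smul' _ _ := funext fun x => funext fun z => LinearMap.ext₂ fun _ _ =>
    map_smul (wtTens C x z).d _ _

/-- Composition with the differential `d ⊗ 1 + σ ⊗ d` of the source. -/
def hat₂Pre (C : X → Cplx k c) (y : X) : P.Hat₂L C y →ₗ[k] P.Hat₂L C y where
  toFun F x z := F x z ∘ₗ (P.ops y x).d + (F x z).compl₁₂ (P.ops y x).sgn (P.opsTens x z).d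
  map_add' _ _ := funext fun _ => funext fun _ => LinearMap.ext₂ fun _ _ =>
    add_add_add_comm _ _ _ _
  map_smul' r _ := funext fun _ => funext fun _ => LinearMap.ext₂ fun _ _ =>
    (smul_add r _ _).symm

lemma hat₂Pre_apply (C : X → Cplx k c) (y : X) (F : P.Hat₂L C y) (x : Word X)
    (z : Fin x.len → Word X) (a : (P.ops y x).M) (b : (P.opsTens x z).M) :
    P.hat₂Pre C y F x z a b = F x z ((P.ops y x).d a) b +
      F x z ((P.ops y x).sgn a) ((P.opsTens x z).d b) := rfl

/-- The graded maps underlying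
`P^∧₂(C)^y = [P(x; y), [P(z₁; x₁) ⊗ ⋯ ⊗ P(zₙ; xₙ), C^{⊗ z₁} ⊗ ⋯ ⊗ C^{⊗ zₙ}]]`: families of
bilinear maps of degree `p`, natural in the words `x` and `z₁, …, zₙ`. -/
def hat₂Sp (C : X → Cplx k c) (y : X) : HomSp k c where
  L := P.Hat₂L C y
  deg p :=
    { carrier := {F | (∀ x z q r, ∀ a ∈ (P.ops y x).deg q, ∀ b ∈ (P.opsTens x z).deg r,
          F x z a b ∈ (wtTens C x z).deg (p + (q + r))) ∧
        (∀ x (z z' : Fin x.len → Word X) (e : ∀ i, z i ⟶ z' i) a b, F x z' a (P.actTens x e b) =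
          tensMap (fun i => wtMap C (e i)) (F x z a b)) ∧
        ∀ x n (σ : Fin n ≃ Fin x.len) (z : Fin x.len → Word X) a b,
          F x z (P.act y (x.pullHom σ) a) (P.permTens x σ z b) =
          wtPerm C x σ z (F (x.pull σ) (fun i => z (σ i)) a b)}
      add_mem' := fun hf hg =>
        ⟨fun x z q r a ha b hb => add_mem (hf.1 x z q r a ha b hb) (hg.1 x z q r a ha b hb),
        fun x z z' e a b => (congrArg₂ (· + ·) (hf.2.1 x z z' e a b) (hg.2.1 x z z' e a b)).trans
          (map_add _ _ _).symm,
        fun x n σ z a b => (congrArg₂ (· + ·) (hf.2.2 x n σ z a b) (hg.2.2 x n σ z a b)).trans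
          (map_add _ _ _).symm⟩
      zero_mem' := ⟨fun _ _ _ _ _ _ _ _ => zero_mem _, fun _ _ _ _ _ _ => (map_zero _).symm,
        fun _ _ _ _ _ _ => (map_zero _).symm⟩
      smul_mem' := fun s f hf =>
        ⟨fun x z q r a ha b hb => Submodule.smul_mem _ _ (hf.1 x z q r a ha b hb),
        fun x z z' e a b => (congrArg (s • ·) (hf.2.1 x z z' e a b)).trans (map_smul _ _ _).symm,
        fun x n σ z a b => (congrArg (s • ·) (hf.2.2 x n σ z a b)).trans (map_smul _ _ _).symm⟩ }
  post := P.hat₂Post C y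
  pre := P.hat₂Pre C y
  post_mem := by
    intro p q F h hF
    refine ⟨fun x z i j a ha b hb => ?_, fun x z z' e a b => ?_, fun x n σ z a b => ?_⟩
    · have := (wtTens C x z).d_mem' h (hF.1 x z i j a ha b hb)
      rwa [← add_assoc, sub_add_cancel] at this
    · exact (congrArg _ (hF.2.1 x z z' e a b)).trans
        ((tensMap_isHom fun i => wtMap_isHom C (e i)).d _).symm
    · exact (congrArg _ (hF.2.2 x n σ z a b)).trans
        ((permMap_isHom σ fun i => GMod.IsHom.id _).d _).symm
  pre_mem := by
    intro p q F h hF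
    refine ⟨fun x z i j a ha b hb => ?_, fun x z z' e a b => ?_, fun x n σ z a b => ?_⟩
    · refine add_mem ?_ ?_
      · have := hF.1 x z _ _ _ ((P.ops y x).d_mem' h ha) b hb
        rwa [add_assoc, ← add_assoc, add_sub_cancel] at this
      · have := hF.1 x z _ _ _ ((P.ops y x).sgn_of_mem ha ▸ Submodule.smul_mem _ _ ha) _
          ((P.opsTens x z).d_mem' h hb)
        rwa [add_left_comm i, ← add_assoc, add_sub_cancel] at this
    · rw [hat₂Pre_apply, hat₂Pre_apply, map_add, hF.2.1 x z z' e]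
      congr 1
      refine Eq.trans (congrArg _ ?_) (hF.2.1 x z z' e _ _)
      exact ((tensMap_isHom fun i => totMap_isHom _).d b).symm
    · rw [hat₂Pre_apply, hat₂Pre_apply, map_add]
      congr 1
      · refine Eq.trans ?_ (hF.2.2 x n σ z _ b)
        exact congrArg (fun a => F x z a _) ((totMap_isHom _).d a).symm
      · refine Eq.trans ?_ (hF.2.2 x n σ z _ _)
        refine congrArg₂ (fun a b => F x z a b) ((totMap_isHom _).sgn a).symm ?_
        exact ((permMap_isHom (A := fun i => P.ops (x.col (σ i)) (z (σ i)))
          (B := fun i => P.ops (x.col i) (z i)) σ fun i => GMod.IsHom.id _).d b).symm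
  post_post F := funext fun x => funext fun z => LinearMap.ext₂ fun a b => (wtTens C x z).d_d _
  pre_pre F := funext fun x => funext fun z => LinearMap.ext₂ fun a b => by
    rw [hat₂Pre_apply, hat₂Pre_apply, hat₂Pre_apply, GMod.d_d, GMod.d_d, GMod.sgn_d, map_zero, map_zero, map_neg, LinearMap.zero_apply,
      LinearMap.neg_apply]
    abel
  post_pre F := funext fun x => funext fun z => LinearMap.ext₂ fun a b =>
    map_add (wtTens C x z).d _ _

/-- The map of graded maps induced by `C ⟶ D`. -/
def hat₂SpMap {C D : X → Cplx k c} (f : C ⟶ D) (y : X) :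
    (P.hat₂Sp C y).L →ₗ[k] (P.hat₂Sp D y).L where
  toFun F x z := (F x z).compr₂ (tensMap fun i => wtFun f (z i))
  map_add' _ _ := funext fun _ => funext fun z => LinearMap.ext₂ fun _ _ =>
    map_add (tensMap (A := fun i => wt C (z i)) (B := fun i => wt D (z i))
      fun i => wtFun f (z i)) _ _
  map_smul' _ _ := funext fun _ => funext fun z => LinearMap.ext₂ fun _ _ =>
    map_smul (tensMap (A := fun i => wt C (z i)) (B := fun i => wt D (z i))
      fun i => wtFun f (z i)) _ _

/-- The map `P^∧₂(C) ⟶ P^∧₂(D)` induced by `C ⟶ D`. -/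
def hat₂Map {C D : X → Cplx k c} (f : C ⟶ D) (y : X) :
    (P.hat₂Sp C y).cplx ⟶ (P.hat₂Sp D y).cplx :=
  HomSp.cplxMap (P.hat₂SpMap f y)
    (fun p F hF => by
      refine ⟨fun x z q r a ha b hb => ?_, fun x z z' e a b => ?_, fun x n σ z a b => ?_⟩
      · exact (tensMap_isHom fun i => wtFun_isHom f (z i)).deg _ _ (hF.1 x z q r a ha b hb)
      · refine (congrArg _ (hF.2.1 x z z' e a b)).trans ?_
        refine (LinearMap.congr_fun (tensMap_comp _ _) _).symm.trans ?_
        refine Eq.trans ?_ (LinearMap.congr_fun (tensMap_comp _ _) _)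
        refine congrArg (fun φ => tensMap φ (F x z a b)) (funext fun i => LinearMap.ext fun t => ?_)
        exact (wtMap_wtFun f (e i) t).symm
      · refine (congrArg _ (hF.2.2 x n σ z a b)).trans ?_
        exact (permMap_tensMap σ (fun i => wtFun_isHom f (z (σ i))) (fun i t => rfl) _).symm)
    (fun p F _ => funext fun x => funext fun z => LinearMap.ext₂ fun a b => by
      let τ := tensMap (A := fun i => wt C (z i)) (B := fun i => wt D (z i))
        fun i => wtFun f (z i)
      refine Eq.trans ?_ (map_sub τ ((wtTens C x z).d (F x z a b)) _).symm
      refine congrArg₂ (· - ·) ((tensMap_isHom fun i => wtFun_isHom f (z i)).d _).symm ?_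
      refine Eq.trans ?_ (map_smul τ _ _).symm
      exact congrArg _ (map_add τ _ _).symm)

/-- The functor `P^∧₂`. -/
def hat₂ : (X → Cplx k c) ⥤ (X → Cplx k c) where
  obj C y := (P.hat₂Sp C y).cplx
  map f y := P.hat₂Map f y
  map_id C := by
    funext y
    ext p F
    refine Subtype.ext (funext fun x => funext fun z => LinearMap.ext₂ fun a b => ?_)
    refine (LinearMap.congr_fun (congrArg tensMap (funext fun i => wtFun_id C (z i))) _).trans ?_
    exact LinearMap.congr_fun (tensMap_id _) _
  map_comp f g := by
    funext y
    ext p F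
    refine Subtype.ext (funext fun x => funext fun z => LinearMap.ext₂ fun a b => ?_)
    refine (LinearMap.congr_fun (congrArg tensMap (funext fun i => wtFun_comp f g (z i))) _).trans ?_
    exact LinearMap.congr_fun (tensMap_comp _ _) _

end Operad

end Operads

section Maps

variable {X : Type u}

lemma oneOut_aux (A : GMod k c) {p : Fin 1 → I} {a : Fin 1 → A.M} (ha : ∀ i, a i ∈ A.deg (p i)) :
    a 0 ∈ A.deg (∑ i, p i) := by
  rw [Fin.sum_univ_one]; exact ha 0

/-- The identification of a tensor product with one factor with that factor. -/
def oneOut (A : GMod k c) : (tens fun _ : Fin 1 => A).M →ₗ[k] A.M :=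
  (PiTensorProduct.subsingletonEquiv (R := k) (s := fun _ : Fin 1 => A.M) 0).toLinearMap

lemma oneOut_pure (A : GMod k c) (a : Fin 1 → A.M) :
    oneOut A (pure (A := fun _ : Fin 1 => A) a) = a 0 :=
  PiTensorProduct.subsingletonEquiv_apply_tprod 0 a

lemma oneOut_isHom (A : GMod k c) : GMod.IsHom (oneOut A) where
  deg p t ht := by
    refine mem_tens_induction ht ((A.deg p).comap (oneOut A)) ?_
    rintro q a ha rfl
    rw [Submodule.mem_comap, oneOut_pure]
    exact oneOut_aux A ha
  d t := by
    have : oneOut A ∘ₗ (tens fun _ : Fin 1 => A).d = A.d ∘ₗ oneOut A := by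
      refine tens_ext fun p a ha => ?_
      rw [LinearMap.comp_apply, LinearMap.comp_apply, oneOut_pure, d_pure _ ha, map_sum,
        Fin.sum_univ_one, map_smul, oneOut_pure]
      simp
    exact LinearMap.congr_fun this t

lemma oneOut_tensMap {A B : GMod k c} (φ : A.M →ₗ[k] B.M) (t : (tens fun _ : Fin 1 => A).M) :
    oneOut B (tensMap (A := fun _ : Fin 1 => A) (B := fun _ : Fin 1 => B) (fun _ => φ) t) =
      φ (oneOut A t) := by
  have : oneOut B ∘ₗ tensMap (A := fun _ : Fin 1 => A) (B := fun _ : Fin 1 => B) (fun _ => φ) =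
      φ ∘ₗ oneOut A := by
    refine tens_ext fun p a _ => ?_
    rw [LinearMap.comp_apply, LinearMap.comp_apply, tensMap_pure, oneOut_pure, oneOut_pure]
  exact LinearMap.congr_fun this t

lemma cproj_totMap {A B : Cplx k c} (f : A ⟶ B) {p : I} {a : (tot A).M} (h : a ∈ (tot A).deg p) :
    cproj B p (totMap f a) = (f.f p).hom (cproj A p a) := by
  rw [← ι_cproj A h, totMap_ι, cproj_ι, cproj_ι]

lemma IsPairing.D {G A B : GMod k c} {ev : G.M →ₗ[k] A.M →ₗ[k] B.M} (h : IsPairing ev) {s : k}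
    (hs : s * s = 1) {g g' g'' : G.M} {a : A.M} (hg : g'' = s • G.sgn g) :
    B.d (ev g a) - s • (ev g' a + ev g'' (A.d a)) = ev (G.d g - s • g') a := by
  rw [h.d, hg, map_smul, LinearMap.smul_apply, smul_add, smul_smul, hs, one_smul,
    add_sub_add_right_eq_sub, map_sub, LinearMap.sub_apply, map_smul, LinearMap.smul_apply]

namespace Operad

variable (P : Operad k c X)

lemma hatSp_D_apply (C : X → Cplx k c) (y : X) (p : I) (f : (P.hatSp C y).L) (x : Word X)
    (a : (P.ops y x).M) : (P.hatSp C y).D p f x a =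
      (wt C x).d (f x a) - sg k (c.ε p) • f x ((P.ops y x).d a) := rfl

lemma hat₂Sp_D_apply (C : X → Cplx k c) (y : X) (p : I) (F : (P.hat₂Sp C y).L) (x : Word X)
    (z : Fin x.len → Word X) (a : (P.ops y x).M) (b : (P.opsTens x z).M) :
    (P.hat₂Sp C y).D p F x z a b = (wtTens C x z).d (F x z a b) -
      sg k (c.ε p) • (F x z ((P.ops y x).d a) b +
        F x z ((P.ops y x).sgn a) ((P.opsTens x z).d b)) := rfl

/-! ### The natural transformations `ε : P^∧ ⟶ Id`, `Δ : P^∧ ⟶ P^∧₂`, `α : P^∧ P^∧ ⟶ P^∧₂` -/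

/-- The value of a family of maps `P(x; y) → C^{⊗ x}` at the unit of `P(y; y)`. -/
def evalUnit (C : X → Cplx k c) (y : X) : (P.hatSp C y).L →ₗ[k] (tot (C y)).M where
  toFun f := oneOut (tot (C y)) (f (Word.single y) (P.unit y))
  map_add' _ _ := map_add (oneOut (tot (C y))) _ _
  map_smul' _ _ := map_smul (oneOut (tot (C y))) _ _

lemma evalUnit_mem (C : X → Cplx k c) (y : X) (p : I) {f : (P.hatSp C y).L}
    (hf : f ∈ (P.hatSp C y).deg p) : P.evalUnit C y f ∈ (tot (C y)).deg p := by
  have := (oneOut_isHom (tot (C y))).deg _ _ (hf.1 _ _ _ (P.unit_mem y))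
  rwa [add_zero] at this

lemma evalUnit_D (C : X → Cplx k c) (y : X) (p : I) (f : (P.hatSp C y).L) :
    P.evalUnit C y ((P.hatSp C y).D p f) = (tot (C y)).d (P.evalUnit C y f) := by
  refine Eq.trans ?_ ((oneOut_isHom _).d _)
  refine congrArg (oneOut (tot (C y))) ?_
  rw [hatSp_D_apply, P.d_unit, map_zero, smul_zero, sub_zero]
  rfl

/-- The counit `P^∧(C)^y → C^y`, evaluation at the unit of `P(y; y)`. -/
def counitMap (C : X → Cplx k c) (y : X) : (P.hatSp C y).cplx ⟶ C y where
  f p := ModuleCat.ofHom (cproj (C y) p ∘ₗ P.evalUnit C y ∘ₗ ((P.hatSp C y).deg p).subtype)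
  comm' p q h := by
    ext f
    have h1 := ι_cproj _ (P.evalUnit_mem C y p f.2)
    have h2 := congrArg (cproj (C y) q) (d_ι (C y) h (cproj (C y) p (P.evalUnit C y f.1)))
    rw [cproj_ι, h1] at h2
    refine h2.symm.trans ?_
    refine (congrArg (cproj (C y) q) (P.evalUnit_D C y p f.1).symm).trans ?_
    exact congrArg (fun g : (P.hatSp C y).deg q => cproj (C y) q (P.evalUnit C y g.1))
      (HomSp.cplx_d _ h f).symm

/-- The counit `ε : P^∧ ⟶ Id`. -/
def counit : P.hat ⟶ 𝟭 (X → Cplx k c) where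
  app C y := P.counitMap C y
  naturality C D f := by
    funext y
    ext p g
    refine Eq.trans ?_ (cproj_totMap (f y) (P.evalUnit_mem C y p g.2))
    exact congrArg (cproj (D y) p) (oneOut_tensMap (totMap (f y)) (g.1 (Word.single y) (P.unit y)))

/-- The map `f ↦ ((μ, ν) ↦ f (μ ∘ ν))`. -/
def diagL (C : X → Cplx k c) (y : X) : (P.hatSp C y).L →ₗ[k] (P.hat₂Sp C y).L where
  toFun f x z := (P.comp y x z).compr₂ (unflat C x z ∘ₗ f (x.concat z))
  map_add' _ _ := funext fun x => funext fun z => LinearMap.ext₂ fun _ _ =>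
    map_add (unflat C x z) _ _
  map_smul' _ _ := funext fun x => funext fun z => LinearMap.ext₂ fun _ _ =>
    map_smul (unflat C x z) _ _

/-- The map `Δ : P^∧(C) ⟶ P^∧₂(C)`, induced by the composition of `P`. -/
def diagMap (C : X → Cplx k c) (y : X) : (P.hatSp C y).cplx ⟶ (P.hat₂Sp C y).cplx :=
  HomSp.cplxMap (P.diagL C y)
    (fun p f hf => by
      refine ⟨fun x z q r a ha b hb => ?_, fun x z z' e a b => ?_, fun x n σ z a b => ?_⟩
      · exact (unflat_isHom C x z).deg _ _ (hf.1 _ _ _ ((P.comp_isPairing y x z).deg _ _ _ ha _ hb))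
      · refine (congrArg (fun t => unflat C x z' (f _ t)) (P.comp_map y x z z' e a b)).trans ?_
        refine (congrArg (unflat C x z') (hf.2 _ _ _ _)).trans ?_
        exact unflat_concatMap C x e _
      · refine (congrArg (fun t => unflat C x z (f _ t)) (P.comp_pull y x n σ z a b)).trans ?_
        refine (congrArg (unflat C x z) (hf.2 _ _ _ _)).trans ?_
        exact unflat_blockHom C x σ z _)
    (fun p f hf => funext fun x => funext fun z => LinearMap.ext₂ fun a b => by
      refine Eq.trans ?_ (map_sub (unflat C x z) _ _).symm
      refine congrArg₂ (· - ·) ((unflat_isHom C x z).d _).symm ?_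
      refine Eq.trans ?_ (map_smul (unflat C x z) _ _).symm
      refine congrArg (fun t : (wtTens C x z).M => sg k (c.ε p) • t) ?_
      refine (map_add (unflat C x z ∘ₗ f _) _ _).symm.trans ?_
      exact congrArg (unflat C x z ∘ₗ f _) ((P.comp_isPairing y x z).d a b).symm)

/-- The natural transformation `Δ : P^∧ ⟶ P^∧₂`. -/
def diag : P.hat ⟶ P.hat₂ where
  app C y := P.diagMap C y
  naturality C D f := by
    funext y
    ext p g
    refine Subtype.ext (funext fun x => funext fun z => LinearMap.ext₂ fun a b => ?_)
    exact unflat_wtFun f x z _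

/-- Evaluation of elements of `P^∧(C)^y` on `P(x; y)`. -/
def ev (C : X → Cplx k c) (y : X) (x : Word X) :
    (tot (P.hat.obj C y)).M →ₗ[k] (P.ops y x).M →ₗ[k] (wt C x).M :=
  LinearMap.proj x ∘ₗ (P.hatSp C y).total

lemma ev_ι (C : X → Cplx k c) (y : X) (x : Word X) (p : I) (f : (P.hatSp C y).deg p) :
    P.ev C y x (ι (P.hat.obj C y) p f) = f.1 x :=
  congrFun ((P.hatSp C y).total_ι p f) x

lemma ev_isPairing (C : X → Cplx k c) (y : X) (x : Word X) : IsPairing (P.ev C y x) where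
  deg := by
    rintro p q _ ⟨f, rfl⟩ a ha
    change P.ev C y x (ι (P.hat.obj C y) p f) a ∈ _
    have e : P.ev C y x (ι (P.hat.obj C y) p f) = f.1 x := P.ev_ι C y x p f
    rw [e]
    exact f.2.1 x q a ha
  d g a := by
    have : (P.ev C y x).compr₂ (wt C x).d = P.ev C y x ∘ₗ (tot (P.hat.obj C y)).d +
        (P.ev C y x).compl₁₂ (tot (P.hat.obj C y)).sgn (P.ops y x).d := by
      refine tot_ext fun p f => LinearMap.ext fun a => ?_
      change (wt C x).d (P.ev C y x (ι (P.hat.obj C y) p f) a) =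
        P.ev C y x ((tot (P.hat.obj C y)).d (ι (P.hat.obj C y) p f)) a +
          P.ev C y x ((tot (P.hat.obj C y)).sgn (ι (P.hat.obj C y) p f)) ((P.ops y x).d a)
      rw [(tot (P.hat.obj C y)).sgn_of_mem (ι_mem (P.hat.obj C y) p f)]
      by_cases h : ∃ q, c.Rel p q
      · obtain ⟨q, h⟩ := h
        have h1 : P.ev C y x ((tot (P.hat.obj C y)).d (ι (P.hat.obj C y) p f)) =
            (P.hatSp C y).D p f.1 x := by
          rw [d_ι _ h]
          refine (P.ev_ι C y x q _).trans ?_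
          exact congrArg (fun g : (P.hatSp C y).deg q => g.1 x) (HomSp.cplx_d _ h f)
        have e : P.ev C y x (ι (P.hat.obj C y) p f) = f.1 x := P.ev_ι C y x p f
        rw [h1, map_smul, LinearMap.smul_apply, e]
        exact (sub_add_cancel _ _).symm
      · push Not at h
        rw [GMod.d_of_no_rel _ h, GMod.d_of_no_rel _ h, GMod.d_of_no_rel _ h, map_zero, map_zero,
          LinearMap.zero_apply, add_zero]
    exact LinearMap.congr_fun₂ this g a

lemma ev_act (C : X → Cplx k c) (y : X) {x x' : Word X} (e : x ⟶ x') (g : (tot (P.hat.obj C y)).M)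
    (a : (P.ops y x).M) : P.ev C y x' g (P.act y e a) = wtMap C e (P.ev C y x g a) := by
  have : (P.ev C y x').compl₁₂ LinearMap.id (P.act y e) = (P.ev C y x).compr₂ (wtMap C e) := by
    refine tot_ext fun p f => LinearMap.ext fun a => ?_
    change P.ev C y x' (ι (P.hat.obj C y) p f) (P.act y e a) =
      wtMap C e (P.ev C y x (ι (P.hat.obj C y) p f) a)
    have e1 : P.ev C y x (ι (P.hat.obj C y) p f) = f.1 x := P.ev_ι C y x p f
    have e2 : P.ev C y x' (ι (P.hat.obj C y) p f) = f.1 x' := P.ev_ι C y x' p f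
    rw [e1, e2]
    exact f.2.2 x x' e a
  exact LinearMap.congr_fun₂ this g a

lemma ev_map {C D : X → Cplx k c} (f : C ⟶ D) (y : X) (x : Word X) (g : (tot (P.hat.obj C y)).M)
    (a : (P.ops y x).M) :
    P.ev D y x (totMap (P.hat.map f y) g) a = wtFun f x (P.ev C y x g a) :=
  congrArg (fun h : (P.hatSp D y).L => h x a) 
    (HomSp.total_totMap (P.hatSpMap f y) (P.hatSpMap_mem f y) (fun p g _ => P.hatSpMap_D f y p g) g)

/-- The map sending `g` to `(μ, ν) ↦ (g₁ ⊗ ⋯ ⊗ gₙ) (ν)`, where `g μ = g₁ ⊗ ⋯ ⊗ gₙ`. -/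
def laxL (C : X → Cplx k c) (y : X) : (P.hatSp (P.hat.obj C) y).L →ₗ[k] (P.hat₂Sp C y).L where
  toFun g x z := pairTens (fun i => P.ev C (x.col i) (z i)) ∘ₗ g x
  map_add' _ _ := funext fun x => funext fun z => LinearMap.ext fun _ =>
    map_add (pairTens fun i => P.ev C (x.col i) (z i)) _ _
  map_smul' _ _ := funext fun x => funext fun z => LinearMap.ext fun _ =>
    map_smul (pairTens fun i => P.ev C (x.col i) (z i)) _ _

/-- The map `α : P^∧(P^∧(C)) ⟶ P^∧₂(C)`, induced by the canonical maps
`[A₁, B₁] ⊗ ⋯ ⊗ [Aₙ, Bₙ] ⟶ [A₁ ⊗ ⋯ ⊗ Aₙ, B₁ ⊗ ⋯ ⊗ Bₙ]`. -/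
def laxMap (C : X → Cplx k c) (y : X) :
    (P.hatSp (P.hat.obj C) y).cplx ⟶ (P.hat₂Sp C y).cplx :=
  HomSp.cplxMap (P.laxL C y)
    (fun p g hg => by
      refine ⟨fun x z q r a ha b hb => ?_, fun x z z' e a b => ?_, fun x n σ z a b => ?_⟩
      · have := (pairTens_isPairing fun i => P.ev_isPairing C (x.col i) (z i)).deg _ _ _
          (hg.1 x q a ha) b hb
        rwa [add_assoc] at this
      · have := pairTens_tensMap (ev := fun i => P.ev C (x.col i) (z i))
          (ev' := fun i => P.ev C (x.col i) (z' i)) (φ := fun _ => LinearMap.id)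
          (ψ := fun i => P.act (x.col i) (e i)) (χ := fun i => wtMap C (e i))
          (fun i => GMod.IsHom.id _) (fun i => totMap_isHom _)
          (fun i g a => P.ev_act C _ (e i) g a) (g x a) b
        rwa [tensMap_id] at this
      · have := pairTens_permMap σ (ev := fun i => P.ev C (x.col (σ i)) (z (σ i)))
          (ev' := fun i => P.ev C (x.col i) (z i)) (φ := fun _ => LinearMap.id)
          (ψ := fun i => LinearMap.id) (χ := fun i => LinearMap.id)
          (fun i => P.ev_isPairing C _ _)
          (fun i => GMod.IsHom.id _) (fun i => GMod.IsHom.id _)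
          (fun i g a => rfl) (g (x.pull σ) a) b
        refine Eq.trans ?_ this
        refine congrArg (fun t => pairTens _ t _) ?_
        refine (hg.2 _ _ (x.pullHom σ) a).trans ?_
        refine congrArg (fun φ => permMap (A := fun i => tot (P.hat.obj C (x.col (σ i))))
          (B := fun i => tot (P.hat.obj C (x.col i))) σ φ (g (x.pull σ) a)) ?_
        exact funext fun i => LinearMap.ext fun t => colMap_rfl _ _ t)
    (fun p g hg => by
      have hsgn : ∀ x a, g x ((P.ops y x).sgn a) =
          sg k (c.ε p) • (wt (P.hat.obj C) x).sgn (g x a) := by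
        intro x a
        have : g x ∘ₗ (P.ops y x).sgn =
            sg k (c.ε p) • ((wt (P.hat.obj C) x).sgn ∘ₗ g x) := by
          refine (P.ops y x).ext_deg fun q a ha => ?_
          rw [LinearMap.comp_apply, LinearMap.smul_apply, LinearMap.comp_apply,
            GMod.sgn_of_mem _ ha, GMod.sgn_of_mem _ (hg.1 x q a ha), map_smul, smul_smul, c.ε_add,
            map_mul, ← mul_assoc, sg_mul_self, one_mul]
        exact LinearMap.congr_fun this a
      refine funext fun x => funext fun z => LinearMap.ext₂ fun a b => ?_
      exact (pairTens_isPairing fun i => P.ev_isPairing C (x.col i) (z i)).D (sg_mul_self k _)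
        (hsgn x a))

/-- The natural transformation `α : P^∧ P^∧ ⟶ P^∧₂`. -/
def lax : P.hat ⋙ P.hat ⟶ P.hat₂ where
  app C y := P.laxMap C y
  naturality C D f := by
    funext y
    ext p g
    refine Subtype.ext (funext fun x => funext fun z => LinearMap.ext₂ fun a b => ?_)
    have := pairTens_tensMap (ev := fun i => P.ev C (x.col i) (z i))
      (ev' := fun i => P.ev D (x.col i) (z i)) (φ := fun i => totMap (P.hat.map f (x.col i)))
      (ψ := fun i => LinearMap.id) (χ := fun i => wtFun f (z i))
      (fun i => totMap_isHom _) (fun i => GMod.IsHom.id _)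
      (fun i g a => P.ev_map f _ _ g a) (g.1 x a) b
    rw [tensMap_id] at this
    exact this

end Operad

end Maps

/-! ## Coalgebras and the recursion -/

section Coalgebras

variable {X : Type u}

instance hasLimits_cplx : Limits.HasLimitsOfSize.{u, u} (X → Cplx k c) where
  has_limits_of_shape _ := { has_limit := fun _ => pi.hasLimit_of_hasLimit_comp_eval }

instance hasSmallLimits_cplx : Limits.HasLimitsOfSize.{0, 0} (X → Cplx k c) :=
  Limits.hasLimitsOfSizeShrink.{0, 0, u, u} _

namespace Operad

variable (P : Operad k c X)

/-- A map `δ : C ⟶ P^∧(C)` is a `P`-coalgebra structure if it is counital, `ε δ = 1`, and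
coassociative, `α P^∧(δ) δ = Δ δ`. -/
structure IsCoalgebra (C : X → Cplx k c) (δ : C ⟶ P.hat.obj C) : Prop where
  counit : δ ≫ P.counit.app C = 𝟙 C
  coassoc : δ ≫ P.hat.map δ ≫ P.lax.app C = δ ≫ P.diag.app C

/-- A `P`-coalgebra. -/
structure Coalgebra where
  C : X → Cplx k c
  δ : C ⟶ P.hat.obj C
  isCoalgebra : P.IsCoalgebra C δ

/-- Morphisms of `P`-coalgebras. -/
def IsCoalgebraHom {P : Operad k c X} (D E : P.Coalgebra) (f : D.C ⟶ E.C) : Prop :=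
  D.δ ≫ P.hat.map f = f ≫ E.δ

/-- The coalgebra `E` with the map `p : E ⟶ C` is the cofree coalgebra on `C`. -/
def IsCofree {P : Operad k c X} (E : P.Coalgebra) {C : X → Cplx k c} (p : E.C ⟶ C) : Prop :=
  ∀ (D : P.Coalgebra) (f : D.C ⟶ C), ∃! g : D.C ⟶ E.C, IsCoalgebraHom D E g ∧ g ≫ p = f

end Operad

/-- A step `(Q_{n+1}, Q_n, χ_{n+1}, δ_{n+1})` of the recursion. -/
structure Step (k : Type u) [Field k] (c : ComplexShape I) (X : Type u) where
  Q : (X → Cplx k c) ⥤ (X → Cplx k c)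
  Q' : (X → Cplx k c) ⥤ (X → Cplx k c)
  χ : Q ⟶ Q'
  δ : Q ⟶ Q' ⋙ Q'

/-- The next step of the recursion: `Q_{n+2}` is the limit of the diagram
`Q_{n+1} ⟶ Q_n Q_n ⟵ Q_{n+1} Q_{n+1} ⇉ Q_n Q_n Q_n`, whose maps are
`δ_{n+1}`, `χ_{n+1} χ_{n+1}`, `δ_{n+1} χ_{n+1}` and `χ_{n+1} δ_{n+1}`. -/
def Step.next (S : Step k c X) : Step k c X where
  Q := Limits.pullback S.δ (Limits.equalizer.ι
    ((S.δ ◫ S.χ) ≫ (Functor.associator S.Q' S.Q' S.Q').hom) (S.χ ◫ S.δ) ≫ (S.χ ◫ S.χ))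
  Q' := S.Q
  χ := Limits.pullback.fst _ _
  δ := Limits.pullback.snd _ _ ≫ Limits.equalizer.ι _ _

namespace Operad

variable (P : Operad k c X)

/-- The first step of the recursion: `Q_1` is the fiber product of `Δ : P^∧ ⟶ P^∧₂` and
`α : P^∧ P^∧ ⟶ P^∧₂`. -/
def firstStep : Step k c X where
  Q := Limits.pullback P.diag P.lax
  Q' := P.hat
  χ := Limits.pullback.fst _ _
  δ := Limits.pullback.snd _ _

/-- The `n`-th step of the recursion, constructing `Q_{n+1}`. -/
def step : ℕ → Step k c X
  | 0 => P.firstStep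
  | n + 1 => (step n).next

/-- The functors `Q_n`. -/
def Q : ℕ → (X → Cplx k c) ⥤ (X → Cplx k c)
  | 0 => P.hat
  | n + 1 => (P.step n).Q

/-- The maps `χ_{n+1} : Q_{n+1} ⟶ Q_n`. -/
def χ : ∀ n, P.Q (n + 1) ⟶ P.Q n
  | 0 => P.firstStep.χ
  | n + 1 => (P.step (n + 1)).χ

/-- The map `χ_1 : Q_1 ⟶ P^∧`. -/
def χ₁ : P.Q 1 ⟶ P.hat := P.χ 0

/-- The map `δ_1 : Q_1 ⟶ P^∧ P^∧`. -/
def δ₁ : P.Q 1 ⟶ P.hat ⋙ P.hat := P.firstStep.δ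

/-- The tower `⋯ ⟶ Q_2 ⟶ Q_1 ⟶ Q_0`. -/
def tower : ℕᵒᵖ ⥤ ((X → Cplx k c) ⥤ (X → Cplx k c)) := Functor.ofOpSequence P.χ

/-- The limit `Q_∞` of the tower. -/
def Qinf : (X → Cplx k c) ⥤ (X → Cplx k c) := Limits.limit P.tower

/-- The projection `Q_∞ ⟶ Q_n`. -/
def πinf (n : ℕ) : P.Qinf ⟶ P.Q n := Limits.limit.π P.tower (Opposite.op n)

/-- The recursion stops at the first step: `Q_∞ = Q_1`, and `Q_{n+1} = Q_n` for all `n ≥ 1`. -/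
def RecursionStops : Prop :=
  (∀ n, 1 ≤ n → IsIso (P.χ n)) ∧ IsIso (P.πinf 1)

/-- An element `f` of `P^∧(C)` is representative if `Δ f` is in the image of
`α : P^∧(P^∧(C)) ⟶ P^∧₂(C)`. -/
def IsRepresentative (C : X → Cplx k c) (y : X) (p : I) (f : (P.hat.obj C y).X p) : Prop :=
  ∃ g : (P.hat.obj (P.hat.obj C) y).X p,
    ((P.lax.app C y).f p).hom g = ((P.diag.app C y).f p).hom f

/-- `Q_1(C)` is the fiber product of `P^∧(C) ⟶ P^∧₂(C) ⟵ P^∧(P^∧(C))`, and it is the subobject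
of `P^∧(C)` of representative elements. -/
def IsRepresentativeSubobject : Prop :=
  ∀ C, IsPullback (P.χ₁.app C) (P.δ₁.app C) (P.diag.app C) (P.lax.app C) ∧
    Mono (P.χ₁.app C) ∧
    ∀ y p f, (∃ q, ((P.χ₁.app C y).f p).hom q = f) ↔ P.IsRepresentative C y p f

/-- `Q_1` is the cofree `P`-coalgebra functor: `δ_1` lifts to a natural coalgebra structure
`δ : Q_1 ⟶ P^∧ Q_1`, for which `Q_1(C)` with the map `Q_1(C) ⟶ P^∧(C) ⟶ C` is the cofree
`P`-coalgebra on `C`. -/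
def IsCofreeCoalgebraFunctor : Prop :=
  ∃ δ : P.Q 1 ⟶ P.Q 1 ⋙ P.hat, δ ≫ Functor.whiskerRight P.χ₁ P.hat = P.δ₁ ∧
    ∀ C, ∃ h : P.IsCoalgebra ((P.Q 1).obj C) (δ.app C),
      IsCofree ⟨(P.Q 1).obj C, δ.app C, h⟩ (P.χ₁.app C ≫ P.counit.app C)

end Operad

/-- The shape of complexes with one term and no differential. A complex of this shape is a vector
space, chain maps are linear maps, and all Koszul signs are trivial. -/
def vectShape : ComplexShape PUnit.{1} where
  Rel _ _ := False
  next_eq h := h.elim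
  prev_eq h := h.elim

instance : vectShape.TensorSigns where
  ε' := 1
  rel_add _ _ _ h := h.elim
  add_rel _ _ _ h := h.elim
  ε'_succ _ _ h := h.elim

/-- The Koszul sign `(-1)^p` for chain complexes. -/
instance : (ComplexShape.down ℤ).TensorSigns where
  ε' := MonoidHom.mk' (fun i : Multiplicative ℤ => Int.negOnePow i.toAdd)
    fun _ _ => Int.negOnePow_add _ _
  rel_add p q r h := by
    change q + r + 1 = p + r
    have : q + 1 = p := h
    omega
  add_rel p q r h := by
    change r + q + 1 = r + p
    have : q + 1 = p := h
    omega
  ε'_succ := by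
    rintro p q rfl
    change Int.negOnePow q = - Int.negOnePow (q + 1)
    rw [Int.negOnePow_succ, neg_neg]

end Coalgebras

end

end OperadCoalg

namespace OperadCoalg

open CategoryTheory
open PiTensorProduct (map_tprod)
open scoped TensorProduct DirectSum

noncomputable section

set_option linter.unusedSectionVars false

/-! ## Contractions of tensors with functionals -/

section Contraction

variable {k : Type u} [Field k] {n : ℕ} {W U : Fin n → Type u} [∀ i, AddCommGroup (W i)]
  [∀ i, Module k (W i)] [∀ i, AddCommGroup (U i)] [∀ i, Module k (U i)]

/-! This is the operadic form of the fact that representative functions form a coalgebra, and it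
rests on linear algebra over a field.

The map `α` is injective (`laxL_injective`). Evaluation at a homogeneous operation followed by a
homogeneous functional gives a separating family of functionals on `P^∧(C)` (`separates_ev`), and
products of separating families separate the points of a tensor product (`eq_zero_of_contrAll`). So
an element `g` with `α g = Δ f` is determined by `f`, and the fiber product `Q_1(C)` is the
subcomplex of representative elements (`exists_isPullback_rep`).

The main point is that such a `g` takes its values in the tensor powers of `Q_1(C)`, not only of
`P^∧(C)` (`mem_range_wtFun_of_lax`). A tensor lies in a tensor product of subspaces as soon as its
contractions in all slots but one, against separating functionals, lie in the subspace of the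
remaining slot (`mem_range_map_of_contr`). Contract `g μ` in the slots `j ≠ i` with functionals `h ↦
ψ_j (h ν_j)`, and let `h'` be the result. Then `h'` is representative
(`tensContr_isRepresentative`). Indeed, put an operation `ρ` in slot `i` of `ν` and contract `g (μ ∘
ν)` in the slots `j ≠ i` with evaluation at the units followed by `ψ_j`. The identity `f ((μ ∘ ν) ∘
κ) = f (μ ∘ (ν ∘ κ))`, with units in the slots `j ≠ i` of `κ`, says that this contraction evaluates
at `κ_i` to `h' (ρ ∘ κ_i)`, up to a constant sign (`exists_evWt_eq`). Hence `δ₁` factors through the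
monomorphism `P^∧(χ₁)`, which gives the coaction `δ`.

The coalgebra axioms are checked after monomorphisms, where they become the unit laws and the
associativity of `P` (`evalUnit_of_lax`, `lax_coassoc`). For a coalgebra `D` and a map `f : D ⟶ C`,
coassociativity of `D` makes `D ⟶ P^∧(D) ⟶ P^∧(C)` land in `Q_1(C)` (`coaction_diag`). Uniqueness
holds because `δ₁` followed by `P^∧(ε)` is `χ₁` (`wtFun_counit_of_lax`, `eq_of_comp_counit`).

Cofreeness gives a coassociative comultiplication `d` on `Q_1` lying over `δ₁`. As `χ₁ χ₁` is a
monomorphism, `χ_2` is one too, and `d` provides a section of it, so `χ_2` is an isomorphism. The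
comultiplication is transported to `Q_2` and the argument repeats (`Step.IsStable.next`), so the
tower is constant from `Q_1` on.

All of this is done for complexes of any shape with tensor signs; vector spaces and chain complexes
are two instances. -/

/-- The functional `φ₁ ⊗ ⋯ ⊗ φₙ`. -/
def contrAll (φ : ∀ j, W j →ₗ[k] k) : (⨂[k] j, W j) →ₗ[k] k :=
  PiTensorProduct.lift ((MultilinearMap.mkPiAlgebra k (Fin n) k).compLinearMap φ)

lemma contrAll_tprod (φ : ∀ j, W j →ₗ[k] k) (w : ∀ j, W j) :
    contrAll φ (PiTensorProduct.tprod k w) = ∏ j, φ j (w j) := by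
  rw [contrAll, PiTensorProduct.lift.tprod]; rfl

/-- The map `φ₁ ⊗ ⋯ ⊗ 1 ⊗ ⋯ ⊗ φₙ`, with the identity in position `i`. -/
def contr (i : Fin n) (φ : ∀ j, W j →ₗ[k] k) : (⨂[k] j, W j) →ₗ[k] W i :=
  PiTensorProduct.lift (MultilinearMap.mk'
    (fun w => (∏ j ∈ Finset.univ.erase i, φ j (w j)) • w i)
    (fun w j a b => by
      by_cases h : j = i
      · subst h
        have : ∀ c, ∏ l ∈ Finset.univ.erase j, φ l (Function.update w j c l) =
            ∏ l ∈ Finset.univ.erase j, φ l (w l) := fun c =>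
          Finset.prod_congr rfl fun l hl => by rw [Function.update_of_ne (Finset.ne_of_mem_erase hl)]
        simp only [this, Function.update_self, smul_add]
      · have hj : j ∈ Finset.univ.erase i := Finset.mem_erase.2 ⟨h, Finset.mem_univ _⟩
        have : ∀ c, ∏ l ∈ Finset.univ.erase i, φ l (Function.update w j c l) =
            φ j c * ∏ l ∈ (Finset.univ.erase i).erase j, φ l (w l) := fun c => by
          rw [← Finset.mul_prod_erase _ _ hj, Function.update_self]
          congr 1
          exact Finset.prod_congr rfl fun l hl => by
            rw [Function.update_of_ne (Finset.ne_of_mem_erase hl)]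
        simp only [this, Function.update_of_ne (Ne.symm h), map_add, add_mul, add_smul])
    (fun w j r a => by
      by_cases h : j = i
      · subst h
        have : ∀ c, ∏ l ∈ Finset.univ.erase j, φ l (Function.update w j c l) =
            ∏ l ∈ Finset.univ.erase j, φ l (w l) := fun c =>
          Finset.prod_congr rfl fun l hl => by rw [Function.update_of_ne (Finset.ne_of_mem_erase hl)]
        simp only [this, Function.update_self]
        exact smul_comm _ _ _
      · have hj : j ∈ Finset.univ.erase i := Finset.mem_erase.2 ⟨h, Finset.mem_univ _⟩
        have : ∀ c, ∏ l ∈ Finset.univ.erase i, φ l (Function.update w j c l) =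
            φ j c * ∏ l ∈ (Finset.univ.erase i).erase j, φ l (w l) := fun c => by
          rw [← Finset.mul_prod_erase _ _ hj, Function.update_self]
          congr 1
          exact Finset.prod_congr rfl fun l hl => by
            rw [Function.update_of_ne (Finset.ne_of_mem_erase hl)]
        simp only [this, Function.update_of_ne (Ne.symm h), map_smul, smul_eq_mul, mul_assoc,
          mul_smul]))

lemma contr_tprod (i : Fin n) (φ : ∀ j, W j →ₗ[k] k) (w : ∀ j, W j) :
    contr i φ (PiTensorProduct.tprod k w) = (∏ j ∈ Finset.univ.erase i, φ j (w j)) • w i :=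
  PiTensorProduct.lift.tprod _

/-- A full contraction can be carried out with slot `i` last, which allows arguments one slot at a
time. -/
lemma contrAll_eq_contr (i : Fin n) (φ : ∀ j, W j →ₗ[k] k) (t : ⨂[k] j, W j) :
    contrAll φ t = φ i (contr i φ t) := by
  have : contrAll φ = φ i ∘ₗ contr i φ := by
    refine PiTensorProduct.ext (MultilinearMap.ext fun w => ?_)
    simp only [LinearMap.compMultilinearMap_apply, contrAll_tprod, LinearMap.comp_apply,
      contr_tprod, map_smul, smul_eq_mul]
    rw [mul_comm, Finset.mul_prod_erase Finset.univ (fun j => φ j (w j)) (Finset.mem_univ i)]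
  exact LinearMap.congr_fun this t

/-- Slot `i` is left uncontracted, so the functional placed there is irrelevant and can be exchanged
for any convenient one. -/
lemma contr_congr {i : Fin n} {φ φ' : ∀ j, W j →ₗ[k] k} (h : ∀ j, j ≠ i → φ j = φ' j) :
    contr i φ = contr i φ' := by
  refine PiTensorProduct.ext (MultilinearMap.ext fun w => ?_)
  simp only [LinearMap.compMultilinearMap_apply, contr_tprod]
  rw [Finset.prod_congr rfl fun j hj => by rw [h j (Finset.ne_of_mem_erase hj)]]

lemma contr_map (i : Fin n) (φ : ∀ j, W j →ₗ[k] k) (m : ∀ j, U j →ₗ[k] W j) (t : ⨂[k] j, U j) :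
    contr i φ (PiTensorProduct.map m t) = m i (contr i (fun j => φ j ∘ₗ m j) t) := by
  have : contr i φ ∘ₗ PiTensorProduct.map m = m i ∘ₗ contr i (fun j => φ j ∘ₗ m j) := by
    refine PiTensorProduct.ext (MultilinearMap.ext fun w => ?_)
    simp only [LinearMap.compMultilinearMap_apply, LinearMap.comp_apply, map_tprod, contr_tprod,
      map_smul]
  exact LinearMap.congr_fun this t

/-- A set of functionals which separates the points. -/
def Separates {V : Type u} [AddCommGroup V] [Module k V] (Φ : Set (V →ₗ[k] k)) : Prop :=
  ∀ v, (∀ φ ∈ Φ, φ v = 0) → v = 0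

lemma separates_univ (V : Type u) [AddCommGroup V] [Module k V] :
    Separates (Set.univ : Set (V →ₗ[k] k)) := fun v h =>
  (Module.forall_dual_apply_eq_zero_iff k v).1 fun φ => h φ trivial

/-- The coordinates with respect to a tensor product of bases are themselves products of
functionals. -/
lemma eq_zero_of_contrAll_all {t : ⨂[k] j, W j} (h : ∀ φ : ∀ j, W j →ₗ[k] k, contrAll φ t = 0) :
    t = 0 := by
  let b := Basis.piTensorProduct fun j => Module.Basis.ofVectorSpace k (W j)
  refine b.forall_coord_eq_zero_iff.1 fun p => ?_
  have : b.coord p = contrAll fun j => (Module.Basis.ofVectorSpace k (W j)).coord (p j) := by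
    refine PiTensorProduct.ext (MultilinearMap.ext fun w => ?_)
    simp only [LinearMap.compMultilinearMap_apply, contrAll_tprod, Module.Basis.coord_apply]
    exact Basis.piTensorProduct_repr_tprod_apply _ _ _
  rw [this, h]

/-- The separating families are enlarged to the full duals one slot at a time: the contraction of
`t` at slot `i` is killed by `Φ i`, hence is zero, hence is killed by every functional. -/
lemma eq_zero_of_contrAll {Φ : ∀ j, Set (W j →ₗ[k] k)} (hΦ : ∀ j, Separates (Φ j))
    {t : ⨂[k] j, W j} (h : ∀ φ : ∀ j, W j →ₗ[k] k, (∀ j, φ j ∈ Φ j) → contrAll φ t = 0) :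
    t = 0 := by
  -- The set `s` consists of the slots in which the functional is already arbitrary.
  have key : ∀ s : Finset (Fin n), ∀ φ : ∀ j, W j →ₗ[k] k, (∀ j, j ∉ s → φ j ∈ Φ j) →
      contrAll φ t = 0 := by
    intro s
    induction s using Finset.induction_on with
    | empty => exact fun φ hφ => h φ fun j => hφ j (Finset.notMem_empty j)
    | insert i s hi ih =>
      intro φ hφ
      have h0 : contr i φ t = 0 := by
        refine hΦ i _ fun θ hθ => ?_
        have h1 : contr i φ = contr i (Function.update φ i θ) :=
          contr_congr fun j hj => by rw [Function.update_of_ne hj]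
        have h2 := contrAll_eq_contr i (Function.update φ i θ) t
        rw [Function.update_self] at h2
        rw [h1, ← h2]
        refine ih _ fun j hj => ?_
        by_cases hji : j = i
        · subst hji; rwa [Function.update_self]
        · rw [Function.update_of_ne hji]
          exact hφ j (by simp [hji, hj])
      rw [contrAll_eq_contr i, h0, map_zero]
  exact eq_zero_of_contrAll_all fun φ => key Finset.univ φ fun j hj => (hj (Finset.mem_univ j)).elim

/-- A quasi-inverse of a linear map. -/
lemma exists_quasiInverse {V V' : Type u} [AddCommGroup V] [Module k V] [AddCommGroup V']
    [Module k V'] (m : V →ₗ[k] V') : ∃ s : V' →ₗ[k] V, ∀ v ∈ LinearMap.range m, m (s v) = v := by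
  obtain ⟨s, hs⟩ := m.rangeRestrict.exists_rightInverse_of_surjective m.range_rangeRestrict
  obtain ⟨p, hp⟩ := (LinearMap.range m).exists_isCompl
  refine ⟨s ∘ₗ Submodule.projectionOnto _ _ hp, fun v hv => ?_⟩
  have h1 : Submodule.projectionOnto _ _ hp v = ⟨v, hv⟩ :=
    Submodule.projectionOnto_apply_left hp ⟨v, hv⟩
  rw [LinearMap.comp_apply, h1]
  exact congrArg Subtype.val (LinearMap.congr_fun hs ⟨v, hv⟩)

/-- A tensor lies in the tensor product of subspaces if all its contractions with separating
families of functionals do. -/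
lemma mem_range_map_of_contr {Φ : ∀ j, Set (W j →ₗ[k] k)} (hΦ : ∀ j, Separates (Φ j))
    (m : ∀ j, U j →ₗ[k] W j) {t : ⨂[k] j, W j}
    (h : ∀ i (φ : ∀ j, W j →ₗ[k] k), (∀ j, φ j ∈ Φ j) → contr i φ t ∈ LinearMap.range (m i)) :
    t ∈ LinearMap.range (PiTensorProduct.map m) := by
  -- The hypothesis on contractions needs a functional in every slot. If some `Φ j` is empty there
  -- is none, but then the separation criterion holds vacuously and `t = 0`.
  by_cases hne : ∀ j, (Φ j).Nonempty
  swap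
  · push Not at hne
    obtain ⟨j, hj⟩ := hne
    have ht : t = 0 := by
      refine eq_zero_of_contrAll hΦ fun φ hφ => ?_
      have := hφ j
      rw [hj] at this
      exact this.elim
    rw [ht]; exact zero_mem _
  choose s hs using fun j => exists_quasiInverse (m j)
  -- The operator `m i ∘ s i` is the identity on the range of `m i`. Applied in slot `i` alone it
  -- will be shown to fix `t`; the composite over all slots then exhibits `t` in the range.
  let P (i : Fin n) : ∀ j, W j →ₗ[k] W j := Function.update (fun _ => LinearMap.id) i (m i ∘ₗ s i)
  have hP : ∀ i, PiTensorProduct.map (P i) t = t := by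
    intro i
    rw [← sub_eq_zero]
    -- In slot `i` all functionals are allowed: the contraction at `i` ignores the one standing
    -- there, so some `θ ∈ Φ i` can take its place when the hypothesis `h` is used.
    refine eq_zero_of_contrAll (Φ := Function.update Φ i Set.univ) (fun j => ?_) fun φ hφ => ?_
    · by_cases hj : j = i
      · subst hj; rw [Function.update_self]; exact separates_univ _
      · rw [Function.update_of_ne hj]; exact hΦ j
    · obtain ⟨θ, hθ⟩ := hne i
      have h1 : contr i φ = contr i (Function.update φ i θ) :=
        contr_congr fun j hj => by rw [Function.update_of_ne hj]
      have h2 : contr i φ t ∈ LinearMap.range (m i) := by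
        rw [h1]
        refine h i _ fun j => ?_
        by_cases hj : j = i
        · subst hj; rwa [Function.update_self]
        · have := hφ j
          rw [Function.update_of_ne hj] at this ⊢
          exact this
      have h3 : contr i (fun j => φ j ∘ₗ P i j) = contr i φ :=
        contr_congr fun j hj => by simp only [P, Function.update_of_ne hj, LinearMap.comp_id]
      rw [contrAll_eq_contr i, map_sub, contr_map, h3]
      simp only [P, Function.update_self, LinearMap.comp_apply]
      rw [hs i _ h2, sub_self, map_zero]
  have key : ∀ S : Finset (Fin n),
      PiTensorProduct.map (fun j => if j ∈ S then m j ∘ₗ s j else LinearMap.id) t = t := by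
    intro S
    induction S using Finset.induction_on with
    | empty =>
      simp only [Finset.notMem_empty, if_false]
      exact LinearMap.congr_fun PiTensorProduct.map_id t
    | insert i S hi ih =>
      have e : (fun j => if j ∈ insert i S then m j ∘ₗ s j else LinearMap.id) =
          fun j => P i j ∘ₗ (if j ∈ S then m j ∘ₗ s j else LinearMap.id) := by
        funext j
        by_cases hj : j = i
        · subst hj; simp [P, hi]
        · simp [P, hj]
      rw [e, PiTensorProduct.map_comp, LinearMap.comp_apply, ih, hP]
  have := key Finset.univ
  simp only [Finset.mem_univ, if_true] at this
  rw [PiTensorProduct.map_comp, LinearMap.comp_apply] at this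
  exact ⟨_, this⟩

end Contraction

variable {k : Type u} [Field k] {I : Type} [AddCommGroup I] [DecidableEq I]
  {c : ComplexShape I} [c.TensorSigns]


/-! ## Homogeneous functionals and contractions of pairings -/

section Functionals

/-- A functional which vanishes on the homogeneous elements of degree different from `d`. -/
def GMod.IsFunctional (A : GMod k c) (d : I) (φ : A.M →ₗ[k] k) : Prop :=
  ∀ q, ∀ a ∈ A.deg q, q ≠ d → φ a = 0

/-- The functional `φ₁ ⊗ ⋯ ⊗ φₙ` on the total space of a tensor product. -/
def tensContrAll {n : ℕ} {A : Fin n → GMod k c} (φ : ∀ j, (A j).M →ₗ[k] k) : (tens A).M →ₗ[k] k :=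
  contrAll φ

lemma tensContrAll_pure {n : ℕ} {A : Fin n → GMod k c} (φ : ∀ j, (A j).M →ₗ[k] k)
    (a : ∀ j, (A j).M) : tensContrAll φ (pure a) = ∏ j, φ j (a j) := contrAll_tprod φ a

/-- The map `φ₁ ⊗ ⋯ ⊗ 1 ⊗ ⋯ ⊗ φₙ` on the total space of a tensor product. -/
def tensContr {n : ℕ} {A : Fin n → GMod k c} (i : Fin n) (φ : ∀ j, (A j).M →ₗ[k] k) :
    (tens A).M →ₗ[k] (A i).M := contr i φ

lemma tensContr_pure {n : ℕ} {A : Fin n → GMod k c} (i : Fin n) (φ : ∀ j, (A j).M →ₗ[k] k)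
    (a : ∀ j, (A j).M) :
    tensContr i φ (pure a) = (∏ j ∈ Finset.univ.erase i, φ j (a j)) • a i := contr_tprod i φ a

lemma tensContr_congr {n : ℕ} {A : Fin n → GMod k c} {i : Fin n} {φ φ' : ∀ j, (A j).M →ₗ[k] k}
    (h : ∀ j, j ≠ i → φ j = φ' j) : tensContr i φ = tensContr i φ' := contr_congr h

lemma tensContr_tensMap {n : ℕ} {A B : Fin n → GMod k c} (i : Fin n) (φ : ∀ j, (B j).M →ₗ[k] k)
    (m : ∀ j, (A j).M →ₗ[k] (B j).M) (t : (tens A).M) :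
    tensContr i φ (tensMap m t) = m i (tensContr i (fun j => φ j ∘ₗ m j) t) := contr_map i φ m t

/-- Only pure tensors whose factors in the slots `j ≠ i` have the degrees `d j` survive the
contraction, and these determine the degree of the remaining factor. -/
lemma tensContr_mem {n : ℕ} {A : Fin n → GMod k c} {i : Fin n} {φ : ∀ j, (A j).M →ₗ[k] k}
    {d : Fin n → I} (hφ : ∀ j, j ≠ i → (A j).IsFunctional (d j) (φ j)) {p : I} {t : (tens A).M}
    (ht : t ∈ (tens A).deg p) :
    tensContr i φ t ∈ (A i).deg (p - ∑ j ∈ Finset.univ.erase i, d j) := by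
  refine mem_tens_induction ht (((A i).deg _).comap (tensContr i φ)) ?_
  rintro q a ha rfl
  rw [Submodule.mem_comap, tensContr_pure]
  by_cases h : ∀ j, j ≠ i → q j = d j
  · refine Submodule.smul_mem _ _ ?_
    have : ∑ j, q j - ∑ j ∈ Finset.univ.erase i, d j = q i := by
      rw [← Finset.add_sum_erase _ q (Finset.mem_univ i),
        Finset.sum_congr rfl fun j hj => h j (Finset.ne_of_mem_erase hj), add_sub_cancel_right]
    rw [this]; exact ha i
  · push Not at h
    obtain ⟨j, hj, hq⟩ := h
    rw [Finset.prod_eq_zero (Finset.mem_erase.2 ⟨hj, Finset.mem_univ j⟩) (hφ j hj _ _ (ha j) hq),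
      zero_smul]
    exact zero_mem _

lemma tensContrAll_isFunctional {n : ℕ} {A : Fin n → GMod k c} {φ : ∀ j, (A j).M →ₗ[k] k}
    {d : Fin n → I} (hφ : ∀ j, (A j).IsFunctional (d j) (φ j)) :
    (tens A).IsFunctional (∑ j, d j) (tensContrAll φ) := by
  intro p t ht hp
  refine mem_tens_induction ht (LinearMap.ker (tensContrAll φ)) ?_
  rintro q a ha rfl
  rw [LinearMap.mem_ker, tensContrAll_pure]
  have : ∃ j, q j ≠ d j := by
    by_contra! h
    exact hp (Finset.sum_congr rfl fun j _ => h j)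
  obtain ⟨j, hj⟩ := this
  exact Finset.prod_eq_zero (Finset.mem_univ j) (hφ j _ _ (ha j) hj)

/-- Pairing with `a` raises degrees by `n`, so only elements of degree `d - n` reach the degree seen
by `ψ`. -/
lemma GMod.IsFunctional.flip {G A B : GMod k c} {E : G.M →ₗ[k] A.M →ₗ[k] B.M} (hE : IsPairing E)
    {d n : I} {ψ : B.M →ₗ[k] k} (hψ : B.IsFunctional d ψ) {a : A.M} (ha : a ∈ A.deg n) :
    G.IsFunctional (d - n) (ψ ∘ₗ E.flip a) := fun _ g hg hq =>
  hψ _ _ (hE.deg _ _ g hg a ha) fun h => hq (eq_sub_of_add_eq h)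

lemma GMod.IsFunctional.comp {A B : GMod k c} {f : A.M →ₗ[k] B.M} (hf : GMod.IsHom f)
    {d : I} {ψ : B.M →ₗ[k] k} (hψ : B.IsFunctional d ψ) : A.IsFunctional d (ψ ∘ₗ f) :=
  fun _ a ha hq => hψ _ _ (hf.deg _ a ha) hq

/-- The contraction of `pairTens E t (a₁ ⊗ ⋯ ⊗ aₙ)` with homogeneous functionals. -/
lemma tensContrAll_pairTens {n : ℕ} {G A B : Fin n → GMod k c}
    {E : ∀ i, (G i).M →ₗ[k] (A i).M →ₗ[k] (B i).M} (hE : ∀ i, IsPairing (E i))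
    {d q : Fin n → I} {ψ : ∀ j, (B j).M →ₗ[k] k} (hψ : ∀ j, (B j).IsFunctional (d j) (ψ j))
    {a : ∀ j, (A j).M} (ha : ∀ j, a j ∈ (A j).deg (q j)) (t : (tens G).M) :
    tensContrAll ψ (pairTens E t (pure a)) =
      sg k (shuffleSign (fun j => c.ε (d j - q j)) fun j => c.ε (q j)) •
        tensContrAll (fun j => ψ j ∘ₗ (E j).flip (a j)) t := by
  have : tensContrAll ψ ∘ₗ (pairTens E).flip (pure a) =
      sg k (shuffleSign (fun j => c.ε (d j - q j)) fun j => c.ε (q j)) •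
        tensContrAll fun j => ψ j ∘ₗ (E j).flip (a j) := by
    refine tens_ext fun p g hg => ?_
    rw [LinearMap.comp_apply, LinearMap.flip_apply, LinearMap.smul_apply, pairTens_pure E hg ha,
      map_smul, tensContrAll_pure, tensContrAll_pure]
    -- Both sides vanish outside this one multidegree, so the Koszul sign of the shuffle is a
    -- constant.
    by_cases h : ∀ j, p j = d j - q j
    · obtain rfl : p = fun j => d j - q j := funext h
      rfl
    · push Not at h
      obtain ⟨j, hj⟩ := h
      have h0 : ψ j (E j (g j) (a j)) = 0 :=
        (hψ j).flip (hE j) (ha j) _ _ (hg j) hj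
      rw [Finset.prod_eq_zero (Finset.mem_univ j) h0,
        Finset.prod_eq_zero (Finset.mem_univ j) h0, smul_zero, smul_zero]
  exact LinearMap.congr_fun this t

/-- The functionals fix the parities of the surviving factors in the slots `j ≠ i`, and the total
degree of `t` then forces the parity in slot `i`. So the shuffle sign is again a constant; `η`
records these parities. -/
lemma tensContr_pairTens {n : ℕ} {G A B : Fin n → GMod k c}
    {E : ∀ i, (G i).M →ₗ[k] (A i).M →ₗ[k] (B i).M} (hE : ∀ i, IsPairing (E i)) (i : Fin n)
    {d q : Fin n → I} {ψ : ∀ j, (B j).M →ₗ[k] k}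
    (hψ : ∀ j, j ≠ i → (B j).IsFunctional (d j) (ψ j))
    {a : ∀ j, (A j).M} (ha : ∀ j, a j ∈ (A j).deg (q j)) {p : I} {t : (tens G).M}
    (ht : t ∈ (tens G).deg p) {η : Fin n → ℤˣ} (hη : ∀ j, j ≠ i → η j = c.ε (d j - q j))
    (hp : ∏ j, η j = c.ε p) :
    tensContr i ψ (pairTens E t (pure a)) =
      sg k (shuffleSign η fun j => c.ε (q j)) •
        E i (tensContr i (fun j => ψ j ∘ₗ (E j).flip (a j)) t) (a i) := by
  refine mem_tens_induction ht (LinearMap.eqLocus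
    (tensContr i ψ ∘ₗ (pairTens E).flip (pure a))
    (sg k (shuffleSign η fun j => c.ε (q j)) • ((E i).flip (a i) ∘ₗ
      tensContr i fun j => ψ j ∘ₗ (E j).flip (a j)))) ?_
  rintro p' g hg rfl
  rw [LinearMap.mem_eqLocus, LinearMap.comp_apply, LinearMap.flip_apply, LinearMap.smul_apply,
    LinearMap.comp_apply, LinearMap.flip_apply, pairTens_pure E hg ha, map_smul, tensContr_pure,
    tensContr_pure, map_smul, LinearMap.smul_apply]
  by_cases h : ∀ j, j ≠ i → p' j = d j - q j
  · have hη' : η = fun j => c.ε (p' j) := by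
      have h1 : ∀ j, j ≠ i → η j = c.ε (p' j) := fun j hj => by rw [hη j hj, h j hj]
      funext j
      by_cases hj : j = i
      · subst hj
        rw [ε_sum, ← Finset.mul_prod_erase _ _ (Finset.mem_univ j),
          ← Finset.mul_prod_erase _ (fun j => c.ε (p' j)) (Finset.mem_univ j),
          Finset.prod_congr rfl fun l hl => h1 l (Finset.ne_of_mem_erase hl)] at hp
        exact mul_right_cancel hp
      · exact h1 j hj
    rw [hη']
    rfl
  · push Not at h
    obtain ⟨j, hj, hp'⟩ := h
    have h0 : ψ j (E j (g j) (a j)) = 0 := (hψ j hj).flip (hE j) (ha j) _ _ (hg j) hp'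
    have hj' : j ∈ Finset.univ.erase i := Finset.mem_erase.2 ⟨hj, Finset.mem_univ j⟩
    rw [Finset.prod_eq_zero hj' h0, Finset.prod_eq_zero hj' h0, zero_smul]
    simp only [smul_zero]

/-! ### Separating families of homogeneous functionals. -/

variable {S : Type u}

/-- The functionals `g ↦ ψ (E s g a)`, for homogeneous `a` and `ψ`. -/
def detectors {G : GMod k c} {A B : S → GMod k c}
    (E : ∀ s, G.M →ₗ[k] (A s).M →ₗ[k] (B s).M) : Set (G.M →ₗ[k] k) :=
  {φ | ∃ s n a d ψ, a ∈ (A s).deg n ∧ (B s).IsFunctional d ψ ∧ φ = ψ ∘ₗ (E s).flip a}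

lemma eq_zero_of_detectors {G : GMod k c} {A B : S → GMod k c}
    {E : ∀ s, G.M →ₗ[k] (A s).M →ₗ[k] (B s).M} (h : Separates (detectors E)) {g : G.M}
    (hg : ∀ s n, ∀ a ∈ (A s).deg n, E s g a = 0) : g = 0 := by
  refine h g ?_
  rintro _ ⟨s, n, a, d, ψ, ha, -, rfl⟩
  rw [LinearMap.comp_apply, LinearMap.flip_apply, hg s n a ha, map_zero]

/-- Up to a sign, a product of detectors of the factors is a detector for the pairing of the tensor
products. -/
lemma separates_detectors_pairTens {n : ℕ} {S : Fin n → Type u} {G : Fin n → GMod k c}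
    {A B : ∀ j, S j → GMod k c} {E : ∀ j s, (G j).M →ₗ[k] (A j s).M →ₗ[k] (B j s).M}
    (hE : ∀ j s, IsPairing (E j s)) (h : ∀ j, Separates (detectors (E j))) :
    Separates (detectors fun s : ∀ j, S j =>
      pairTens (G := G) (A := fun j => A j (s j)) (B := fun j => B j (s j)) fun j => E j (s j)) := by
  intro t ht
  refine eq_zero_of_contrAll h fun φ hφ => ?_
  choose s m a d ψ ha hψ hφ using hφ
  have h1 := ht _ ⟨s, _, pure (A := fun j => A j (s j)) a, _, tensContrAll ψ, pure_mem ha,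
    tensContrAll_isFunctional hψ, rfl⟩
  rw [LinearMap.comp_apply, LinearMap.flip_apply,
    tensContrAll_pairTens (fun j => hE j (s j)) hψ ha] at h1
  obtain rfl : φ = fun j => ψ j ∘ₗ (E j (s j)).flip (a j) := funext hφ
  have h2 := congrArg (sg k (shuffleSign (fun j => c.ε (d j - m j)) fun j => c.ε (m j)) • ·) h1
  simp only [smul_smul, sg_mul_self, one_smul, smul_zero] at h2
  exact h2

/-- The homogeneous functionals. -/
def GMod.functionals (A : GMod k c) : Set (A.M →ₗ[k] k) := {φ | ∃ d, A.IsFunctional d φ}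

lemma separates_tens {n : ℕ} {A : Fin n → GMod k c} (h : ∀ j, Separates (A j).functionals) :
    Separates (tens A).functionals := by
  intro t ht
  refine eq_zero_of_contrAll h fun φ hφ => ?_
  choose d hd using hφ
  exact ht _ ⟨_, tensContrAll_isFunctional hd⟩

lemma cproj_ι_of_ne (A : Cplx k c) {p q : I} (h : q ≠ p) (a : A.X q) :
    cproj A p (ι A q a) = 0 :=
  (DirectSum.component.of k (M := fun p => A.X p) p q a).trans (dif_neg h)

lemma eq_zero_of_cproj {A : Cplx k c} {a : (tot A).M} (h : ∀ p, cproj A p a = 0) : a = 0 :=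
  DirectSum.ext_component k fun p => (h p).trans (map_zero (cproj A p)).symm

lemma separates_tot (A : Cplx k c) : Separates (tot A).functionals := by
  intro a ha
  refine eq_zero_of_cproj fun p => separates_univ _ _ fun φ _ => ha (φ ∘ₗ cproj A p) ⟨p, ?_⟩
  rintro q _ ⟨b, rfl⟩ hq
  exact (congrArg φ (cproj_ι_of_ne A hq b)).trans (map_zero φ)

lemma separates_wt {X : Type u} (C : X → Cplx k c) (x : Word X) :
    Separates (wt C x).functionals := separates_tens fun _ => separates_tot _

namespace Operad

variable {X : Type u} (P : Operad k c X)

/-- The evaluation maps `P^∧(C)^y ⊗ P(x; y) → C^{⊗ x}` separate the elements of `P^∧(C)^y`. -/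
lemma separates_ev (C : X → Cplx k c) (y : X) : Separates (detectors fun x => P.ev C y x) := by
  intro h hh
  have key : ∀ p, cproj (P.hat.obj C y) p h = 0 := by
    intro p
    let f : (P.hatSp C y).deg p := cproj (P.hat.obj C y) p h
    have hf : f.1 = 0 := by
      funext x
      refine (P.ops y x).ext_deg fun n a ha => separates_wt C x _ ?_
      rintro ψ ⟨d, hψ⟩
      -- For `d = p + n` the detector sees only the component of `h` of degree `p`, so its vanishing
      -- on `h` gives its vanishing on `f`. For other `d` the value of `f` has the wrong degree.
      by_cases hd : d = p + n
      · subst hd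
        have hΦ := (hψ.flip (P.ev_isPairing C y x) ha)
        have h1 : (ψ ∘ₗ (P.ev C y x).flip a) h =
            (ψ ∘ₗ (P.ev C y x).flip a) (ι (P.hat.obj C y) p f) := by
          have : (ψ ∘ₗ (P.ev C y x).flip a) =
              (ψ ∘ₗ (P.ev C y x).flip a) ∘ₗ ι (P.hat.obj C y) p ∘ₗ cproj (P.hat.obj C y) p := by
            refine tot_ext fun q g => ?_
            by_cases hq : q = p
            · subst hq
              simp only [LinearMap.comp_apply, cproj_ι]
            · rw [hΦ q _ (ι_mem _ q g) (by rwa [add_sub_cancel_right])]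
              symm
              have h0 : (ι (P.hat.obj C y) p ∘ₗ cproj (P.hat.obj C y) p)
                  (ι (P.hat.obj C y) q g) = 0 :=
                (congrArg (ι (P.hat.obj C y) p) (cproj_ι_of_ne (P.hat.obj C y) hq g)).trans (map_zero _)
              exact (congrArg (ψ ∘ₗ (P.ev C y x).flip a) h0).trans (map_zero _)
          exact LinearMap.congr_fun this h
        have h2 := hh _ ⟨x, n, a, _, ψ, ha, hψ, rfl⟩
        rw [h1] at h2
        have e : P.ev C y x (ι (P.hat.obj C y) p f) = f.1 x := P.ev_ι C y x p f
        rw [LinearMap.comp_apply, LinearMap.flip_apply, e] at h2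
        exact h2
      · exact hψ _ _ (f.2.1 x n a ha) (Ne.symm hd)
    exact Subtype.ext hf
  exact eq_zero_of_cproj key

end Operad

end Functionals

/-! ## Tensor products of tensor products -/

section Unflat

/-- The pairs of positions are split according to whether they lie in different blocks or in the
same one. For two different blocks the signs multiply, by bilinearity, to the sign of the total
parities. -/
lemma shuffleSign_flat {n : ℕ} {m : Fin n → ℕ} (η θ : Fin (∑ i, m i) → ℤˣ) :
    shuffleSign η θ =
      shuffleSign (fun i => ∏ j, η (finSigmaFinEquiv ⟨i, j⟩))
        (fun i => ∏ j, θ (finSigmaFinEquiv ⟨i, j⟩)) *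
      ∏ i, shuffleSign (fun j => η (finSigmaFinEquiv ⟨i, j⟩))
        fun j => θ (finSigmaFinEquiv ⟨i, j⟩) := by
  unfold shuffleSign
  rw [prod_flat, ← Finset.prod_mul_distrib]
  refine Finset.prod_congr rfl fun i _ => ?_
  refine (Finset.prod_congr rfl fun j _ => prod_flat _).trans ?_
  rw [Finset.prod_comm]
  have h : ∀ i', (∏ j, ∏ j', if finSigmaFinEquiv ⟨i, j⟩ < finSigmaFinEquiv ⟨i', j'⟩ then
        koszul (θ (finSigmaFinEquiv ⟨i, j⟩)) (η (finSigmaFinEquiv ⟨i', j'⟩)) else 1) =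
      (if i < i' then koszul (∏ j, θ (finSigmaFinEquiv ⟨i, j⟩))
        (∏ j, η (finSigmaFinEquiv ⟨i', j⟩)) else 1) *
      (if i' = i then ∏ j, ∏ j', (if j < j' then koszul (θ (finSigmaFinEquiv ⟨i, j⟩))
        (η (finSigmaFinEquiv ⟨i, j'⟩)) else 1) else 1) := by
    intro i'
    rcases lt_trichotomy i i' with h | h | h
    · simp only [sigma_lt_of_lt h, h, h.ne', if_true, if_false, mul_one]
      exact (koszul_prod _ _).symm
    · subst h
      simp only [sigma_lt_iff, lt_irrefl, if_true, if_false, one_mul]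
    · simp only [not_lt_of_gt (sigma_lt_of_lt h _ _), not_lt_of_gt h, h.ne, if_false,
        Finset.prod_const_one, mul_one]
  refine (Finset.prod_congr rfl fun i' _ => h i').trans ?_
  rw [Finset.prod_mul_distrib]
  congr 1
  simp

/-! ### Regroupings of concatenations preserve the order of positions and carry no sign. -/

lemma permSign_of_strictMono {n m : ℕ} (e : Fin n ≃ Fin m) (h : ∀ i j, i < j → e i < e j)
    (η : Fin n → ℤˣ) : permSign e η = 1 :=
  Finset.prod_eq_one fun i _ => Finset.prod_eq_one fun j _ =>
    if_neg fun hij => lt_asymm hij.2 (h i j hij.1)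

lemma finSigmaFinEquiv_lt {n : ℕ} {m : Fin n → ℕ} {i i' : Fin n} {j : Fin (m i)}
    {j' : Fin (m i')} (h : finSigmaFinEquiv ⟨i, j⟩ < finSigmaFinEquiv ⟨i', j'⟩) :
    i < i' ∨ ∃ h : i = i', h ▸ j < j' := by
  rcases lt_trichotomy i i' with h1 | h1 | h1
  · exact Or.inl h1
  · subst h1
    exact Or.inr ⟨rfl, (sigma_lt_iff _ _).1 h⟩
  · exact (lt_asymm h (sigma_lt_of_lt h1 _ _)).elim

lemma singleEquiv_apply (m : ℕ) (i : Fin 1) (j : Fin m) :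
    singleEquiv m (finSigmaFinEquiv ⟨i, j⟩) = j := by
  simp only [singleEquiv, Equiv.trans_apply, Equiv.symm_apply_apply]
  rfl

lemma lettersEquiv_apply (n : ℕ) (i : Fin n) (j : Fin 1) :
    lettersEquiv n (finSigmaFinEquiv ⟨i, j⟩) = i := by
  simp only [lettersEquiv, Equiv.trans_apply, Equiv.symm_apply_apply]
  rfl

lemma assocEquiv_apply {n : ℕ} {m : Fin n → ℕ} (l : ∀ i, Fin (m i) → ℕ) (a : Fin (∑ i, m i))
    (r : Fin (l (finSigmaFinEquiv.symm a).1 (finSigmaFinEquiv.symm a).2)) :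
    assocEquiv l (finSigmaFinEquiv ⟨a, r⟩) = finSigmaFinEquiv
      ⟨(finSigmaFinEquiv.symm a).1, finSigmaFinEquiv ⟨(finSigmaFinEquiv.symm a).2, r⟩⟩ := by
  simp only [assocEquiv, Equiv.trans_apply, Equiv.symm_apply_apply]
  rfl

lemma permSign_single (m : ℕ) (η : Fin (∑ _ : Fin 1, m) → ℤˣ) : permSign (singleEquiv m) η = 1 := by
  refine permSign_of_strictMono _ (fun s s' h => ?_) η
  obtain ⟨⟨i, j⟩, rfl⟩ := finSigmaFinEquiv.surjective s
  obtain ⟨⟨i', j'⟩, rfl⟩ := finSigmaFinEquiv.surjective s'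
  obtain rfl := Subsingleton.elim i i'
  rw [singleEquiv_apply, singleEquiv_apply]
  exact (sigma_lt_iff (m := fun _ => m) _ _).1 h

lemma permSign_letters (n : ℕ) (η : Fin (∑ _ : Fin n, 1) → ℤˣ) :
    permSign (lettersEquiv n) η = 1 := by
  refine permSign_of_strictMono _ (fun s s' h => ?_) η
  obtain ⟨⟨i, j⟩, rfl⟩ := finSigmaFinEquiv.surjective s
  obtain ⟨⟨i', j'⟩, rfl⟩ := finSigmaFinEquiv.surjective s'
  rw [lettersEquiv_apply, lettersEquiv_apply]
  rcases finSigmaFinEquiv_lt h with h | ⟨rfl, h⟩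
  · exact h
  · exact (h.ne (Subsingleton.elim _ _)).elim

lemma permSign_assoc {n : ℕ} {m : Fin n → ℕ} (l : ∀ i, Fin (m i) → ℕ)
    (η : Fin (∑ s : Fin (∑ i, m i),
      l (finSigmaFinEquiv.symm s).1 (finSigmaFinEquiv.symm s).2) → ℤˣ) :
    permSign (assocEquiv l) η = 1 := by
  refine permSign_of_strictMono _ (fun s s' h => ?_) η
  obtain ⟨⟨a, r⟩, rfl⟩ := finSigmaFinEquiv.surjective s
  obtain ⟨⟨a', r'⟩, rfl⟩ := finSigmaFinEquiv.surjective s'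
  rw [assocEquiv_apply, assocEquiv_apply]
  rcases finSigmaFinEquiv_lt h with h | ⟨rfl, h⟩
  · have key : ∀ (w w' : (i : Fin n) × Fin (m i)) (r : Fin (l w.1 w.2)) (r' : Fin (l w'.1 w'.2)),
        finSigmaFinEquiv w < finSigmaFinEquiv w' →
        finSigmaFinEquiv (n := fun i => ∑ j, l i j) ⟨w.1, finSigmaFinEquiv ⟨w.2, r⟩⟩ <
          finSigmaFinEquiv ⟨w'.1, finSigmaFinEquiv ⟨w'.2, r'⟩⟩ := by
      rintro ⟨i, j⟩ ⟨i', j'⟩ r r' h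
      rcases finSigmaFinEquiv_lt h with h | ⟨rfl, h⟩
      · exact sigma_lt_of_lt h _ _
      · exact (sigma_lt_iff _ _).2 (sigma_lt_of_lt h _ _)
    refine key _ _ r r' ?_
    rwa [Equiv.apply_symm_apply, Equiv.apply_symm_apply]
  · exact (sigma_lt_iff _ _).2 ((sigma_lt_iff _ _).2 h)

/-- By `shuffleSign_flat` the shuffle of all factors is the shuffle of the blocks together with the
shuffles inside each block. -/
lemma unflatG_pairTens {n : ℕ} {m : Fin n → ℕ} {G A B : ∀ i, Fin (m i) → GMod k c}
    (E : ∀ i j, (G i j).M →ₗ[k] (A i j).M →ₗ[k] (B i j).M)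
    (g : (tens (flatFam G)).M) (a : (tens (flatFam A)).M) :
    unflatG B (pairTens (G := flatFam G) (A := flatFam A) (B := flatFam B)
      (fun _ => E _ _) g a) =
    pairTens (G := fun i => tens (G i)) (A := fun i => tens (A i)) (B := fun i => tens (B i))
      (fun i => pairTens (E i)) (unflatG G g) (unflatG A a) := by
  have : (pairTens (G := flatFam G) (A := flatFam A) (B := flatFam B)
      fun _ => E _ _).compr₂ (unflatG B) =
    (pairTens (G := fun i => tens (G i)) (A := fun i => tens (A i)) (B := fun i => tens (B i))
      fun i => pairTens (E i)).compl₁₂ (unflatG G) (unflatG A) := by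
    refine flat_ext fun p g hg => flat_ext fun q a ha => ?_
    rw [LinearMap.compr₂_apply, LinearMap.compl₁₂_apply, unflatG_pure, unflatG_pure,
      pairTens_pure (G := flatFam G) (A := flatFam A) (B := flatFam B) _ (flat_mem hg)
        (flat_mem ha), map_smul,
      pairTens_pure _ (fun i => pure_mem (hg i)) (fun i => pure_mem (ha i))]
    have e : (fun i => pairTens (E i) (pure (g i)) (pure (a i))) = fun i =>
        sg k (shuffleSign (fun j => c.ε (p i j)) fun j => c.ε (q i j)) •
          pure (A := B i) fun j => E i j (g i j) (a i j) :=
      funext fun i => pairTens_pure (E i) (hg i) (ha i)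
    rw [e, pure_sg_smul (A := fun i => tens (B i)), smul_smul, ← map_mul, shuffleSign_flat]
    simp only [flatDeg_apply, ε_sum]
    congr 1
    exact unflatG_pure (A := B) fun i j => E i j (g i j) (a i j)
  exact LinearMap.congr_fun₂ this g a

lemma exists_flat_family {n : ℕ} {m : Fin n → ℕ} (F : ∀ i, Fin (m i) → Type u)
    (a : ∀ s : Fin (∑ i, m i), F (finSigmaFinEquiv.symm s).1 (finSigmaFinEquiv.symm s).2) :
    ∃ u : ∀ i j, F i j, a = fun s => u (finSigmaFinEquiv.symm s).1 (finSigmaFinEquiv.symm s).2 := by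
  let E := Equiv.piCongrLeft' (fun w : (i : Fin n) × Fin (m i) => F w.1 w.2) finSigmaFinEquiv
  exact ⟨fun i j => E.symm a ⟨i, j⟩, (E.apply_symm_apply a).symm⟩

/-- On pure tensors of triply indexed families both sides are the same regrouping. The maps `ψ` are
constrained only by their effect on such families, which keeps the transport between equal colours
out of the computation. -/
lemma unflatG_assoc {n : ℕ} {m : Fin n → ℕ} {l : ∀ i, Fin (m i) → ℕ}
    (A : ∀ i j, Fin (l i j) → GMod k c)
    (ψ : ∀ s, (flatFam (n := ∑ i, m i)
        (m := fun s => l (finSigmaFinEquiv.symm s).1 (finSigmaFinEquiv.symm s).2)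
        (fun s => A (finSigmaFinEquiv.symm s).1 (finSigmaFinEquiv.symm s).2) s).M →ₗ[k]
      (flatFam (fun i => flatFam (A i)) (assocEquiv l s)).M)
    (hψ : ∀ (u : ∀ i j r, (A i j r).M) s,
      flat (A := fun i => flatFam (A i)) (fun i => flat (u i)) (assocEquiv l s) =
      ψ s (flat (n := ∑ i, m i)
        (m := fun s => l (finSigmaFinEquiv.symm s).1 (finSigmaFinEquiv.symm s).2)
        (A := fun s => A (finSigmaFinEquiv.symm s).1 (finSigmaFinEquiv.symm s).2)
        (fun s => u (finSigmaFinEquiv.symm s).1 (finSigmaFinEquiv.symm s).2) s))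
    (t : (tens (flatFam (n := ∑ i, m i)
        (m := fun s => l (finSigmaFinEquiv.symm s).1 (finSigmaFinEquiv.symm s).2)
        fun s => A (finSigmaFinEquiv.symm s).1 (finSigmaFinEquiv.symm s).2)).M) :
    tensMap (A := fun i => tens (flatFam (A i))) (B := fun i => tens fun j => tens (A i j))
        (fun i => unflatG (A i)) (unflatG (fun i => flatFam (A i))
          (permMap (B := flatFam fun i => flatFam (A i)) (assocEquiv l) ψ t)) =
      unflatG (fun i j => tens (A i j)) (unflatG (n := ∑ i, m i)
        (m := fun s => l (finSigmaFinEquiv.symm s).1 (finSigmaFinEquiv.symm s).2)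
        (fun s => A (finSigmaFinEquiv.symm s).1 (finSigmaFinEquiv.symm s).2) t) := by
  refine LinearMap.congr_fun (f := tensMap (A := fun i => tens (flatFam (A i)))
    (B := fun i => tens fun j => tens (A i j)) (fun i => unflatG (A i)) ∘ₗ
      unflatG (fun i => flatFam (A i)) ∘ₗ
      permMap (B := flatFam fun i => flatFam (A i)) (assocEquiv l) ψ)
    (g := unflatG (fun i j => tens (A i j)) ∘ₗ unflatG (n := ∑ i, m i)
        (m := fun s => l (finSigmaFinEquiv.symm s).1 (finSigmaFinEquiv.symm s).2)
        (fun s => A (finSigmaFinEquiv.symm s).1 (finSigmaFinEquiv.symm s).2)) ?_ t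
  refine flat_ext fun p u' hu => ?_
  obtain ⟨u, rfl⟩ := exists_flat_family (fun i j => ∀ r, (A i j r).M) u'
  simp only [LinearMap.comp_apply]
  rw [permMap_pure (B := flatFam fun i => flatFam (A i)) _ ψ (flat_mem hu), permSign_assoc,
    map_one, one_smul]
  have hv : (Equiv.piCongrLeft (fun s => (flatFam (fun i => flatFam (A i)) s).M) (assocEquiv l)
      fun s => ψ s (flat (n := ∑ i, m i)
        (m := fun s => l (finSigmaFinEquiv.symm s).1 (finSigmaFinEquiv.symm s).2)
        (A := fun s => A (finSigmaFinEquiv.symm s).1 (finSigmaFinEquiv.symm s).2)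
        (fun s => u (finSigmaFinEquiv.symm s).1 (finSigmaFinEquiv.symm s).2) s)) =
      flat (A := fun i => flatFam (A i)) fun i => flat (u i) := by
    funext s
    obtain ⟨s, rfl⟩ := (assocEquiv l).surjective s
    rw [Equiv.piCongrLeft_apply_apply, hψ]
  rw [hv, unflatG_pure, tensMap_pure, unflatG_pure (n := ∑ i, m i)]
  refine Eq.trans ?_ (unflatG_pure (A := fun i j => tens (A i j)) fun i j => pure (u i j)).symm
  exact congrArg pure (funext fun i => unflatG_pure (u i))

lemma unflatG_single {m : ℕ} (A : Fin m → GMod k c)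
    (ψ : ∀ s, (flatFam (n := 1) (m := fun _ => m) (fun _ => A) s).M →ₗ[k]
      (A (singleEquiv m s)).M)
    (hψ : ∀ (u : Fin 1 → ∀ j, (A j).M) s, u 0 (singleEquiv m s) =
      ψ s (flat (m := fun _ => m) (A := fun _ => A) u s))
    (t : (tens (flatFam (n := 1) (m := fun _ => m) fun _ => A)).M) :
    oneOut (tens A) (unflatG (n := 1) (m := fun _ => m) (fun _ => A) t) =
      permMap (singleEquiv m) ψ t := by
  have : oneOut (tens A) ∘ₗ unflatG (n := 1) (m := fun _ => m) (fun _ => A) =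
      permMap (singleEquiv m) ψ := by
    refine flat_ext fun p u hu => ?_
    rw [LinearMap.comp_apply, unflatG_pure, oneOut_pure,
      permMap_pure _ ψ (flat_mem (m := fun _ => m) (A := fun _ => A) hu), permSign_single,
      map_one, one_smul]
    refine congrArg pure (funext fun s => ?_)
    obtain ⟨s, rfl⟩ := (singleEquiv m).surjective s
    rw [Equiv.piCongrLeft_apply_apply]
    exact hψ u s
  exact LinearMap.congr_fun this t

lemma unflatG_letters {n : ℕ} (A : Fin n → GMod k c)
    (ψ : ∀ s, (flatFam (m := fun _ => 1) (fun i _ => A i) s).M →ₗ[k] (A (lettersEquiv n s)).M)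
    (hψ : ∀ (u : ∀ i, Fin 1 → (A i).M) s, u (lettersEquiv n s) 0 =
      ψ s (flat (m := fun _ => 1) (A := fun i _ => A i) u s))
    (t : (tens (flatFam (m := fun _ => 1) fun i _ => A i)).M) :
    tensMap (A := fun i => tens fun _ : Fin 1 => A i) (fun i => oneOut (A i))
      (unflatG (m := fun _ => 1) (fun i _ => A i) t) = permMap (lettersEquiv n) ψ t := by
  have : tensMap (A := fun i => tens fun _ : Fin 1 => A i) (fun i => oneOut (A i)) ∘ₗ
      unflatG (m := fun _ => 1) (fun i _ => A i) = permMap (lettersEquiv n) ψ := by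
    refine flat_ext fun p u hu => ?_
    rw [LinearMap.comp_apply, unflatG_pure, tensMap_pure,
      permMap_pure _ ψ (flat_mem (m := fun _ => 1) (A := fun i _ => A i) hu), permSign_letters,
      map_one, one_smul]
    refine congrArg pure (funext fun s => ?_)
    obtain ⟨s, rfl⟩ := (lettersEquiv n).surjective s
    rw [Equiv.piCongrLeft_apply_apply, oneOut_pure]
    exact hψ u s
  exact LinearMap.congr_fun this t

/-! ### Tensor powers and the coherence isomorphisms of words. -/

variable {X : Type u}

open Word

lemma colMap_apply_of_eq (C : X → Cplx k c) {J : Type} {f : J → X} (v : ∀ j, (tot (C (f j))).M)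
    {a b : J} (h : a = b) (h' : f a = f b) : v b = colMap C h' (v a) := by
  subst h; rw [colMap_rfl]

lemma unflat_concatAssoc (C : X → Cplx k c) (x : Word X) (z : Fin x.len → Word X)
    (T : ∀ i, Fin (z i).len → Word X)
    (t : (wt C (concat (concat x z) fun s =>
      T (finSigmaFinEquiv.symm s).1 (finSigmaFinEquiv.symm s).2)).M) :
    tensMap (A := fun i => wt C (concat (z i) (T i))) (B := fun i => tens fun j => wt C (T i j))
      (fun i => unflat C (z i) (T i))
        (unflat C x (fun i => concat (z i) (T i)) (wtMap C (concatAssoc x z T) t)) =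
      unflatG (m := fun i => (z i).len) (fun i j => wt C (T i j))
        (unflat C (concat x z)
          (fun s => T (finSigmaFinEquiv.symm s).1 (finSigmaFinEquiv.symm s).2) t) := by
  refine unflatG_assoc (l := fun i j => (T i j).len) (fun i j r => tot (C ((T i j).col r)))
    (fun s => colMap C ((concatAssoc x z T).2 s).symm) (fun u s => ?_) t
  -- The two sides carry the same vector up to a transport of colours. Reading the triply indexed
  -- family as a function on `J` reduces this to the equality of two triples of positions.
  let J := (i : Fin x.len) × (j : Fin (z i).len) × Fin (T i j).len
  let w (q : (i : Fin x.len) × Fin (∑ j, (T i j).len)) : J := ⟨q.1, finSigmaFinEquiv.symm q.2⟩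
  have hw : ∀ q : J, w (finSigmaFinEquiv.symm
      (finSigmaFinEquiv ⟨q.1, finSigmaFinEquiv ⟨q.2.1, q.2.2⟩⟩)) = q := fun q =>
    (congrArg w (Equiv.symm_apply_apply _ _)).trans
      (congrArg (Sigma.mk q.1) (Equiv.symm_apply_apply _ _))
  exact colMap_apply_of_eq C (J := J) (f := fun w => (T w.1 w.2.1).col w.2.2)
    (fun w => u w.1 w.2.1 w.2.2) (hw ⟨_, _, (finSigmaFinEquiv.symm s).2⟩).symm _

lemma unflat_concatSingle (C : X → Cplx k c) (y : X) (x : Word X)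
    (t : (wt C (concat (single y) fun _ => x)).M) :
    oneOut (wt C x) (unflat C (single y) (fun _ => x) t) = wtMap C (concatSingle y x) t := by
  refine unflatG_single (fun j => tot (C (x.col j)))
    (fun s => colMap C ((concatSingle y x).2 s).symm) (fun u s => ?_) t
  exact colMap_apply_of_eq C (J := Fin 1 × Fin x.len) (f := fun w => x.col w.2)
    (fun w => u w.1 w.2) (a := ((finSigmaFinEquiv.symm s).1, (finSigmaFinEquiv.symm s).2))
    (b := (0, (finSigmaFinEquiv.symm s).2))
      (Prod.ext (Subsingleton.elim _ _) rfl) _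

lemma unflat_concatLetters (C : X → Cplx k c) (x : Word X)
    (t : (wt C (concat x fun i => single (x.col i))).M) :
    tensMap (A := fun i => wt C (single (x.col i))) (fun i => oneOut (tot (C (x.col i))))
      (unflat C x (fun i => single (x.col i)) t) = wtMap C (concatLetters x) t := by
  refine unflatG_letters (fun i => tot (C (x.col i)))
    (fun s => colMap C ((concatLetters x).2 s).symm) (fun u s => ?_) t
  exact colMap_apply_of_eq C (J := Fin x.len × Fin 1) (f := fun w => x.col w.1)
    (fun w => u w.1 w.2) 
    (a := ((finSigmaFinEquiv.symm s).1, (finSigmaFinEquiv.symm s).2))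
    (b := ((finSigmaFinEquiv.symm s).1, 0))
      (Prod.ext rfl (Subsingleton.elim _ _)) _

end Unflat

/-! ## Representative elements -/

section Representative

open Word

lemma oneOut_pairTens {G A B : GMod k c} (E : G.M →ₗ[k] A.M →ₗ[k] B.M) (t : (tens fun _ : Fin 1 => G).M)
    {n : I} {a : A.M} (ha : a ∈ A.deg n) :
    oneOut B (pairTens (G := fun _ : Fin 1 => G) (A := fun _ => A) (B := fun _ => B) (fun _ => E) t
      (pure fun _ => a)) = E (oneOut G t) a := by
  have : oneOut B ∘ₗ (pairTens (G := fun _ : Fin 1 => G) (A := fun _ => A) (B := fun _ => B)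
      fun _ => E).flip (pure fun _ => a) = E.flip a ∘ₗ oneOut G := by
    refine tens_ext fun p g hg => ?_
    rw [LinearMap.comp_apply, LinearMap.comp_apply, LinearMap.flip_apply, LinearMap.flip_apply,
      pairTens_pure _ hg fun _ => ha, map_smul, oneOut_pure, oneOut_pure]
    simp [shuffleSign]
  exact LinearMap.congr_fun this t

/-- The pairing enters through an equation, so that one indexed by the letters of a one-letter word
can be supplied. -/
lemma oneOut_pairTens_of_eq {G A B : GMod k c} (E : G.M →ₗ[k] A.M →ₗ[k] B.M)
    (φ : (tens fun _ : Fin 1 => G).M →ₗ[k] (tens fun _ : Fin 1 => A).M →ₗ[k]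
      (tens fun _ : Fin 1 => B).M)
    (hφ : φ = pairTens (G := fun _ : Fin 1 => G) (A := fun _ => A) (B := fun _ => B) fun _ => E)
    (t : (tens fun _ : Fin 1 => G).M) {n : I} {a : A.M} (ha : a ∈ A.deg n) :
    oneOut B (φ t (pure (A := fun _ : Fin 1 => A) fun _ => a)) = E (oneOut G t) a := by
  subst hφ
  exact oneOut_pairTens E t ha

lemma shuffleSign_mul_left {n : ℕ} (η η' θ : Fin n → ℤˣ) :
    shuffleSign (fun j => η j * η' j) θ = shuffleSign η θ * shuffleSign η' θ := by
  unfold shuffleSign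
  simp only [← Finset.prod_mul_distrib]
  refine Finset.prod_congr rfl fun i _ => Finset.prod_congr rfl fun j _ => ?_
  split_ifs
  · exact koszul_mul_right _ _ _
  · exact (one_mul _).symm

lemma shuffleSign_mul_right {n : ℕ} (η θ θ' : Fin n → ℤˣ) :
    shuffleSign η (fun j => θ j * θ' j) = shuffleSign η θ * shuffleSign η θ' := by
  unfold shuffleSign
  simp only [← Finset.prod_mul_distrib]
  refine Finset.prod_congr rfl fun i _ => Finset.prod_congr rfl fun j _ => ?_
  split_ifs
  · exact koszul_mul_left _ _ _
  · exact (one_mul _).symm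

/-- Every factor of the sign involves two different positions, and one of them differs from `i`. -/
lemma shuffleSign_eq_one {n : ℕ} (i : Fin n) {η θ : Fin n → ℤˣ} (hη : ∀ j, j ≠ i → η j = 1)
    (hθ : ∀ j, j ≠ i → θ j = 1) : shuffleSign η θ = 1 := by
  have h1 : ∀ u, koszul 1 u = 1 := by decide
  have h2 : ∀ u, koszul u 1 = 1 := by decide
  refine Finset.prod_eq_one fun a _ => Finset.prod_eq_one fun b _ => ?_
  split_ifs with hab
  · by_cases ha : a = i
    · rw [hη b fun hb => hab.ne (ha.trans hb.symm), h2]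
    · rw [hθ a ha, h1]
  · rfl

/-- Elements of degree zero are even and move past everything without signs. The case needed is that
of the operad units. -/
lemma pairTens_pure_zero {n : ℕ} {G A B : Fin n → GMod k c}
    (E : ∀ i, (G i).M →ₗ[k] (A i).M →ₗ[k] (B i).M) {a : ∀ j, (A j).M}
    (ha : ∀ j, a j ∈ (A j).deg 0) (t : (tens G).M) :
    pairTens E t (pure a) = tensMap (fun j => (E j).flip (a j)) t := by
  have : (pairTens E).flip (pure a) = tensMap (A := G) (B := B) fun j => (E j).flip (a j) := by
    refine tens_ext fun p g hg => ?_
    rw [LinearMap.flip_apply, pairTens_pure E hg ha, tensMap_pure]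
    have h1 : ∀ u, koszul (c.ε 0) u = 1 := by rw [c.ε_zero]; decide
    have : shuffleSign (fun j => c.ε (p j)) (fun _ : Fin n => c.ε 0) = 1 :=
      Finset.prod_eq_one fun a _ => Finset.prod_eq_one fun b _ => by
        split_ifs
        · exact h1 _
        · rfl
    rw [this, map_one, one_smul]
    rfl
  exact LinearMap.congr_fun this t

lemma ε_sub_mul (d n : I) : c.ε (d - n) * c.ε n = c.ε d := by
  rw [← c.ε_add, sub_add_cancel]

/-- The identification `C^{⊗ y} = C^y`. -/
def wtOne {X : Type u} (C : X → Cplx k c) (y : X) : (wt C (single y)).M →ₗ[k] (tot (C y)).M :=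
  oneOut (tot (C y))

lemma wtOne_isHom {X : Type u} (C : X → Cplx k c) (y : X) : GMod.IsHom (wtOne C y) :=
  oneOut_isHom _

namespace Operad

variable {X : Type u} (P : Operad k c X)

lemma isRepresentative_iff {C : X → Cplx k c} {y : X} {p : I} {f : (P.hatSp C y).deg p} :
    P.IsRepresentative C y p f ↔
      ∃ g ∈ (P.hatSp (P.hat.obj C) y).deg p, P.laxL C y g = P.diagL C y f.1 := by
  constructor
  · rintro ⟨g, hg⟩
    exact ⟨g.1, g.2, congrArg Subtype.val hg⟩
  · rintro ⟨g, h1, h2⟩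
    exact ⟨⟨g, h1⟩, Subtype.ext h2⟩

/-- The pairing of `P^∧(C)^{x₁} ⊗ ⋯ ⊗ P^∧(C)^{xₙ}` with `P(z₁; x₁) ⊗ ⋯ ⊗ P(zₙ; xₙ)`. -/
def evWt (C : X → Cplx k c) (x : Word X) (z : Fin x.len → Word X) :
    (wt (P.hat.obj C) x).M →ₗ[k] (P.opsTens x z).M →ₗ[k] (wtTens C x z).M :=
  pairTens fun i => P.ev C (x.col i) (z i)

lemma evWt_isPairing (C : X → Cplx k c) (x : Word X) (z : Fin x.len → Word X) :
    IsPairing (P.evWt C x z) := pairTens_isPairing fun _ => P.ev_isPairing C _ _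

lemma separates_evWt (C : X → Cplx k c) (x : Word X) : Separates (detectors fun z => P.evWt C x z) :=
  separates_detectors_pairTens (S := fun _ => Word X) (fun _ _ => P.ev_isPairing C _ _)
    fun _ => P.separates_ev C _

/-- Elements of a tensor power of `P^∧(C)` are functions of operations: this is what makes elements
with prescribed evaluations unique, and `α` injective. -/
lemma wt_hat_ext {C : X → Cplx k c} {x : Word X} {t t' : (wt (P.hat.obj C) x).M}
    (h : ∀ (z : Fin x.len → Word X) (b : Fin x.len → I) (κ : ∀ i, (P.ops (x.col i) (z i)).M),
      (∀ i, κ i ∈ (P.ops (x.col i) (z i)).deg (b i)) →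
      P.evWt C x z t (pure κ) = P.evWt C x z t' (pure κ)) : t = t' := by
  rw [← sub_eq_zero]
  refine eq_zero_of_detectors (P.separates_evWt C x) fun z n a _ => ?_
  rw [map_sub, LinearMap.sub_apply, sub_eq_zero]
  have : P.evWt C x z t = P.evWt C x z t' := tens_ext fun b κ hκ => h z b κ hκ
  rw [this]

lemma hat_ext {C : X → Cplx k c} {y : X} {t t' : (tot (P.hat.obj C y)).M}
    (h : ∀ x n, ∀ a ∈ (P.ops y x).deg n, P.ev C y x t a = P.ev C y x t' a) : t = t' := by
  rw [← sub_eq_zero]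
  refine eq_zero_of_detectors (P.separates_ev C y) fun x n a ha => ?_
  rw [map_sub, LinearMap.sub_apply, sub_eq_zero]
  exact h x n a ha

/-! ### The operad laws for a pair `f`, `g` with `α g = Δ f`. -/

section

variable {P} {C : X → Cplx k c} {y : X} {p : I} {f : ∀ x, (P.ops y x).M →ₗ[k] (wt C x).M}
  {g : ∀ x, (P.ops y x).M →ₗ[k] (wt (P.hat.obj C) x).M}

lemma hatSp_act (hf : f ∈ (P.hatSp C y).deg p) {x x' : Word X} (e : x ⟶ x') (μ : (P.ops y x).M) :
    f x' (P.act y e μ) = wtMap C e (f x μ) := hf.2 x x' e μ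

lemma ev_ι_apply (hf : f ∈ (P.hatSp C y).deg p) (x : Word X) :
    P.ev C y x (ι (P.hat.obj C y) p (⟨f, hf⟩ : (P.hatSp C y).deg p)) = f x :=
  P.ev_ι C y x p ⟨f, hf⟩

lemma evWt_of_lax (h : P.laxL C y g = P.diagL C y f) (x : Word X) (z : Fin x.len → Word X)
    (μ : (P.ops y x).M) (ν : (P.opsTens x z).M) :
    P.evWt C x z (g x μ) ν = unflat C x z (f (x.concat z) (P.comp y x z μ ν)) :=
  LinearMap.congr_fun₂ (congrFun (congrFun h x) z) μ ν

/-- This is `f (μ ∘ (ν ∘ κ)) = f ((μ ∘ ν) ∘ κ)`, where the right-hand side is read off from `g` at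
the operation `μ ∘ ν`. -/
lemma unflat_comp_comp (hf : f ∈ (P.hatSp C y).deg p) (h : P.laxL C y g = P.diagL C y f)
    (x : Word X) (z : Fin x.len → Word X) (T : ∀ i, Fin (z i).len → Word X)
    (μ : (P.ops y x).M) (ν : (P.opsTens x z).M)
    (κ : (P.opsTens (concat x z) fun s =>
      T (finSigmaFinEquiv.symm s).1 (finSigmaFinEquiv.symm s).2).M) :
    tensMap (A := fun i => wt C (concat (z i) (T i))) (B := fun i => wtTens C (z i) (T i))
      (fun i => unflat C (z i) (T i)) (unflat C x (fun i => concat (z i) (T i))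
        (f _ (P.comp y x _ μ (pairTens (fun i => P.comp (x.col i) (z i) (T i)) ν
          (unflatG (m := fun i => (z i).len) (fun i j => P.ops ((z i).col j) (T i j)) κ))))) =
    pairTens (fun i => P.evWt C (z i) (T i))
      (unflat (P.hat.obj C) x z (g (concat x z) (P.comp y x z μ ν)))
      (unflatG (m := fun i => (z i).len) (fun i j => P.ops ((z i).col j) (T i j)) κ) := by
  rw [← P.assoc, hatSp_act hf, unflat_concatAssoc, ← evWt_of_lax h]
  exact unflatG_pairTens (m := fun i => (z i).len) (fun i j => P.ev C ((z i).col j) (T i j)) _ _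

lemma oneOut_evWt (C : X → Cplx k c) (y : X) (x : Word X) (t : (wt (P.hat.obj C) (single y)).M) {n : I}
    {a : (P.ops y x).M} (ha : a ∈ (P.ops y x).deg n) :
    oneOut (wt C x) (P.evWt C (single y) (fun _ => x) t (pure (A := fun _ : Fin 1 => P.ops y x)
      fun _ => a)) = P.ev C y x (wtOne (P.hat.obj C) y t) a := by
  have h : P.evWt C (single y) (fun _ => x) = pairTens (n := 1) (G := fun _ => tot (P.hat.obj C y))
      (A := fun _ => P.ops y x) (B := fun _ => wt C x) (fun _ => P.ev C y x) := by
    unfold evWt; rfl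
  exact oneOut_pairTens_of_eq (P.ev C y x) _ h t ha

/-- The left unit law for representative elements. -/
lemma evalUnit_of_lax (hf : f ∈ (P.hatSp C y).deg p) (h : P.laxL C y g = P.diagL C y f) :
    wtOne (P.hat.obj C) y (g (single y) (P.unit y)) =
      ι (P.hat.obj C y) p (⟨f, hf⟩ : (P.hatSp C y).deg p) := by
  refine P.hat_ext fun x n a ha => ?_
  refine Eq.trans ?_ (LinearMap.congr_fun (ev_ι_apply hf x) a).symm
  let m : (P.ops y (concat (single y) fun _ => x)).M := P.comp y (single y) (fun _ => x) (P.unit y)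
    (pure (A := fun _ : Fin 1 => P.ops y x) fun _ => a)
  have h1 := congrArg (oneOut (wt C x)) (evWt_of_lax h (single y) (fun _ => x) (P.unit y)
    (pure (A := fun _ : Fin 1 => P.ops y x) fun _ => a))
  have h2 := unflat_concatSingle C y x (f _ m)
  have h3 := hatSp_act hf (concatSingle y x) m
  have h4 : f x (P.act y (concatSingle y x) m) = f x a := congrArg (f x) (P.unit_comp y x a)
  exact (oneOut_evWt C y x _ ha).symm.trans (h1.trans (h2.trans (h3.symm.trans h4)))

/-- The counit is defined degree by degree; on total spaces it is evaluation at the unit, in a form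
that can be tensored. -/
lemma totMap_counit (C : X → Cplx k c) (y : X) :
    totMap (P.counit.app C y) = wtOne C y ∘ₗ (P.ev C y (single y)).flip (P.unit y) := by
  refine tot_ext fun p f => ?_
  refine (totMap_ι _ _ _).trans ((ι_cproj _ (P.evalUnit_mem C y p f.2)).trans ?_)
  exact congrArg (wtOne C y) (LinearMap.congr_fun (P.ev_ι C y (single y) p f) (P.unit y)).symm

/-- Substituting units into every input of `μ` and relabelling gives back `μ`. -/
lemma wtOne_unflat_letters (hf : f ∈ (P.hatSp C y).deg p) (x : Word X) (μ : (P.ops y x).M) :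
    tensMap (A := fun i => wt C (single (x.col i))) (fun i => wtOne C (x.col i))
      (unflat C x (fun i => single (x.col i)) (f _ (P.comp y x (fun i => single (x.col i)) μ
        (pure (A := fun i => P.ops (x.col i) (single (x.col i))) fun i => P.unit (x.col i))))) =
      f x μ := by
  refine (unflat_concatLetters C x _).trans ?_
  rw [← hatSp_act hf]
  exact congrArg (f x) (P.comp_unit y x μ)

/-- The right unit law for representative elements. -/
lemma wtFun_counit_of_lax (hf : f ∈ (P.hatSp C y).deg p) (h : P.laxL C y g = P.diagL C y f)
    (x : Word X) (μ : (P.ops y x).M) : wtFun (P.counit.app C) x (g x μ) = f x μ := by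
  rw [← wtOne_unflat_letters hf x μ, ← evWt_of_lax h]
  refine Eq.trans ?_ (congrArg _ (pairTens_pure_zero (fun i => P.ev C (x.col i) _)
    (fun i => P.unit_mem (x.col i)) (g x μ)).symm)
  refine Eq.trans ?_ (LinearMap.congr_fun (tensMap_comp _ _) _)
  exact congrArg (fun φ => tensMap φ (g x μ)) (funext fun i => totMap_counit C _)

/-- An element `f` of `P^∧(C)` is representative if all the elements `κ ↦ f (ρ ∘ κ)` are in the
image of `α`. -/
lemma isRepresentative_of_forall (hf : f ∈ (P.hatSp C y).deg p)
    (h : ∀ (w : Word X) (r : I), ∀ ρ ∈ (P.ops y w).deg r, ∃ t ∈ (wt (P.hat.obj C) w).deg (p + r),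
      ∀ (z : Fin w.len → Word X) (b : Fin w.len → I) (κ : ∀ i, (P.ops (w.col i) (z i)).M),
        (∀ i, κ i ∈ (P.ops (w.col i) (z i)).deg (b i)) →
        P.evWt C w z t (pure κ) = unflat C w z (f (w.concat z) (P.comp y w z ρ (pure κ)))) :
    P.IsRepresentative C y p ⟨f, hf⟩ := by
  -- The hypothesis concerns homogeneous operations only; it is extended to all of them by
  -- linearity.
  have ex : ∀ (w : Word X) (ρ : (P.ops y w).M), ∃ t : (wt (P.hat.obj C) w).M,
      ∀ (z : Fin w.len → Word X) (b : Fin w.len → I) (κ : ∀ i, (P.ops (w.col i) (z i)).M),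
        (∀ i, κ i ∈ (P.ops (w.col i) (z i)).deg (b i)) →
        P.evWt C w z t (pure κ) = unflat C w z (f (w.concat z) (P.comp y w z ρ (pure κ))) := by
    intro w ρ
    have hρ : ρ ∈ Submodule.span k {a | ∃ p, a ∈ (P.ops y w).deg p} :=
      (P.ops y w).span_deg ▸ Submodule.mem_top
    induction hρ using Submodule.span_induction with
    | mem ρ hρ =>
      obtain ⟨r, hr⟩ := hρ
      obtain ⟨t, -, ht⟩ := h w r ρ hr
      exact ⟨t, ht⟩
    | zero => exact ⟨0, fun z b κ _ => by simp only [map_zero, LinearMap.zero_apply]⟩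
    | add ρ ρ' _ _ h1 h2 =>
      obtain ⟨t, ht⟩ := h1
      obtain ⟨t', ht'⟩ := h2
      exact ⟨t + t', fun z b κ hκ => by
        simp only [map_add, LinearMap.add_apply, ht z b κ hκ, ht' z b κ hκ]⟩
    | smul s ρ _ h1 =>
      obtain ⟨t, ht⟩ := h1
      exact ⟨s • t, fun z b κ hκ => by
        simp only [map_smul, LinearMap.smul_apply, ht z b κ hκ]⟩
  choose F hF using ex
  -- The chosen elements depend linearly on the operation because they are determined by their
  -- evaluations.
  let g : ∀ w, (P.ops y w).M →ₗ[k] (wt (P.hat.obj C) w).M := fun w =>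
    { toFun := F w
      map_add' := fun ρ ρ' => P.wt_hat_ext fun z b κ hκ => by
        simp only [map_add, LinearMap.add_apply, hF w _ z b κ hκ]
      map_smul' := fun s ρ => P.wt_hat_ext fun z b κ hκ => by
        simp only [map_smul, LinearMap.smul_apply, hF w _ z b κ hκ, RingHom.id_apply] }
  refine P.isRepresentative_iff.2 ⟨g, ⟨fun w r ρ hρ => ?_, fun x x' e ρ => ?_⟩, ?_⟩
  · obtain ⟨t, ht, ht'⟩ := h w r ρ hρ
    have : F w ρ = t := P.wt_hat_ext fun z b κ hκ => (hF w ρ z b κ hκ).trans (ht' z b κ hκ).symm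
    change F w ρ ∈ _
    rwa [this]
  -- Every morphism of words is a bijection `σ` with source `x'.pull σ`, so naturality is only
  -- needed for the morphisms `pullHom`.
  · have key : ∀ (n : ℕ) (σ : Fin n ≃ Fin x'.len) (ρ : (P.ops y (x'.pull σ)).M),
        F x' (P.act y (x'.pullHom σ) ρ) =
          wtMap (P.hat.obj C) (x'.pullHom σ) (F (x'.pull σ) ρ) := by
      intro n σ ρ
      refine P.wt_hat_ext fun z b κ hκ => ?_
      have hκ' : ∀ i, κ (σ i) ∈ (P.ops (x'.col (σ i)) (z (σ i))).deg (b (σ i)) := fun i => hκ _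
      -- Up to the Koszul sign, `κ` is the image of the permuted family `κ ∘ σ`. This brings the
      -- claim into the form of the equivariance of `Δ f`, which enters as `h1`.
      have e1 : P.permTens x' σ z (pure (A := fun i => P.ops (x'.col (σ i)) (z (σ i)))
          fun i => κ (σ i)) = sg k (permSign σ fun i => c.ε (b (σ i))) •
            pure (A := fun i => P.ops (x'.col i) (z i)) κ := by
        refine (permMap_pure _ _ hκ').trans (congrArg (_ • ·) (congrArg pure ?_))
        funext j
        obtain ⟨i, rfl⟩ := σ.surjective j
        rw [Equiv.piCongrLeft_apply_apply]
        rfl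
      have e2 := congrArg (sg k (permSign σ fun i => c.ε (b (σ i))) • ·) e1
      simp only [smul_smul, sg_mul_self, one_smul] at e2
      rw [hF _ _ _ _ _ hκ, ← e2, map_smul, map_smul, map_smul, map_smul]
      refine congrArg (_ • ·) ?_
      have h1 := (((P.diagMap C y).f p).hom ⟨f, hf⟩).2.2.2 x' n σ z ρ
        (pure (A := fun i => P.ops (x'.col (σ i)) (z (σ i))) fun i => κ (σ i))
      refine h1.trans ?_
      have h2 := pairTens_permMap σ (ev := fun i => P.ev C (x'.col (σ i)) (z (σ i)))
          (ev' := fun i => P.ev C (x'.col i) (z i))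
          (φ := fun i => colMap (P.hat.obj C) ((x'.pullHom σ).2 i).symm) (ψ := fun i => LinearMap.id)
          (χ := fun i => LinearMap.id) (fun i => P.ev_isPairing C _ _)
          (fun i => colMap_isHom _ _) (fun i => GMod.IsHom.id _)
          (fun i g a => congrArg (fun g => P.ev C (x'.col (σ i)) (z (σ i)) g a)
            (colMap_rfl (P.hat.obj C) ((x'.pullHom σ).2 i).symm g)) (F (x'.pull σ) ρ)
          (pure (A := fun i => P.ops (x'.col (σ i)) (z (σ i))) fun i => κ (σ i))
      refine Eq.trans ?_ h2.symm
      exact congrArg (permMap (A := fun i => wt C (z (σ i))) (B := fun i => wt C (z i)) σ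
        fun _ => LinearMap.id) (hF (x'.pull σ) ρ (fun i => z (σ i))
        (fun i => b (σ i)) (fun i => κ (σ i)) hκ').symm
    obtain ⟨n, col⟩ := x
    obtain ⟨σ, hσ⟩ := e
    change Fin n ≃ Fin x'.len at σ
    obtain rfl : col = x'.col ∘ σ := funext fun i => (hσ i).symm
    exact key n σ ρ
  · funext w z
    refine LinearMap.ext fun ρ => tens_ext fun b κ hκ => ?_
    exact hF w ρ z b κ hκ

end

end Operad

end Representative

/-! ## Contractions of representative elements -/

section Contractions

open Word

/-- The parity in slot `i` is free, and is used to match the parity of a given total degree. -/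
lemma exists_parities {n : ℕ} (η : Fin n → ℤˣ) (i : Fin n) (u : ℤˣ) :
    ∃ η' : Fin n → ℤˣ, (∀ j, j ≠ i → η' j = η j) ∧ ∏ j, η' j = u := by
  refine ⟨Function.update η i (u * (∏ j ∈ Finset.univ.erase i, η j)⁻¹),
    fun j hj => Function.update_of_ne hj _ _, ?_⟩
  rw [Finset.prod_update_of_mem (Finset.mem_univ i), Finset.sdiff_singleton_eq_erase,
    inv_mul_cancel_right]

lemma sign_cancel {a b s t : ℤˣ} (h : a * b * s = 1) : a * (b * (t * s)) = t := by
  revert a b s t; decide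

namespace Operad

/-! ### Associativity with prescribed inputs, and its contraction to one slot. -/

variable {X : Type u} (P : Operad k c X)

/-- Homogeneous operations with outputs the letters of the word `w`. -/
structure Inputs (w : Word X) where
  word : Fin w.len → Word X
  op : ∀ l, (P.ops (w.col l) (word l)).M
  deg : Fin w.len → I
  mem : ∀ l, op l ∈ (P.ops (w.col l) (word l)).deg (deg l)

/-- The units. -/
def units (w : Word X) : P.Inputs w where
  word l := single (w.col l)
  op l := P.unit (w.col l)
  deg _ := 0
  mem _ := P.unit_mem _

variable {P}

/-- The tensor product of a family of operations. -/
def Inputs.tensor {w : Word X} (D : P.Inputs w) : (P.opsTens w D.word).M := pure D.op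

lemma Inputs.tensor_mem {w : Word X} (D : P.Inputs w) :
    D.tensor ∈ (P.opsTens w D.word).deg (∑ l, D.deg l) := pure_mem D.mem

variable {C : X → Cplx k c} {y : X} {p : I} {f : ∀ x, (P.ops y x).M →ₗ[k] (wt C x).M}
  {g : ∀ x, (P.ops y x).M →ₗ[k] (wt (P.hat.obj C) x).M}

/-- Associativity on pure tensors. The sign comes from moving each tensor of inputs next to the
operation that it is composed with. -/
lemma pairTens_evWt_tensor (hf : f ∈ (P.hatSp C y).deg p) (h : P.laxL C y g = P.diagL C y f)
    (x : Word X) (z : Fin x.len → Word X) (μ : (P.ops y x).M)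
    {n : Fin x.len → I} {ν : ∀ j, (P.ops (x.col j) (z j)).M}
    (hν : ∀ j, ν j ∈ (P.ops (x.col j) (z j)).deg (n j)) (D : ∀ j, P.Inputs (z j)) :
    pairTens (fun j => P.evWt C (z j) (D j).word)
      (unflat (P.hat.obj C) x z (g (concat x z) (P.comp y x z μ (pure ν))))
      (pure (A := fun j => P.opsTens (z j) (D j).word) fun j => (D j).tensor) =
    sg k (shuffleSign (fun j => c.ε (n j)) fun j => c.ε (∑ l, (D j).deg l)) •
      tensMap (A := fun j => wt C (concat (z j) (D j).word))
        (B := fun j => wtTens C (z j) (D j).word) (fun j => unflat C (z j) (D j).word)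
        (P.evWt C x (fun j => concat (z j) (D j).word) (g x μ)
          (pure (A := fun j => P.ops (x.col j) (concat (z j) (D j).word))
            fun j => P.comp (x.col j) (z j) (D j).word (ν j) (D j).tensor)) := by
  have h1 := unflat_comp_comp hf h x z (fun j => (D j).word) μ (pure ν)
    (pure (A := flatFam (m := fun j => (z j).len) fun j l => P.ops ((z j).col l) ((D j).word l))
      (flat (m := fun j => (z j).len)
        (A := fun j l => P.ops ((z j).col l) ((D j).word l)) fun j l => (D j).op l))
  have h2 := unflatG_pure (m := fun j => (z j).len)
    (A := fun j l => P.ops ((z j).col l) ((D j).word l)) fun j l => (D j).op l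
  rw [h2] at h1
  refine h1.symm.trans ?_
  have h3 := pairTens_pure (fun j => P.comp (x.col j) (z j) (D j).word) hν
    fun j => (D j).tensor_mem
  refine (congrArg (fun t => tensMap (A := fun j => wt C (concat (z j) (D j).word))
    (B := fun j => wtTens C (z j) (D j).word) (fun j => unflat C (z j) (D j).word)
      (unflat C x (fun j => concat (z j) (D j).word) (f _ (P.comp y x _ μ t)))) h3).trans ?_
  rw [evWt_of_lax h]
  simp only [map_smul]

/-- Both sides of `pairTens_evWt_tensor` are contracted in all slots but `i`. The inputs in these
slots have total degree zero, as is the case for units; this makes the resulting sign independent of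
the inputs in slot `i`. -/
lemma evWt_tensContr (hf : f ∈ (P.hatSp C y).deg p) (hg : g ∈ (P.hatSp (P.hat.obj C) y).deg p)
    (h : P.laxL C y g = P.diagL C y f) (x : Word X) (z : Fin x.len → Word X) {m : I}
    {μ : (P.ops y x).M} (hμ : μ ∈ (P.ops y x).deg m) {n : Fin x.len → I}
    {ν : ∀ j, (P.ops (x.col j) (z j)).M} (hν : ∀ j, ν j ∈ (P.ops (x.col j) (z j)).deg (n j))
    (D : ∀ j, P.Inputs (z j)) (i : Fin x.len) {d : Fin x.len → I}
    {ψ : ∀ j, (wtTens C (z j) (D j).word).M →ₗ[k] k}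
    (hψ : ∀ j, j ≠ i → (wtTens C (z j) (D j).word).IsFunctional (d j) (ψ j))
    (hD : ∀ j, j ≠ i → ∑ l, (D j).deg l = 0) {η : Fin x.len → ℤˣ}
    (hη : ∀ j, j ≠ i → η j = c.ε (d j - n j)) (hp : ∏ j, η j = c.ε (p + m)) :
    P.evWt C (z i) (D i).word
      (tensContr (A := fun j => wt (P.hat.obj C) (z j)) i
        (fun j => ψ j ∘ₗ (P.evWt C (z j) (D j).word).flip (D j).tensor)
        (unflat (P.hat.obj C) x z (g (concat x z) (P.comp y x z μ (pure ν))))) (D i).tensor =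
    sg k (shuffleSign η fun j => c.ε (n j)) •
      unflat C (z i) (D i).word (P.ev C (x.col i) (concat (z i) (D i).word)
        (tensContr (A := fun j => tot (P.hat.obj C (x.col j))) i
          (fun j => (ψ j ∘ₗ unflat C (z j) (D j).word) ∘ₗ
            (P.ev C (x.col j) (concat (z j) (D j).word)).flip
              (P.comp (x.col j) (z j) (D j).word (ν j) (D j).tensor)) (g x μ))
        (P.comp (x.col i) (z i) (D i).word (ν i) (D i).tensor)) := by
  let β : Fin x.len → I := fun j => ∑ l, (D j).deg l
  have hG : unflat (P.hat.obj C) x z (g (concat x z) (P.comp y x z μ (pure ν))) ∈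
      (tens fun j => wt (P.hat.obj C) (z j)).deg (p + (m + ∑ j, n j)) :=
    (unflat_isHom _ x z).deg _ _ (hg.1 _ _ _ ((P.comp_isPairing y x z).deg _ _ _ hμ _ (pure_mem hν)))
  -- The parities of the factors of `g (μ ∘ ν)` selected by the functionals, completed in slot `i`
  -- so as to match the total degree.
  obtain ⟨η₁, hη₁, hp₁⟩ := exists_parities (fun j => c.ε (d j - β j)) i (c.ε (p + (m + ∑ j, n j)))
  have e1 := tensContr_pairTens (fun j => P.evWt_isPairing C (z j) (D j).word) i hψ
    (fun j => (D j).tensor_mem) hG hη₁ hp₁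
  have hν' : ∀ j, P.comp (x.col j) (z j) (D j).word (ν j) (D j).tensor ∈
      (P.ops (x.col j) (concat (z j) (D j).word)).deg (n j + β j) := fun j =>
    (P.comp_isPairing _ _ _).deg _ _ _ (hν j) _ (D j).tensor_mem
  have e2 := tensContr_pairTens (G := fun j => tot (P.hat.obj C (x.col j)))
    (fun j => P.ev_isPairing C (x.col j) (concat (z j) (D j).word)) i
    (d := d) (ψ := fun j => ψ j ∘ₗ unflat C (z j) (D j).word)
    (fun j hj => (hψ j hj).comp (unflat_isHom C (z j) (D j).word)) hν' (hg.1 x m μ hμ)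
    (η := η) (fun j hj => by
      have : β j = 0 := hD j hj
      rw [hη j hj, this, add_zero]) hp
  have e3 := congrArg (tensContr (A := fun j => wtTens C (z j) (D j).word) i ψ)
    (pairTens_evWt_tensor hf h x z μ hν D)
  rw [map_smul] at e3
  have e4 := tensContr_tensMap (A := fun j => wt C (concat (z j) (D j).word))
    (B := fun j => wtTens C (z j) (D j).word) i ψ (fun j => unflat C (z j) (D j).word)
    (P.evWt C x (fun j => concat (z j) (D j).word) (g x μ)
          (pure (A := fun j => P.ops (x.col j) (concat (z j) (D j).word))
            fun j => P.comp (x.col j) (z j) (D j).word (ν j) (D j).tensor))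
  have e5 := e1.symm.trans (e3.trans (congrArg (_ • ·) (e4.trans
    ((congrArg (unflat C (z i) (D i).word) e2).trans (map_smul _ _ _)))))
  have e6 := congrArg (sg k (shuffleSign η₁ fun j => c.ε (∑ l, (D j).deg l)) • ·) e5
  simp only [smul_smul, ← map_mul, Int.units_mul_self, map_one, one_smul] at e6
  refine e6.trans (congrArg (sg k · • _) ?_)
  have hβ : ∀ j, j ≠ i → c.ε (β j) = 1 := fun j hj =>
    (congrArg c.ε (hD j hj)).trans c.ε_zero
  have e7 : shuffleSign η (fun j => c.ε (n j + β j)) =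
      shuffleSign η (fun j => c.ε (n j)) * shuffleSign η fun j => c.ε (β j) := by
    rw [← shuffleSign_mul_right]
    exact congrArg (shuffleSign η) (funext fun j => c.ε_add _ _)
  -- For `j ≠ i` both `η₁ j` and `c.ε (n j) * η j` are the parity of `d j`, and `β j` is even. So
  -- only slot `i` can be odd on either side, and no pair contributes.
  have e8 : shuffleSign (fun j => η₁ j * c.ε (n j) * η j) (fun j => c.ε (β j)) = 1 := by
    refine shuffleSign_eq_one i (fun j hj => ?_) hβ
    have : β j = 0 := hD j hj
    rw [hη₁ j hj, hη j hj, this, sub_zero, mul_assoc, mul_comm (c.ε (n j)), ε_sub_mul,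
      Int.units_mul_self]
  rw [shuffleSign_mul_left, shuffleSign_mul_left] at e8
  rw [e7]
  exact sign_cancel e8

/-- The right unit law in the form needed for the contracted slots: evaluating at `ν` composed with
units amounts to evaluating at `ν`. -/
lemma wtOne_unflat_ev_units (w : Word X) (ν : (P.ops y w).M) (t : (tot (P.hat.obj C y)).M) :
    tensMap (A := fun l => wt C (single (w.col l))) (fun l => wtOne C (w.col l))
      (unflat C w (P.units w).word (P.ev C y _ t (P.comp y w _ ν (P.units w).tensor))) =
      P.ev C y w t ν := by
  refine (unflat_concatLetters C w _).trans ?_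
  refine (P.ev_act C y (concatLetters w) t _).symm.trans ?_
  exact congrArg (P.ev C y w t) (P.comp_unit y w ν)

/-! ### Detectors, and representativity of contractions. -/

variable (P) in
/-- The functional `h ↦ ψ (h ν)` on `P^∧(C)^y`, for an operation `ν` and a functional `ψ`. -/
structure Detector (C : X → Cplx k c) (y : X) where
  word : Word X
  op : (P.ops y word).M
  opDeg : I
  op_mem : op ∈ (P.ops y word).deg opDeg
  deg : I
  functional : (wt C word).M →ₗ[k] k
  isFunctional : (wt C word).IsFunctional deg functional

/-- The functional defined by a detector. -/
def Detector.toFun (E : P.Detector C y) : (tot (P.hat.obj C y)).M →ₗ[k] k :=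
  E.functional ∘ₗ (P.ev C y E.word).flip E.op

lemma Detector.toFun_isFunctional (E : P.Detector C y) :
    (tot (P.hat.obj C y)).IsFunctional (E.deg - E.opDeg) E.toFun :=
  E.isFunctional.flip (P.ev_isPairing C y E.word) E.op_mem

lemma exists_detector {φ : (tot (P.hat.obj C y)).M →ₗ[k] k}
    (h : φ ∈ detectors fun x => P.ev C y x) : ∃ E : P.Detector C y, φ = E.toFun := by
  obtain ⟨w, n, a, d, ψ, ha, hψ, rfl⟩ := h
  exact ⟨⟨w, a, n, ha, d, ψ, hψ⟩, rfl⟩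

/-- The element `t` is, up to sign, the contraction of `g (μ ∘ ν)`, where `ν` consists of the
operations of the detectors, against evaluation at units followed by the functionals of the
detectors. Associativity with units in the slots `j ≠ i` and `D` in slot `i` identifies its
evaluations with those of `s`. It is essential that `t` does not depend on `D`. -/
lemma exists_evWt_eq (hf : f ∈ (P.hatSp C y).deg p) (hg : g ∈ (P.hatSp (P.hat.obj C) y).deg p)
    (h : P.laxL C y g = P.diagL C y f) (x : Word X) {m : I}
    {μ : (P.ops y x).M} (hμ : μ ∈ (P.ops y x).deg m)
    (E : ∀ j, P.Detector C (x.col j)) (i : Fin x.len) {q : I}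
    (hq : q = p + m - ∑ j ∈ Finset.univ.erase i, ((E j).deg - (E j).opDeg))
    {s : (tot (P.hat.obj C (x.col i))).M}
    (hs : tensContr (A := fun j => tot (P.hat.obj C (x.col j))) i (fun j => (E j).toFun) (g x μ) =
      s) :
    ∃ t ∈ (wt (P.hat.obj C) (E i).word).deg (q + (E i).opDeg),
      ∀ D : P.Inputs (E i).word, P.evWt C (E i).word D.word t D.tensor =
        unflat C (E i).word D.word (P.ev C (x.col i) (concat (E i).word D.word) s
          (P.comp (x.col i) (E i).word D.word (E i).op D.tensor)) := by
  let G : (tens fun j => wt (P.hat.obj C) (E j).word).M :=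
    unflat (P.hat.obj C) x (fun j => (E j).word) (g (concat x fun j => (E j).word) (P.comp y x (fun j => (E j).word) μ (pure fun j => (E j).op)))
  have hG : G ∈ (tens fun j => wt (P.hat.obj C) (E j).word).deg (p + (m + ∑ j, (E j).opDeg)) :=
    (unflat_isHom _ x fun j => (E j).word).deg _ _ (hg.1 _ _ _ ((P.comp_isPairing y x fun j => (E j).word).deg _ _ _ hμ _
      (pure_mem fun j => (E j).op_mem)))
  -- Evaluation at units yields tensors over one-letter words; `wtOne` brings them back to where the
  -- functional of the detector is defined.
  let ψ j : (wtTens C (E j).word (P.units (E j).word).word).M →ₗ[k] k := (E j).functional ∘ₗ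
    tensMap (A := fun l => wt C (single ((E j).word.col l))) fun l => wtOne C ((E j).word.col l)
  have hψ : ∀ j, (wtTens C (E j).word (P.units (E j).word).word).IsFunctional (E j).deg (ψ j) := fun j =>
    (E j).isFunctional.comp (tensMap_isHom fun l => wtOne_isHom C _)
  let Φ j : (wt (P.hat.obj C) (E j).word).M →ₗ[k] k :=
    ψ j ∘ₗ (P.evWt C (E j).word (P.units (E j).word).word).flip (P.units (E j).word).tensor
  have hu : ∀ j, ∑ l, (P.units (E j).word).deg l = 0 := fun j => Finset.sum_const_zero
  have hΦ : ∀ j, (wt (P.hat.obj C) (E j).word).IsFunctional (E j).deg (Φ j) := by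
    intro j
    have h1 := (hψ j).flip (P.evWt_isPairing C (E j).word _) (P.units (E j).word).tensor_mem
    rwa [hu j, sub_zero] at h1
  obtain ⟨η, hη, hη'⟩ := exists_parities (fun j => c.ε ((E j).deg - (E j).opDeg)) i (c.ε (p + m))
  let t : (wt (P.hat.obj C) (E i).word).M := tensContr (A := fun j => wt (P.hat.obj C) (E j).word) i Φ G
  have ht : t ∈ (wt (P.hat.obj C) (E i).word).deg (q + (E i).opDeg) := by
    have h1 : t ∈ (wt (P.hat.obj C) (E i).word).deg _ :=
      tensContr_mem (A := fun j => wt (P.hat.obj C) (E j).word) (fun j _ => hΦ j) hG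
    have h2 : p + (m + ∑ j, (E j).opDeg) - ∑ j ∈ Finset.univ.erase i, (E j).deg =
        q + (E i).opDeg := by
      rw [← Finset.add_sum_erase _ _ (Finset.mem_univ i), hq, Finset.sum_sub_distrib]
      abel
    exact h2 ▸ h1
  -- The sign from the contraction depends only on the detectors, `p` and `m`, and is absorbed into
  -- the witness.
  refine ⟨sg k (shuffleSign η fun j => c.ε (E j).opDeg) • t, Submodule.smul_mem _ _ ht,
    fun D => ?_⟩
  · let D' : ∀ j, P.Inputs (E j).word := Function.update (fun j => P.units (E j).word) i D
    have hD' : ∀ j, j ≠ i → D' j = P.units (E j).word := fun j hj => Function.update_of_ne hj _ _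
    have hi : D' i = D := Function.update_self _ _ _
    -- The type of the functional depends on `D' j`, which reduces to the units only for `j ≠ i`.
    -- Hence the choice is made slot by slot, with an arbitrary value in slot `i`, where nothing is
    -- contracted.
    have ex : ∀ j, ∃ ψ' : (wtTens C (E j).word (D' j).word).M →ₗ[k] k, j ≠ i →
        (wtTens C (E j).word (D' j).word).IsFunctional (E j).deg ψ' ∧
        ψ' ∘ₗ (P.evWt C (E j).word (D' j).word).flip (D' j).tensor = Φ j ∧
        (ψ' ∘ₗ unflat C (E j).word (D' j).word) ∘ₗ
            (P.ev C (x.col j) (concat (E j).word (D' j).word)).flip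
              (P.comp (x.col j) (E j).word (D' j).word (E j).op (D' j).tensor) = (E j).toFun := by
      intro j
      by_cases hj : j = i
      · exact ⟨0, fun h => (h hj).elim⟩
      · rw [hD' j hj]
        refine ⟨ψ j, fun _ => ⟨hψ j, rfl, LinearMap.ext fun t => ?_⟩⟩
        exact congrArg (E j).functional (wtOne_unflat_ev_units (E j).word (E j).op t)
    choose ψ' hψ' using ex
    have key := evWt_tensContr hf hg h x (fun j => (E j).word) hμ (fun j => (E j).op_mem) D' i
      (fun j hj => (hψ' j hj).1) (fun j hj => by rw [hD' j hj]; exact hu j) hη hη'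
    rw [tensContr_congr (A := fun j => wt (P.hat.obj C) (E j).word) fun j hj => (hψ' j hj).2.1,
      tensContr_congr (A := fun j => tot (P.hat.obj C (x.col j))) fun j hj => (hψ' j hj).2.2,
      hs, hi] at key
    have key' := congrArg (sg k (shuffleSign η fun j => c.ε (E j).opDeg) • ·) key
    simp only [smul_smul, sg_mul_self, one_smul] at key'
    rw [map_smul, LinearMap.smul_apply]
    exact key'

/-- If `α g = Δ f`, then the contractions of `g μ` with detectors are representative. -/
lemma tensContr_isRepresentative (hf : f ∈ (P.hatSp C y).deg p)
    (hg : g ∈ (P.hatSp (P.hat.obj C) y).deg p)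
    (h : P.laxL C y g = P.diagL C y f) (x : Word X) {m : I}
    {μ : (P.ops y x).M} (hμ : μ ∈ (P.ops y x).deg m)
    (E : ∀ j, P.Detector C (x.col j)) (i : Fin x.len) :
    ∃ q, ∃ h' : (P.hatSp C (x.col i)).deg q,
      tensContr (A := fun j => tot (P.hat.obj C (x.col j))) i (fun j => (E j).toFun) (g x μ) =
        ι (P.hat.obj C (x.col i)) q h' ∧ P.IsRepresentative C (x.col i) q h' := by
  have h1 := tensContr_mem (A := fun j => tot (P.hat.obj C (x.col j))) (i := i)
    (fun j _ => (E j).toFun_isFunctional) (hg.1 x m μ hμ)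
  obtain ⟨h', hh⟩ := h1
  refine ⟨_, h', hh.symm, ?_⟩
  refine isRepresentative_of_forall h'.2 fun w r ρ hρ => ?_
  -- Slot `i` only has to supply the operation `ρ`; its functional is never applied and is taken to
  -- be zero.
  let E' : ∀ j, P.Detector C (x.col j) := Function.update E i ⟨w, ρ, r, hρ, 0, 0, fun _ _ _ _ => rfl⟩
  have hE' : ∀ j, j ≠ i → E' j = E j := fun j hj => Function.update_of_ne hj _ _
  have hi : E' i = ⟨w, ρ, r, hρ, 0, 0, fun _ _ _ _ => rfl⟩ := Function.update_self _ _ _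
  have key := exists_evWt_eq hf hg h x hμ E' i
    (q := p + m - ∑ j ∈ Finset.univ.erase i, ((E j).deg - (E j).opDeg))
    (by
      refine congrArg _ (Finset.sum_congr rfl fun j hj => ?_)
      rw [hE' j (Finset.ne_of_mem_erase hj)])
    ((LinearMap.congr_fun (tensContr_congr (A := fun j => tot (P.hat.obj C (x.col j)))
      fun j hj => by rw [hE' j hj]) (g x μ)).trans hh.symm)
  rw [hi] at key
  dsimp only at key
  obtain ⟨t, ht, ht'⟩ := key
  refine ⟨t, ht, fun z b κ hκ => (ht' ⟨z, κ, b, hκ⟩).trans ?_⟩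
  exact congrArg (unflat C w z) (LinearMap.congr_fun (P.ev_ι C (x.col i) (w.concat z) _ h')
    (P.comp (x.col i) w z ρ (pure κ)))

end Operad

end Contractions

/-! ## Degreewise injective maps -/

section Injective

variable {X : Type u}

/-- Maps which are injective in each colour and degree. -/
def DegInj {A B : X → Cplx k c} (m : A ⟶ B) : Prop :=
  ∀ y p, Function.Injective ((m y).f p).hom

lemma DegInj.mono {A B : X → Cplx k c} {m : A ⟶ B} (hm : DegInj m) : Mono m := by
  refine ⟨fun {T} g h e => ?_⟩
  funext y
  ext p t
  refine hm y p ?_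
  exact LinearMap.congr_fun (congrArg (fun φ : T ⟶ B => ((φ y).f p).hom) e) t

/-- Preimages under `m` are unique, so choosing them is linear and commutes with the differentials.
-/
lemma exists_factorization {A B T : X → Cplx k c} {m : A ⟶ B} (hm : DegInj m) (f : T ⟶ B)
    (h : ∀ y p t, ∃ a, ((m y).f p).hom a = ((f y).f p).hom t) : ∃ f' : T ⟶ A, f' ≫ m = f := by
  let φ : ∀ y p, (T y).X p →ₗ[k] (A y).X p := fun y p =>
    (LinearEquiv.ofInjective _ (hm y p)).symm.toLinearMap ∘ₗ
      ((f y).f p).hom.codRestrict (LinearMap.range ((m y).f p).hom) (h y p)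
  have hφ : ∀ y p t, ((m y).f p).hom (φ y p t) = ((f y).f p).hom t := fun y p t =>
    congrArg Subtype.val ((LinearEquiv.ofInjective _ (hm y p)).apply_symm_apply
      (((f y).f p).hom.codRestrict (LinearMap.range ((m y).f p).hom) (h y p) t))
  refine ⟨fun y => { f := fun p => ModuleCat.ofHom (φ y p), comm' := fun p q _ => ?_ }, ?_⟩
  · ext t
    refine hm y q ?_
    have h1 := LinearMap.congr_fun (congrArg ModuleCat.Hom.hom ((m y).comm p q)) (φ y p t)
    have h2 := LinearMap.congr_fun (congrArg ModuleCat.Hom.hom ((f y).comm p q)) t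
    refine h1.symm.trans ?_
    refine (congrArg ((B y).d p q).hom (hφ y p t)).trans (h2.trans ?_)
    exact (hφ y q _).symm
  · funext y
    ext p t
    exact hφ y p t

/-- A degreewise injective map has a linear retraction of degree zero on total spaces. -/
lemma DegInj.exists_retraction {A B : X → Cplx k c} {m : A ⟶ B} (hm : DegInj m) (y : X) :
    ∃ r : (tot (B y)).M →ₗ[k] (tot (A y)).M, (∀ p, ∀ b ∈ (tot (B y)).deg p, r b ∈ (tot (A y)).deg p) ∧
      r ∘ₗ totMap (m y) = LinearMap.id := by
  have h : ∀ p, ∃ r : (B y).X p →ₗ[k] (A y).X p, r ∘ₗ ((m y).f p).hom = LinearMap.id := fun p =>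
    LinearMap.exists_leftInverse_of_injective _ (LinearMap.ker_eq_bot.2 (hm y p))
  choose r hr using h
  let R : (tot (B y)).M →ₗ[k] (tot (A y)).M :=
    DirectSum.toModule k I _ fun p => ι (A y) p ∘ₗ r p
  have hι : ∀ p b, R (ι (B y) p b) = ι (A y) p (r p b) := fun p b => DirectSum.toModule_lof _ _ _
  refine ⟨R, ?_, tot_ext fun p a => ?_⟩
  · rintro p _ ⟨b, rfl⟩
    exact ⟨r p b, (hι p b).symm⟩
  · refine (congrArg R (totMap_ι (m y) p a)).trans ((hι p _).trans ?_)
    exact congrArg (ι (A y) p) (LinearMap.congr_fun (hr p) a)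

lemma tensMap_mem {n : ℕ} {A B : Fin n → GMod k c} {φ : ∀ i, (A i).M →ₗ[k] (B i).M}
    (hφ : ∀ i p, ∀ a ∈ (A i).deg p, φ i a ∈ (B i).deg p) {p : I} {t : (tens A).M}
    (ht : t ∈ (tens A).deg p) : tensMap φ t ∈ (tens B).deg p := by
  refine mem_tens_induction ht (((tens B).deg p).comap (tensMap φ)) ?_
  rintro q a ha rfl
  rw [Submodule.mem_comap, tensMap_pure]
  exact pure_mem fun i => hφ i _ _ (ha i)

/-- Degreewise retractions exist over a field and can be tensored. They need not commute with the
differentials, which is enough for injectivity and for lifting. -/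
lemma DegInj.exists_wt_retraction {A B : X → Cplx k c} {m : A ⟶ B} (hm : DegInj m) (x : Word X) :
    ∃ r : (wt B x).M →ₗ[k] (wt A x).M, (∀ p, ∀ b ∈ (wt B x).deg p, r b ∈ (wt A x).deg p) ∧
      r ∘ₗ wtFun m x = LinearMap.id := by
  choose r hr hr' using hm.exists_retraction
  refine ⟨tensMap fun i => r (x.col i), fun p b hb => tensMap_mem (fun i => hr _) hb, ?_⟩
  refine (tensMap_comp (fun i => totMap (m (x.col i))) fun i => r (x.col i)).symm.trans ?_
  exact (congrArg tensMap (funext fun i => hr' (x.col i))).trans (tensMap_id _)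

lemma DegInj.wtFun_injective {A B : X → Cplx k c} {m : A ⟶ B} (hm : DegInj m) (x : Word X) :
    Function.Injective (wtFun m x) := by
  obtain ⟨r, -, hr⟩ := hm.exists_wt_retraction x
  exact Function.LeftInverse.injective (g := r) (LinearMap.congr_fun hr)

lemma DegInj.tensMap_wtFun_injective {A B : X → Cplx k c} {m : A ⟶ B} (hm : DegInj m) {n : ℕ}
    (z : Fin n → Word X) : Function.Injective
      (tensMap (A := fun i => wt A (z i)) (B := fun i => wt B (z i)) fun i => wtFun m (z i)) := by
  choose r _ hr' using hm.exists_wt_retraction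
  refine Function.LeftInverse.injective (g := tensMap (A := fun i => wt B (z i))
    (B := fun i => wt A (z i)) fun i => r (z i)) (LinearMap.congr_fun (f := tensMap _ ∘ₗ tensMap _)
    (g := LinearMap.id) ?_)
  refine (tensMap_comp (A := fun i => wt A (z i)) (B := fun i => wt B (z i))
    (C := fun i => wt A (z i)) (fun i => wtFun m (z i)) fun i => r (z i)).symm.trans ?_
  exact (congrArg tensMap (funext fun i => hr' (z i))).trans (tensMap_id _)

/-! ### Injectivity of `α` and of the maps induced on `P^∧` and `P^∧₂`. -/

namespace Operad

variable (P : Operad k c X)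

lemma degInj_hat_map {A B : X → Cplx k c} {m : A ⟶ B} (hm : DegInj m) : DegInj (P.hat.map m) := by
  intro y p f f' h
  refine Subtype.ext (funext fun x => LinearMap.ext fun a => hm.wtFun_injective x ?_)
  exact LinearMap.congr_fun (congrFun (congrArg Subtype.val h) x) a

lemma degInj_hat₂_map {A B : X → Cplx k c} {m : A ⟶ B} (hm : DegInj m) :
    DegInj (P.hat₂.map m) := by
  intro y p f f' h
  refine Subtype.ext (funext fun x => funext fun z => LinearMap.ext₂ fun a b =>
    hm.tensMap_wtFun_injective z ?_)
  exact LinearMap.congr_fun₂ (congrFun (congrFun (congrArg Subtype.val h) x) z) a b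

lemma laxL_injective (C : X → Cplx k c) (y : X) : Function.Injective (P.laxL C y) := by
  intro g g' h
  refine funext fun x => LinearMap.ext fun a => P.wt_hat_ext fun z b κ _ => ?_
  exact LinearMap.congr_fun₂ (congrFun (congrFun h x) z) a (pure κ)

lemma degInj_lax (C : X → Cplx k c) : DegInj (P.lax.app C) := fun y _ _ _ h =>
  Subtype.ext (P.laxL_injective C y (congrArg Subtype.val h))

variable {P} {C : X → Cplx k c} {y : X} {p : I} {f : ∀ x, (P.ops y x).M →ₗ[k] (wt C x).M}
  {g : ∀ x, (P.ops y x).M →ₗ[k] (wt (P.hat.obj C) x).M}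

/-- The lift is `g` followed by a retraction. The retraction is not assumed natural in the word, but
naturality of the lift follows after applying the injective map `wtFun m`. -/
lemma exists_hatSpMap_eq {A B : X → Cplx k c} {m : A ⟶ B} (hm : DegInj m)
    {g : ∀ x, (P.ops y x).M →ₗ[k] (wt B x).M} (hg : g ∈ (P.hatSp B y).deg p)
    (h : ∀ x μ, g x μ ∈ LinearMap.range (wtFun m x)) :
    ∃ g' ∈ (P.hatSp A y).deg p, P.hatSpMap m y g' = g := by
  choose r hr hr' using hm.exists_wt_retraction
  have key : ∀ x μ, wtFun m x (r x (g x μ)) = g x μ := by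
    intro x μ
    obtain ⟨t, ht⟩ := h x μ
    rw [← ht]
    exact congrArg (wtFun m x) (LinearMap.congr_fun (hr' x) t)
  refine ⟨fun x => r x ∘ₗ g x, ⟨fun x q a ha => hr x _ _ (hg.1 x q a ha), fun x x' e a => ?_⟩,
    funext fun x => LinearMap.ext (key x)⟩
  refine hm.wtFun_injective x' ?_
  refine (key x' _).trans ((hg.2 x x' e a).trans ?_)
  rw [← key x a]
  exact wtMap_wtFun m e _

/-- If `α g = Δ f`, then `g` has values in the tensor powers of the space of representative
elements. -/
lemma mem_range_wtFun_of_lax {A : X → Cplx k c} {m : A ⟶ P.hat.obj C}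
    (hm : ∀ y p h, P.IsRepresentative C y p h → ∃ a, ((m y).f p).hom a = h)
    (hf : f ∈ (P.hatSp C y).deg p) (hg : g ∈ (P.hatSp (P.hat.obj C) y).deg p)
    (h : P.laxL C y g = P.diagL C y f) (x : Word X) (μ : (P.ops y x).M) :
    g x μ ∈ LinearMap.range (wtFun m x) := by
  have hμ : μ ∈ Submodule.span k {a | ∃ p, a ∈ (P.ops y x).deg p} :=
    (P.ops y x).span_deg ▸ Submodule.mem_top
  refine Submodule.span_le (p := (LinearMap.range (wtFun m x)).comap (g x)) |>.2 ?_ hμ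
  rintro μ ⟨q, hμ⟩
  -- The subspaces are the ranges of `m`, the separating functionals are the detectors, and the
  -- contractions are representative.
  refine mem_range_map_of_contr (W := fun j => (tot (P.hat.obj C (x.col j))).M)
    (Φ := fun j => detectors fun w => P.ev C (x.col j) w)
    (fun j => P.separates_ev C (x.col j)) (fun j => totMap (m (x.col j))) fun i φ hφ => ?_
  choose E hE using fun j => exists_detector (hφ j)
  obtain rfl : φ = fun j => (E j).toFun := funext hE
  obtain ⟨q', h', e, hr⟩ := tensContr_isRepresentative hf hg h x hμ E i
  obtain ⟨a, ha⟩ := hm _ _ _ hr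
  refine ⟨ι (A (x.col i)) q' a, ?_⟩
  refine (totMap_ι _ _ _).trans (Eq.trans ?_ e.symm)
  exact congrArg (ι (P.hat.obj C (x.col i)) q') ha

end Operad

end Injective

/-! ## Coassociativity -/

section Coassociativity

open Word

lemma pairTens_tensMap_left {n : ℕ} {G G' A B : Fin n → GMod k c}
    (E : ∀ i, (G' i).M →ₗ[k] (A i).M →ₗ[k] (B i).M) {φ : ∀ i, (G i).M →ₗ[k] (G' i).M}
    (hφ : ∀ i, GMod.IsHom (φ i)) (g : (tens G).M) (a : (tens A).M) :
    pairTens E (tensMap φ g) a = pairTens (fun i => E i ∘ₗ φ i) g a := by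
  have h := pairTens_tensMap (ev := fun i => E i ∘ₗ φ i) (ev' := E) (ψ := fun i => LinearMap.id)
    (χ := fun i => LinearMap.id) hφ (fun i => GMod.IsHom.id (A i)) (fun i g a => rfl) g a
  rwa [tensMap_id, tensMap_id] at h

lemma pairTens_compr₂ {n : ℕ} {G A B B' : Fin n → GMod k c}
    (E : ∀ i, (G i).M →ₗ[k] (A i).M →ₗ[k] (B i).M) (χ : ∀ i, (B i).M →ₗ[k] (B' i).M)
    (g : (tens G).M) (a : (tens A).M) :
    pairTens (fun i => (E i).compr₂ (χ i)) g a = tensMap χ (pairTens E g a) := by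
  have h := pairTens_tensMap (ev := E) (ev' := fun i => (E i).compr₂ (χ i))
    (φ := fun i => LinearMap.id) (ψ := fun i => LinearMap.id) (χ := χ)
    (fun i => GMod.IsHom.id (G i)) (fun i => GMod.IsHom.id (A i)) (fun i g a => rfl) g a
  rwa [tensMap_id, tensMap_id] at h

/-- Compatibility of `pairTens` with associative compositions. -/
lemma pairTens_pairTens {n : ℕ} {G A K L B D : Fin n → GMod k c}
    {e : ∀ i, (G i).M →ₗ[k] (A i).M →ₗ[k] (B i).M} {E : ∀ i, (B i).M →ₗ[k] (K i).M →ₗ[k] (D i).M}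
    {m : ∀ i, (A i).M →ₗ[k] (K i).M →ₗ[k] (L i).M} {F : ∀ i, (G i).M →ₗ[k] (L i).M →ₗ[k] (D i).M}
    (he : ∀ i, IsPairing (e i)) (hm : ∀ i, IsPairing (m i))
    (h : ∀ i q a b, E i (e i q a) b = F i q (m i a b)) (t : (tens G).M) (a : (tens A).M)
    (b : (tens K).M) : pairTens E (pairTens e t a) b = pairTens F t (pairTens m a b) := by
  have h1 : ∀ (p q : Fin n → I) (a : ∀ i, (A i).M) (b : ∀ i, (K i).M),
      (∀ i, a i ∈ (A i).deg (p i)) → (∀ i, b i ∈ (K i).deg (q i)) →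
      (pairTens E).flip (pure b) ∘ₗ (pairTens e).flip (pure a) =
        (pairTens F).flip (pairTens m (pure a) (pure b)) := by
    intro p q a b ha hb
    refine tens_ext fun r t ht => ?_
    rw [LinearMap.comp_apply, LinearMap.flip_apply, LinearMap.flip_apply, LinearMap.flip_apply,
      pairTens_pure e ht ha, pairTens_pure m ha hb, map_smul, map_smul, LinearMap.smul_apply,
      pairTens_pure E (fun i => (he i).deg _ _ _ (ht i) _ (ha i)) hb,
      pairTens_pure F ht (fun i => (hm i).deg _ _ _ (ha i) _ (hb i))]
    simp only [c.ε_add, shuffleSign_mul_left, shuffleSign_mul_right, smul_smul, ← map_mul, h]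
    congr 2
    rw [← mul_assoc, mul_comm]
  have h2 : ∀ (q : Fin n → I) (b : ∀ i, (K i).M), (∀ i, b i ∈ (K i).deg (q i)) →
      (pairTens E).flip (pure b) ∘ₗ pairTens e t = pairTens F t ∘ₗ (pairTens m).flip (pure b) :=
    fun q b hb => tens_ext fun p a ha => LinearMap.congr_fun (h1 p q a b ha hb) t
  have h3 : pairTens E (pairTens e t a) = pairTens F t ∘ₗ pairTens m a :=
    tens_ext fun q b hb => LinearMap.congr_fun (h2 q b hb) a
  exact LinearMap.congr_fun h3 b

lemma IsPairing.comp_left {G G' A B : GMod k c} {E : G'.M →ₗ[k] A.M →ₗ[k] B.M} (hE : IsPairing E)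
    {φ : G.M →ₗ[k] G'.M} (hφ : GMod.IsHom φ) : IsPairing (G := G) (A := A) (B := B) (E ∘ₗ φ) :=
  ⟨fun p q g hg a ha => hE.deg p q _ (hφ.deg p g hg) a ha, fun g a => by
    rw [LinearMap.comp_apply, LinearMap.comp_apply, LinearMap.comp_apply, hE.d, hφ.d, hφ.sgn]⟩

namespace Operad

variable {X : Type u} {P : Operad k c X} {C : X → Cplx k c}

/-- Each factor is itself a tensor power of `P^∧(C)`, separated by evaluation at families of
operations followed by homogeneous functionals; products of these separate the tensor product. -/
lemma wtTens_hat_ext {x : Word X} {z : Fin x.len → Word X} {t t' : (wtTens (P.hat.obj C) x z).M}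
    (h : ∀ D : ∀ j, P.Inputs (z j),
      pairTens (fun j => P.evWt C (z j) (D j).word) t
        (pure (A := fun j => P.opsTens (z j) (D j).word) fun j => (D j).tensor) =
      pairTens (fun j => P.evWt C (z j) (D j).word) t'
        (pure (A := fun j => P.opsTens (z j) (D j).word) fun j => (D j).tensor)) : t = t' := by
  rw [← sub_eq_zero]
  have sep : ∀ j, Separates {φ | ∃ (D : P.Inputs (z j)) (d : I)
      (ψ : (wtTens C (z j) D.word).M →ₗ[k] k), (wtTens C (z j) D.word).IsFunctional d ψ ∧
        φ = ψ ∘ₗ (P.evWt C (z j) D.word).flip D.tensor} := by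
    intro j v hv
    refine P.wt_hat_ext fun w b κ hκ => ?_
    rw [map_zero, LinearMap.zero_apply]
    refine separates_tens (fun _ => separates_wt C _) _ ?_
    rintro ψ ⟨d, hψ⟩
    exact hv _ ⟨⟨w, κ, b, hκ⟩, d, ψ, hψ, rfl⟩
  refine eq_zero_of_contrAll (W := fun j => (wt (P.hat.obj C) (z j)).M) sep fun φ hφ => ?_
  choose D d ψ hψ hφ using hφ
  have h1 := tensContrAll_pairTens (fun j => P.evWt_isPairing C (z j) (D j).word) hψ
    (fun j => (D j).tensor_mem) (t - t')
  rw [map_sub, LinearMap.sub_apply, h D, sub_self, map_zero] at h1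
  obtain rfl : φ = fun j => ψ j ∘ₗ (P.evWt C (z j) (D j).word).flip (D j).tensor := funext hφ
  have h2 := congrArg (sg k (shuffleSign (fun j => c.ε (d j - ∑ l, (D j).deg l))
    fun j => c.ε (∑ l, (D j).deg l)) • ·) h1
  simp only [smul_smul, sg_mul_self, one_smul, smul_zero] at h2
  exact h2.symm

section

variable {A : X → Cplx k c} {χ : A ⟶ P.hat.obj C} {δ₁ : A ⟶ P.hat.obj (P.hat.obj C)}

lemma laxL_eq_diagL (w : χ ≫ P.diag.app C = δ₁ ≫ P.lax.app C) (y : X) (p : I) (a : (A y).X p) :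
    P.laxL C y (((δ₁ y).f p).hom a : (P.hatSp (P.hat.obj C) y).deg p).1 =
      P.diagL C y (((χ y).f p).hom a : (P.hatSp C y).deg p).1 :=
  (congrArg (fun φ : A ⟶ P.hat₂.obj C =>
    (((φ y).f p).hom a : (P.hat₂Sp C y).deg p).1) w).symm

/-- The identity `Δ χ = α δ₁` in terms of values at operations, for arbitrary elements of the total
space. -/
lemma evWt_ev (w : χ ≫ P.diag.app C = δ₁ ≫ P.lax.app C) (y : X) (x : Word X)
    (z : Fin x.len → Word X) (t : (tot (A y)).M) (ν : (P.ops y x).M) (κ : (P.opsTens x z).M) :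
    P.evWt C x z (P.ev (P.hat.obj C) y x (totMap (δ₁ y) t) ν) κ =
      unflat C x z (P.ev C y (concat x z) (totMap (χ y) t) (P.comp y x z ν κ)) := by
  refine LinearMap.congr_fun (f := (P.evWt C x z).flip κ ∘ₗ (P.ev (P.hat.obj C) y x).flip ν ∘ₗ
    totMap (δ₁ y)) (g := unflat C x z ∘ₗ (P.ev C y (concat x z)).flip (P.comp y x z ν κ) ∘ₗ
      totMap (χ y)) (tot_ext fun p a => ?_) t
  have e1 : P.ev (P.hat.obj C) y x (totMap (δ₁ y) (ι (A y) p a)) =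
      (((δ₁ y).f p).hom a : (P.hatSp (P.hat.obj C) y).deg p).1 x :=
    (congrArg (P.ev (P.hat.obj C) y x) (totMap_ι (δ₁ y) p a)).trans
      (P.ev_ι (P.hat.obj C) y x p _)
  have e2 : P.ev C y (concat x z) (totMap (χ y) (ι (A y) p a)) =
      (((χ y).f p).hom a : (P.hatSp C y).deg p).1 (concat x z) :=
    (congrArg (P.ev C y (concat x z)) (totMap_ι (χ y) p a)).trans (P.ev_ι C y _ p _)
  refine (congrArg (fun φ => P.evWt C x z (φ ν) κ) e1).trans ?_
  refine Eq.trans ?_ (congrArg (fun φ => unflat C x z (φ (P.comp y x z ν κ))) e2).symm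
  exact evWt_of_lax (laxL_eq_diagL w y p a) x z ν κ

/-- Both sides are evaluated at `ν` and then at a family `κ` of operations. On the left, `δ₁` turns
the two evaluations in each factor into evaluation of `χ` at a composite `ν_j ∘ κ_j`; on the right,
associativity of `P` does the same. What remains is `P^∧(χ) δ = δ₁`. -/
lemma lax_coassoc (w : χ ≫ P.diag.app C = δ₁ ≫ P.lax.app C) {δ : A ⟶ P.hat.obj A}
    (hδ : δ ≫ P.hat.map χ = δ₁) :
    δ ≫ P.hat.map δ₁ ≫ P.lax.app (P.hat.obj C) = δ₁ ≫ P.diag.app (P.hat.obj C) := by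
  funext y
  ext p a
  refine Subtype.ext (funext fun x => funext fun z => LinearMap.ext fun μ =>
    tens_ext fun n ν hν => wtTens_hat_ext fun D => ?_)
  let s : (P.hatSp A y).deg p := ((δ y).f p).hom a
  let g : (P.hatSp (P.hat.obj C) y).deg p := ((δ₁ y).f p).hom a
  have hs : wtFun χ x (s.1 x μ) = g.1 x μ :=
    congrArg (fun φ : A ⟶ P.hat.obj (P.hat.obj C) =>
      (((φ y).f p).hom a : (P.hatSp (P.hat.obj C) y).deg p).1 x μ) hδ
  have e1 : P.evWt (P.hat.obj C) x z (wtFun δ₁ x (s.1 x μ)) (pure ν) =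
      pairTens (fun i => P.ev (P.hat.obj C) (x.col i) (z i) ∘ₗ totMap (δ₁ (x.col i)))
        (s.1 x μ) (pure ν) :=
    pairTens_tensMap_left (fun i => P.ev (P.hat.obj C) (x.col i) (z i))
      (fun i => totMap_isHom (δ₁ (x.col i))) _ _
  let κ : (tens fun j => P.opsTens (z j) (D j).word).M := pure fun j => (D j).tensor
  let ρ : (tens fun j => P.ops (x.col j) (concat (z j) (D j).word)).M :=
    pairTens (fun j => P.comp (x.col j) (z j) (D j).word) (pure ν) κ
  let F : ∀ j, (tot (A (x.col j))).M →ₗ[k] (P.ops (x.col j) (concat (z j) (D j).word)).M →ₗ[k]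
      (wt C (concat (z j) (D j).word)).M := fun j =>
    P.ev C (x.col j) (concat (z j) (D j).word) ∘ₗ totMap (χ (x.col j))
  have e2 : pairTens (fun j => P.evWt C (z j) (D j).word)
      (pairTens (fun i => P.ev (P.hat.obj C) (x.col i) (z i) ∘ₗ totMap (δ₁ (x.col i)))
        (s.1 x μ) (pure ν)) κ =
      pairTens (fun j => (F j).compr₂ (unflat C (z j) (D j).word)) (s.1 x μ) ρ :=
    pairTens_pairTens
      (fun i => (P.ev_isPairing (P.hat.obj C) (x.col i) (z i)).comp_left (totMap_isHom _))
      (fun j => P.comp_isPairing _ _ _)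
      (fun i q ν κ => evWt_ev w (x.col i) (z i) (D i).word q ν κ) _ _ _
  have e3 : pairTens (fun j => (F j).compr₂ (unflat C (z j) (D j).word)) (s.1 x μ) ρ =
      tensMap (fun j => unflat C (z j) (D j).word) (pairTens F (s.1 x μ) ρ) :=
    pairTens_compr₂ F _ _ _
  have e4 : P.evWt C x (fun j => concat (z j) (D j).word) (wtFun χ x (s.1 x μ)) ρ =
      pairTens F (s.1 x μ) ρ :=
    pairTens_tensMap_left (fun j => P.ev C (x.col j) (concat (z j) (D j).word))
      (fun i => totMap_isHom (χ (x.col i))) _ _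
  have e5 := pairTens_evWt_tensor (((χ y).f p).hom a : (P.hatSp C y).deg p).2
    (laxL_eq_diagL w y p a) x z μ hν D
  have e6 : ρ = _ := pairTens_pure (fun j => P.comp (x.col j) (z j) (D j).word) hν
    fun j => (D j).tensor_mem
  refine (congrArg (fun t => pairTens (fun j => P.evWt C (z j) (D j).word) t κ) e1).trans ?_
  refine (e2.trans e3).trans (Eq.trans ?_ e5.symm)
  rw [← e4, hs, e6, map_smul, map_smul]

end

end Operad

end Coassociativity

/-! ## The cofree coalgebra functor -/

section Cofree

variable {X : Type u}

/-- The subcomplex given by a family of subspaces. -/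
def subCplx (A : Cplx k c) (S : ∀ p, Submodule k (A.X p))
    (hS : ∀ p q a, a ∈ S p → (A.d p q).hom a ∈ S q) : Cplx k c where
  X p := ModuleCat.of k (S p)
  d p q := ModuleCat.ofHom ((A.d p q).hom.restrict (hS p q))
  shape p q h := by
    ext a
    exact LinearMap.congr_fun (congrArg ModuleCat.Hom.hom (A.shape p q h)) a.1
  d_comp_d' p q r _ _ := by
    ext a
    exact LinearMap.congr_fun (congrArg ModuleCat.Hom.hom (A.d_comp_d p q r)) a.1

/-- The inclusion of a subcomplex. -/
def subCplxι (A : Cplx k c) (S : ∀ p, Submodule k (A.X p))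
    (hS : ∀ p q a, a ∈ S p → (A.d p q).hom a ∈ S q) : subCplx A S hS ⟶ A where
  f p := ModuleCat.ofHom (S p).subtype
  comm' p q _ := by ext a; rfl

namespace Operad

variable (P : Operad k c X) (C : X → Cplx k c)

/-- The subspace of representative elements. -/
def repSubmodule (y : X) (p : I) : Submodule k ((P.hat.obj C y).X p) where
  carrier := {f | P.IsRepresentative C y p f}
  add_mem' := by
    rintro f f' ⟨g, hg⟩ ⟨g', hg'⟩
    exact ⟨g + g', by rw [map_add, map_add, hg, hg']⟩
  zero_mem' := ⟨0, by rw [map_zero, map_zero]⟩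
  smul_mem' := by
    rintro r f ⟨g, hg⟩
    exact ⟨r • g, by rw [map_smul, map_smul, hg]⟩

lemma isRepresentative_d {y : X} {p : I} (q : I) {f : (P.hat.obj C y).X p}
    (hf : P.IsRepresentative C y p f) :
    P.IsRepresentative C y q (((P.hat.obj C y).d p q).hom f) := by
  obtain ⟨g, hg⟩ := hf
  refine ⟨((P.hat.obj (P.hat.obj C) y).d p q).hom g, ?_⟩
  have h1 := LinearMap.congr_fun (congrArg ModuleCat.Hom.hom ((P.lax.app C y).comm p q)) g
  have h2 := LinearMap.congr_fun (congrArg ModuleCat.Hom.hom ((P.diag.app C y).comm p q)) f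
  exact h1.symm.trans ((congrArg ((P.hat₂.obj C y).d p q).hom hg).trans h2)

/-- The subobject of representative elements of `P^∧(C)`. -/
def rep : X → Cplx k c := fun y =>
  subCplx (P.hat.obj C y) (P.repSubmodule C y) fun _ q _ h => P.isRepresentative_d C q h

/-- The inclusion of the representative elements. -/
def repι : P.rep C ⟶ P.hat.obj C := fun _ => subCplxι _ _ _

lemma degInj_repι : DegInj (P.repι C) := fun _ _ => Subtype.val_injective

/-- As `α` is injective, the restriction of `Δ` to representative elements factors through it. The
first leg of any cone consists of representative elements by the commutativity of the cone. -/
lemma exists_isPullback_rep : ∃ r, IsPullback (P.repι C) r (P.diag.app C) (P.lax.app C) := by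
  have : Mono (P.lax.app C) := (P.degInj_lax C).mono
  have : Mono (P.repι C) := (P.degInj_repι C).mono
  obtain ⟨r, hr⟩ := exists_factorization (P.degInj_lax C) (P.repι C ≫ P.diag.app C)
    fun y p t => t.2
  have key : ∀ s : Limits.PullbackCone (P.diag.app C) (P.lax.app C),
      ∃ l : s.pt ⟶ P.rep C, l ≫ P.repι C = s.fst := fun s =>
    exists_factorization (P.degInj_repι C) s.fst fun y p t => ⟨⟨((s.fst y).f p).hom t,
      ((s.snd y).f p).hom t, (LinearMap.congr_fun (congrArg
        (fun φ : s.pt ⟶ P.hat₂.obj C => ((φ y).f p).hom) s.condition) t).symm⟩, rfl⟩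
  choose l hl using key
  refine ⟨r, ⟨⟨hr.symm⟩, ⟨Limits.PullbackCone.IsLimit.mk _ l hl (fun s => ?_) fun s l' h _ => ?_⟩⟩⟩
  · rw [← cancel_mono (P.lax.app C), Category.assoc, hr, ← Category.assoc, hl, s.condition]
  · rw [← cancel_mono (P.repι C), h, hl]

/-- Pullbacks of functors are computed pointwise. -/
lemma isPullback_Q₁ :
    IsPullback (P.χ₁.app C) (P.δ₁.app C) (P.diag.app C) (P.lax.app C) :=
  (IsPullback.of_hasPullback P.diag P.lax).map ((evaluation _ _).obj C)

/-- Injectivity on elements is carried over from the explicit model `rep` along the comparison of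
pullbacks. -/
lemma degInj_χ₁ : DegInj (P.χ₁.app C) := by
  obtain ⟨r, hr⟩ := P.exists_isPullback_rep C
  let e := (P.isPullback_Q₁ C).isoIsPullback _ _ hr
  have he : e.hom ≫ P.repι C = P.χ₁.app C := IsPullback.isoIsPullback_hom_fst _ _ _ _
  intro y p a a' h
  rw [← he] at h
  have h1 : ((e.hom y).f p).hom a = ((e.hom y).f p).hom a' := P.degInj_repι C y p h
  have h2 : ∀ a, ((e.inv y).f p).hom (((e.hom y).f p).hom a) = a := fun a =>
    LinearMap.congr_fun (congrArg (fun φ : (P.Q 1).obj C ⟶ (P.Q 1).obj C => ((φ y).f p).hom)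
      e.hom_inv_id) a
  rw [← h2 a, h1, h2]

instance : Mono (P.χ₁.app C) := (P.degInj_χ₁ C).mono

lemma exists_χ₁_iff (y : X) (p : I) (f : (P.hat.obj C y).X p) :
    (∃ q, ((P.χ₁.app C y).f p).hom q = f) ↔ P.IsRepresentative C y p f := by
  constructor
  · rintro ⟨q, rfl⟩
    exact ⟨((P.δ₁.app C y).f p).hom q, (LinearMap.congr_fun (congrArg
      (fun φ : (P.Q 1).obj C ⟶ P.hat₂.obj C => ((φ y).f p).hom) (P.isPullback_Q₁ C).w) q).symm⟩
  · intro hf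
    obtain ⟨r, hr⟩ := P.exists_isPullback_rep C
    let e := (P.isPullback_Q₁ C).isoIsPullback _ _ hr
    have he : e.inv ≫ P.χ₁.app C = P.repι C := IsPullback.isoIsPullback_inv_fst _ _ _ _
    exact ⟨((e.inv y).f p).hom ⟨f, hf⟩, LinearMap.congr_fun (congrArg
      (fun φ : P.rep C ⟶ P.hat.obj C => ((φ y).f p).hom) he) ⟨f, hf⟩⟩

lemma isRepresentativeSubobject : P.IsRepresentativeSubobject := fun C =>
  ⟨P.isPullback_Q₁ C, inferInstance, P.exists_χ₁_iff C⟩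

/-- The values of `δ₁` lie in tensor powers of the representative elements, that is, in the image of
`P^∧(χ₁)`. -/
lemma exists_coaction : ∃ δ : (P.Q 1).obj C ⟶ P.hat.obj ((P.Q 1).obj C),
    δ ≫ P.hat.map (P.χ₁.app C) = P.δ₁.app C := by
  refine exists_factorization (P.degInj_hat_map (P.degInj_χ₁ C)) _ fun y p t => ?_
  let g : (P.hatSp (P.hat.obj C) y).deg p := ((P.δ₁.app C y).f p).hom t
  let f : (P.hatSp C y).deg p := ((P.χ₁.app C y).f p).hom t
  obtain ⟨g', hg', h⟩ := exists_hatSpMap_eq (P.degInj_χ₁ C) g.2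
    (mem_range_wtFun_of_lax (fun y p h => (P.exists_χ₁_iff C y p h).2) f.2 g.2
      (laxL_eq_diagL (P.isPullback_Q₁ C).w y p t))
  exact ⟨⟨g', hg'⟩, Subtype.ext h⟩

instance : Mono (P.hat.map (P.χ₁.app C)) := (P.degInj_hat_map (P.degInj_χ₁ C)).mono

instance : Mono (P.hat₂.map (P.χ₁.app C)) := (P.degInj_hat₂_map (P.degInj_χ₁ C)).mono

/-- The coaction of the cofree coalgebra. -/
def coaction : P.Q 1 ⟶ P.Q 1 ⋙ P.hat where
  app C := (P.exists_coaction C).choose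
  naturality C D f := by
    -- The coaction is chosen for each `C` separately; it is natural because `P^∧(χ₁)` is a
    -- monomorphism and `δ₁` is natural.
    rw [← cancel_mono (P.hat.map (P.χ₁.app D))]
    have hC := (P.exists_coaction C).choose_spec
    have hD := (P.exists_coaction D).choose_spec
    have h1 := P.δ₁.naturality f
    have h2 := P.χ₁.naturality f
    simp only [Functor.comp_map, Category.assoc] at h1 h2 ⊢
    rw [hD, ← Functor.map_comp, h2, Functor.map_comp, reassoc_of% hC, h1]

lemma coaction_χ₁ : P.coaction.app C ≫ P.hat.map (P.χ₁.app C) = P.δ₁.app C :=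
  (P.exists_coaction C).choose_spec

/-- The left unit law of `P`: composing the unit with an operation changes nothing. -/
lemma δ₁_counit : P.δ₁.app C ≫ P.counit.app (P.hat.obj C) = P.χ₁.app C := by
  funext y
  ext p t
  let g : (P.hatSp (P.hat.obj C) y).deg p := ((P.δ₁.app C y).f p).hom t
  let f : (P.hatSp C y).deg p := ((P.χ₁.app C y).f p).hom t
  have h := evalUnit_of_lax f.2 (laxL_eq_diagL (P.isPullback_Q₁ C).w y p t)
  exact (congrArg (cproj (P.hat.obj C y) p) h).trans (cproj_ι (P.hat.obj C y) p f)

/-- The right unit law of `P`; it makes `δ₁` determine `χ₁` and thereby gives uniqueness in the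
universal property. -/
lemma δ₁_map_counit : P.δ₁.app C ≫ P.hat.map (P.counit.app C) = P.χ₁.app C := by
  funext y
  ext p t
  exact Subtype.ext (funext fun x => LinearMap.ext fun μ =>
    wtFun_counit_of_lax (((P.χ₁.app C y).f p).hom t : (P.hatSp C y).deg p).2
      (laxL_eq_diagL (P.isPullback_Q₁ C).w y p t) x μ)

/-- The counit law is tested after `χ₁`, and coassociativity after `P^∧₂(χ₁)`; both are
monomorphisms. -/
lemma isCoalgebra_coaction : P.IsCoalgebra ((P.Q 1).obj C) (P.coaction.app C) where
  counit := by
    have h := P.counit.naturality (P.χ₁.app C)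
    rw [← cancel_mono (P.χ₁.app C), Category.assoc, Category.id_comp]
    refine (congrArg (P.coaction.app C ≫ ·) h.symm).trans ?_
    rw [← Category.assoc, P.coaction_χ₁, P.δ₁_counit]
  coassoc := by
    have h1 := P.lax.naturality (P.χ₁.app C)
    have h2 := P.diag.naturality (P.χ₁.app C)
    have h3 := lax_coassoc (P.isPullback_Q₁ C).w (P.coaction_χ₁ C)
    rw [← cancel_mono (P.hat₂.map (P.χ₁.app C)), Category.assoc, Category.assoc, Category.assoc,
      ← h1, ← h2, Functor.comp_map, ← Functor.map_comp_assoc, P.coaction_χ₁, h3,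
      ← Category.assoc, P.coaction_χ₁]

/-! ### The universal property of `Q_1(C)`. -/

section

variable {P C} {D : X → Cplx k c} {δ : D ⟶ P.hat.obj D}

/-- Coassociativity of `D`, pushed forward along `f` by the naturality of `Δ` and `α`: this is the
cone that induces the map to `Q_1(C)`. -/
lemma coaction_diag (hD : P.IsCoalgebra D δ) (f : D ⟶ C) : (δ ≫ P.hat.map f) ≫ P.diag.app C =
    (δ ≫ P.hat.map (δ ≫ P.hat.map f)) ≫ P.lax.app C := by
  have h1 := P.diag.naturality f
  have h2 := P.lax.naturality f
  rw [Functor.comp_map] at h2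
  rw [Functor.map_comp, Category.assoc, Category.assoc, Category.assoc, h1, h2,
    ← reassoc_of% hD.coassoc]

/-- The morphism to the cofree coalgebra induced by a map. -/
def cofreeLift (hD : P.IsCoalgebra D δ) (f : D ⟶ C) : D ⟶ (P.Q 1).obj C := (P.isPullback_Q₁ C).lift _ _ (coaction_diag hD f)

lemma cofreeLift_χ₁ (hD : P.IsCoalgebra D δ) (f : D ⟶ C) :
    cofreeLift hD f ≫ P.χ₁.app C = δ ≫ P.hat.map f :=
  (P.isPullback_Q₁ C).lift_fst _ _ _

lemma cofreeLift_δ₁ (hD : P.IsCoalgebra D δ) (f : D ⟶ C) :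
    cofreeLift hD f ≫ P.δ₁.app C = δ ≫ P.hat.map (δ ≫ P.hat.map f) :=
  (P.isPullback_Q₁ C).lift_snd _ _ _

/-- After the monomorphism `P^∧(χ₁)` both sides are the second component of the map into the fiber
product. -/
lemma cofreeLift_coaction (hD : P.IsCoalgebra D δ) (f : D ⟶ C) :
    δ ≫ P.hat.map (cofreeLift hD f) = cofreeLift hD f ≫ P.coaction.app C := by
  have h : (P.coaction.app C : (P.Q 1).obj C ⟶ P.hat.obj ((P.Q 1).obj C)) ≫
    P.hat.map (P.χ₁.app C) = P.δ₁.app C := P.coaction_χ₁ C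
  rw [← cancel_mono (P.hat.map (P.χ₁.app C)), Category.assoc, ← Functor.map_comp, cofreeLift_χ₁]
  refine (cofreeLift_δ₁ hD f).symm.trans ?_
  exact (congrArg (cofreeLift hD f ≫ ·) h).symm.trans (Category.assoc _ _ _).symm

lemma cofreeLift_counit (hD : P.IsCoalgebra D δ) (f : D ⟶ C) :
    cofreeLift hD f ≫ P.χ₁.app C ≫ P.counit.app C = f := by
  have h1 : P.hat.map f ≫ P.counit.app C = P.counit.app D ≫ f := P.counit.naturality f
  rw [← Category.assoc, cofreeLift_χ₁, Category.assoc, h1, ← Category.assoc, hD.counit,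
    Category.id_comp]

end

/-- For a coalgebra morphism `g`, the composite `g ≫ χ₁` can be recovered from `g ≫ χ₁ ≫ ε` by
applying `P^∧` and precomposing with the coaction of `D`. -/
lemma eq_of_comp_counit {D : X → Cplx k c} {δ : D ⟶ P.hat.obj D} {g g' : D ⟶ (P.Q 1).obj C}
    (hg : δ ≫ P.hat.map g = g ≫ P.coaction.app C) (hg' : δ ≫ P.hat.map g' = g' ≫ P.coaction.app C)
    (h : g ≫ P.χ₁.app C ≫ P.counit.app C = g' ≫ P.χ₁.app C ≫ P.counit.app C) : g = g' := by
  have key : ∀ g : D ⟶ (P.Q 1).obj C, δ ≫ P.hat.map g = g ≫ P.coaction.app C →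
      g ≫ P.χ₁.app C = δ ≫ P.hat.map (g ≫ P.χ₁.app C ≫ P.counit.app C) := by
    intro g hg
    have h1 : (P.coaction.app C ≫ P.hat.map (P.χ₁.app C)) ≫ P.hat.map (P.counit.app C) =
        P.χ₁.app C := (congrArg (· ≫ P.hat.map (P.counit.app C)) (P.coaction_χ₁ C)).trans
          (P.δ₁_map_counit C)
    rw [Functor.map_comp, Functor.map_comp, ← Category.assoc, hg, Category.assoc]
    refine congrArg (g ≫ ·) (h1.symm.trans ?_)
    exact Category.assoc _ _ _
  rw [← cancel_mono (P.χ₁.app C), key g hg, key g' hg', h]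

lemma isCofree_coaction : IsCofree ⟨(P.Q 1).obj C, P.coaction.app C, P.isCoalgebra_coaction C⟩
    (P.χ₁.app C ≫ P.counit.app C) := by
  unfold IsCofree IsCoalgebraHom
  rintro ⟨D, δ, hD⟩ (f : D ⟶ C)
  dsimp only
  refine ⟨cofreeLift hD f, ⟨cofreeLift_coaction hD f, cofreeLift_counit hD f⟩, ?_⟩
  rintro g ⟨hg, hgf⟩
  exact P.eq_of_comp_counit C hg (cofreeLift_coaction hD f)
      (hgf.trans (cofreeLift_counit hD f).symm)

lemma isCofreeCoalgebraFunctor : P.IsCofreeCoalgebraFunctor :=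
  ⟨P.coaction, NatTrans.ext (funext fun C => P.coaction_χ₁ C),
    fun C => ⟨P.isCoalgebra_coaction C, P.isCofree_coaction C⟩⟩

end Operad

end Cofree

/-! ## The recursion -/

section Recursion

/-! ### Formal argument: a comultiplication makes the recursion stop. -/

section Comultiplication

variable {𝒟 : Type*} [Category 𝒟]

/-- A coassociative comultiplication `d` on a functor `F`, with image `δ` under `χ : F ⟶ G`. -/
structure IsComultiplication {F G : 𝒟 ⥤ 𝒟} (χ : F ⟶ G) (δ : F ⟶ G ⋙ G) (d : F ⟶ F ⋙ F) :
    Prop where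
  comp_hcomp : d ≫ (χ ◫ χ) = δ
  coassoc : ∀ C, d.app C ≫ F.map (d.app C) = d.app C ≫ d.app (F.obj C)

lemma IsComultiplication.app {F G : 𝒟 ⥤ 𝒟} {χ : F ⟶ G} {δ : F ⟶ G ⋙ G} {d : F ⟶ F ⋙ F}
    (h : IsComultiplication χ δ d) (C : 𝒟) :
    δ.app C = d.app C ≫ χ.app (F.obj C) ≫ G.map (χ.app C) := by
  rw [← h.comp_hcomp]
  rfl

/-- Each composite is one of the two iterates of `d` followed by `χ` in all three places, and the
iterates agree by coassociativity. -/
lemma IsComultiplication.equalizes {F G : 𝒟 ⥤ 𝒟} {χ : F ⟶ G} {δ : F ⟶ G ⋙ G} {d : F ⟶ F ⋙ F}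
    (h : IsComultiplication χ δ d) :
    d ≫ ((δ ◫ χ) ≫ (Functor.associator G G G).hom) = d ≫ (χ ◫ δ) := by
  ext C
  have h1 : d.app C ≫ χ.app (F.obj C) ≫ G.map (δ.app C) =
      (d.app C ≫ F.map (d.app C)) ≫ χ.app (F.obj (F.obj C)) ≫ G.map (χ.app (F.obj C)) ≫
        G.map (G.map (χ.app C)) := by
    rw [h.app, Functor.map_comp, Functor.map_comp, ← χ.naturality_assoc, Category.assoc]
    rfl
  have h2 : d.app C ≫ δ.app (F.obj C) ≫ G.map (G.map (χ.app C)) =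
      (d.app C ≫ d.app (F.obj C)) ≫ χ.app (F.obj (F.obj C)) ≫ G.map (χ.app (F.obj C)) ≫
        G.map (G.map (χ.app C)) := by
    simp only [h.app, Category.assoc]
  refine Eq.trans ?_ ((h1.trans ((congrArg (· ≫ _) (h.coassoc C)).trans h2.symm)).trans ?_)
  · exact congrArg (d.app C ≫ ·) (Category.comp_id _)
  · rfl

lemma IsComultiplication.transport {F R : 𝒟 ⥤ 𝒟} {d : F ⟶ F ⋙ F}
    (h : ∀ C, d.app C ≫ F.map (d.app C) = d.app C ≫ d.app (F.obj C)) (x : R ⟶ F) [IsIso x] :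
    IsComultiplication x (x ≫ d) (x ≫ d ≫ (inv x ◫ inv x)) where
  comp_hcomp := by
    rw [Category.assoc, Category.assoc, ← NatTrans.exchange, IsIso.inv_hom_id]
    ext C
    simp
  coassoc C := by
    have hj : ∀ C, (inv x).app C ≫ x.app C = 𝟙 _ := fun C => by simp
    -- Only the identity `hj`, that `y` followed by `x` is the identity, is used below.
    generalize inv x = y at *
    change (x.app C ≫ d.app C ≫ y.app (F.obj C) ≫ R.map (y.app C)) ≫
        R.map (x.app C ≫ d.app C ≫ y.app (F.obj C) ≫ R.map (y.app C)) =
      (x.app C ≫ d.app C ≫ y.app (F.obj C) ≫ R.map (y.app C)) ≫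
        x.app (R.obj C) ≫ d.app (R.obj C) ≫ y.app (F.obj (R.obj C)) ≫ R.map (y.app (R.obj C))
    have hd : F.map (y.app C) ≫ d.app (R.obj C) = d.app (F.obj C) ≫ F.map (F.map (y.app C)) :=
      d.naturality _
    have hl : y.app (F.obj C) ≫ R.map (y.app C) ≫
          R.map (x.app C ≫ d.app C ≫ y.app (F.obj C) ≫ R.map (y.app C)) =
        F.map (d.app C) ≫ y.app (F.obj (F.obj C)) ≫ R.map (y.app (F.obj C) ≫ R.map (y.app C)) := by
      rw [← R.map_comp, ← Category.assoc (y.app C), hj, Category.id_comp, ← y.naturality,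
        F.map_comp, Category.assoc, y.naturality]
      rfl
    have hr : y.app (F.obj C) ≫ R.map (y.app C) ≫
          x.app (R.obj C) ≫ d.app (R.obj C) ≫ y.app (F.obj (R.obj C)) ≫ R.map (y.app (R.obj C)) =
        d.app (F.obj C) ≫ y.app (F.obj (F.obj C)) ≫
          R.map (y.app (F.obj C) ≫ R.map (y.app C)) := by
      rw [← y.naturality_assoc, ← Category.assoc (y.app (R.obj C)), hj, Category.id_comp,
        ← Category.assoc (F.map (y.app C)), hd, Category.assoc, y.naturality_assoc, ← R.map_comp,
        y.naturality]
    simp only [Category.assoc]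
    rw [hl, hr, ← Category.assoc (d.app C), h, Category.assoc]

lemma mono_hcomp_of_isIso {F R : 𝒟 ⥤ 𝒟} (x : R ⟶ F) [IsIso x] : Mono (x ◫ x) := by
  have : (x ◫ x) ≫ (inv x ◫ inv x) = 𝟙 _ := by
    rw [← NatTrans.exchange, IsIso.hom_inv_id]
    ext C
    simp
  exact mono_of_mono_fac this

section Pullback

variable {A B E T : 𝒟} {δ : A ⟶ B} {w : E ⟶ B} {u v : E ⟶ T} {d : A ⟶ E} [Mono w]
  [Limits.HasEqualizer u v] [Limits.HasPullback δ (Limits.equalizer.ι u v ≫ w)]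

/-- The projection is a monomorphism, as a pullback of the composite of an equalizer inclusion with
`w`; the map `d` provides a section. -/
lemma isIso_pullback_fst_of_lift (hd : d ≫ w = δ) (h : d ≫ u = d ≫ v) :
    IsIso (Limits.pullback.fst δ (Limits.equalizer.ι u v ≫ w)) := by
  let f : A ⟶ Limits.pullback δ (Limits.equalizer.ι u v ≫ w) :=
    Limits.pullback.lift (𝟙 _) (Limits.equalizer.lift d h) (by
      rw [Category.id_comp, Limits.equalizer.lift_ι_assoc, hd])
  have hf : f ≫ Limits.pullback.fst _ _ = 𝟙 _ := Limits.pullback.lift_fst _ _ _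
  refine ⟨f, ?_, hf⟩
  rw [← cancel_mono (Limits.pullback.fst δ (Limits.equalizer.ι u v ≫ w)), Category.assoc, hf,
    Category.comp_id, Category.id_comp]

/-- Identifies `δ_{n+2}` with the comultiplication of the previous step precomposed with `χ_{n+2}`,
the form in which the structure is transported. -/
lemma pullback_snd_comp_equalizer_ι (hd : d ≫ w = δ) :
    Limits.pullback.snd δ (Limits.equalizer.ι u v ≫ w) ≫ Limits.equalizer.ι u v =
      Limits.pullback.fst δ (Limits.equalizer.ι u v ≫ w) ≫ d := by
  rw [← cancel_mono w, Category.assoc, Category.assoc, hd, Limits.pullback.condition]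

end Pullback

end Comultiplication

/-! ### Stability of the steps and of the tower. -/

variable {X : Type u}

/-- The condition on a step of the recursion under which the recursion stops. -/
structure Step.IsStable (S : Step k c X) : Prop where
  mono : Mono (S.χ ◫ S.χ)
  exists_comultiplication : ∃ d, IsComultiplication S.χ S.δ d

lemma Step.IsStable.isIso {S : Step k c X} (h : S.IsStable) : IsIso S.next.χ := by
  obtain ⟨d, hd⟩ := h.exists_comultiplication
  have := h.mono
  exact isIso_pullback_fst_of_lift hd.comp_hcomp hd.equalizes

/-- Since `χ` of the next step is an isomorphism, the comultiplication moves along it, and the two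
horizontal composites of `χ` needed next are those of an isomorphism. -/
lemma Step.IsStable.next {S : Step k c X} (h : S.IsStable) : S.next.IsStable := by
  obtain ⟨d, hd⟩ := h.exists_comultiplication
  have := h.mono
  let x : S.next.Q ⟶ S.Q := S.next.χ
  have hx : IsIso x := h.isIso
  have hδ : x ≫ d = S.next.δ := (pullback_snd_comp_equalizer_ι hd.comp_hcomp).symm
  have ht := IsComultiplication.transport hd.coassoc x
  rw [hδ] at ht
  exact ⟨mono_hcomp_of_isIso x, _, ht⟩

namespace Operad

variable (P : Operad k c X)

/-- The comultiplication of the cofree coalgebra functor. -/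
def comult : P.Q 1 ⟶ P.Q 1 ⋙ P.Q 1 where
  app C := cofreeLift (P.isCoalgebra_coaction C) (𝟙 ((P.Q 1).obj C))
  naturality C D f := by
    -- The comultiplication is the coalgebra morphism induced by the identity. After `χ₁` it becomes
    -- the coaction, whose naturality is known.
    rw [← cancel_mono (P.χ₁.app ((P.Q 1).obj D))]
    have h : ∀ C, cofreeLift (P.isCoalgebra_coaction C) (𝟙 ((P.Q 1).obj C)) ≫
        P.χ₁.app ((P.Q 1).obj C) = P.coaction.app C := fun C =>
      (cofreeLift_χ₁ (P.isCoalgebra_coaction C) (𝟙 ((P.Q 1).obj C))).trans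
        ((congrArg (P.coaction.app C ≫ ·) (P.hat.map_id _)).trans (Category.comp_id _))
    refine (Category.assoc _ _ _).trans ((congrArg ((P.Q 1).map f ≫ ·) (h D)).trans ?_)
    refine Eq.trans ?_ (Category.assoc _ _ _).symm
    refine Eq.trans ?_ (congrArg (_ ≫ ·) (P.χ₁.naturality ((P.Q 1).map f))).symm
    refine Eq.trans ?_ (Category.assoc _ _ _)
    refine Eq.trans ?_ (congrArg (· ≫ P.hat.map ((P.Q 1).map f)) (h C)).symm
    exact P.coaction.naturality f

lemma comult_χ₁ (C : X → Cplx k c) :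
    P.comult.app C ≫ P.χ₁.app ((P.Q 1).obj C) = P.coaction.app C := by
  exact (cofreeLift_χ₁ (P.isCoalgebra_coaction C) (𝟙 ((P.Q 1).obj C))).trans
    ((congrArg (P.coaction.app C ≫ ·) (P.hat.map_id _)).trans (Category.comp_id _))

/-- After `χ₁` this says that the comultiplication is a morphism of coalgebras. -/
lemma comult_coassoc (C : X → Cplx k c) :
    P.comult.app C ≫ (P.Q 1).map (P.comult.app C) =
      P.comult.app C ≫ P.comult.app ((P.Q 1).obj C) := by
  rw [← cancel_mono (P.χ₁.app ((P.Q 1).obj ((P.Q 1).obj C)))]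
  refine (Category.assoc _ _ _).trans ?_
  refine (congrArg (P.comult.app C ≫ ·) (P.χ₁.naturality (P.comult.app C))).trans ?_
  refine (Category.assoc _ _ _).symm.trans ?_
  refine (congrArg (· ≫ P.hat.map (P.comult.app C)) (P.comult_χ₁ C)).trans ?_
  refine Eq.trans ?_ (Category.assoc _ _ _).symm
  refine Eq.trans ?_ (congrArg (P.comult.app C ≫ ·) (P.comult_χ₁ ((P.Q 1).obj C))).symm
  exact cofreeLift_coaction (P.isCoalgebra_coaction C) (𝟙 ((P.Q 1).obj C))

lemma isStable_firstStep : P.firstStep.IsStable where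
  mono := by
    have : ∀ C, Mono ((P.χ₁ ◫ P.χ₁).app C) := fun C => by
      have h : DegInj (P.χ₁.app C) := P.degInj_χ₁ C
      change Mono (P.χ₁.app ((P.Q 1).obj C) ≫ P.hat.map (P.χ₁.app C))
      infer_instance
    exact NatTrans.mono_of_mono_app (P.χ₁ ◫ P.χ₁)
  exists_comultiplication := by
    refine ⟨P.comult, ⟨?_, fun C => ?_⟩⟩
    · refine NatTrans.ext (funext fun C => ?_)
      refine (Category.assoc _ _ _).symm.trans ?_
      refine (congrArg (· ≫ P.hat.map (P.χ₁.app C)) (P.comult_χ₁ C)).trans ?_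
      exact P.coaction_χ₁ C
    · exact P.comult_coassoc C

lemma isStable_step (n : ℕ) : (P.step n).IsStable := by
  induction n with
  | zero => exact P.isStable_firstStep
  | succ n ih => exact ih.next

lemma isIso_χ (n : ℕ) (hn : 1 ≤ n) : IsIso (P.χ n) := by
  obtain ⟨m, rfl⟩ := Nat.exists_eq_add_of_le' hn
  exact (P.isStable_step m).isIso

/-- Each transition map down to level `1` is a composite of maps `χ n` with `n ≥ 1`; the map `χ 0`
from `Q_1` to `Q_0` does not occur. -/
lemma isEventuallyConstantTo_tower : P.tower.IsEventuallyConstantTo (Opposite.op 1) := by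
  have key : ∀ n (h : 1 ≤ 1 + n), IsIso (P.tower.map (homOfLE h).op) := by
    intro n
    induction n with
    | zero =>
      intro h
      have : (homOfLE h).op = 𝟙 (Opposite.op 1) := rfl
      rw [this]
      infer_instance
    | succ n ih =>
      intro h
      have e : (homOfLE h).op = (homOfLE (Nat.le_add_right (1 + n) 1)).op ≫
        (homOfLE (Nat.le_add_right 1 n)).op := rfl
      have h1 : P.tower.map (homOfLE (Nat.le_add_right (1 + n) 1)).op = P.χ (1 + n) :=
        Functor.ofOpSequence_map_homOfLE_succ P.χ (1 + n)
      have h2 := ih (Nat.le_add_right 1 n)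
      have h3 : IsIso (P.tower.map (homOfLE (Nat.le_add_right (1 + n) 1)).op) := by
        rw [h1]
        exact P.isIso_χ _ (Nat.le_add_right 1 n)
      rw [e, Functor.map_comp]
      infer_instance
  rintro ⟨m⟩ f
  obtain ⟨n, rfl⟩ := Nat.exists_eq_add_of_le f.unop.le
  exact key n f.unop.le

lemma recursionStops : P.RecursionStops :=
  ⟨P.isIso_χ, P.isEventuallyConstantTo_tower.isIso_π_of_isLimit (Limits.limit.isLimit P.tower)⟩

end Operad

end Recursion

end

end OperadCoalg

theorem mainTheorem3 (k : Type u) [Field k] (X : Type u) :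
    (∀ P : OperadCoalg.Operad k OperadCoalg.vectShape X,
      P.RecursionStops ∧ P.IsRepresentativeSubobject ∧ P.IsCofreeCoalgebraFunctor) ∧
    (∀ P : OperadCoalg.Operad k (ComplexShape.down ℤ) X,
      P.RecursionStops ∧ P.IsRepresentativeSubobject ∧ P.IsCofreeCoalgebraFunctor) :=
  ⟨fun P => ⟨P.recursionStops, P.isRepresentativeSubobject, P.isCofreeCoalgebraFunctor⟩,
    fun P => ⟨P.recursionStops, P.isRepresentativeSubobject, P.isCofreeCoalgebraFunctor⟩⟩
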